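/- **Setting.** Let $G$ be a locally compact second countable topological group acting in a Borel way (jointly measurably) on a standard Borel space $X$ with discrete stabilizers: for every $x\in X$ some neighbourhood of the identity $e$ contains no $g\neq e$ with $gx=x$. Let $\lambda$ be a Borel probability measure on $X$. Let $\alpha_X:X\to X$ be a Borel automorphism and $\alpha_G:G\to G$ a group automorphism with $\alpha_X(gx)=\alpha_G(g)\,\alpha_X(x)$ for all $g\in G$, $x\in X$. Assume that $\lambda$ is $\alpha_X$-invariant and $\alpha_X$-ergodic, and that $G$ carries a compatible right-invariant metric $d$ such that, for some $\alpha\in(0,1)$, $d(\alpha_G g,\alpha_G h)=\alpha\, d(g,h)$ for all $g,h\in G$. Let $H$ be a closed normal subgroup of $G$ with $\alpha_G(H)=H$, endowed with the restricted metric, let $\pi:G\to G/H$ be the quotient map, and endow $G/H$ with the metric $d(p,q)=\inf\{d(g,g')\,;\,\pi(g)=p,\ \pi(g')=q\}$. **Disintegration along a group.** For $L\in\{G,H\}$, let $\sigma_L$ denote the disintegration of $\lambda$ along $L$: it maps $x\in X$ to a non-zero Radon measure on $L$ defined up to a positive scalar, and is unique up to a $\lambda$-null set. It is characterized as follows. Let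 $\Sigma\subset X$ be a complete lacunary section for $L$, i.e. a Borel set such that, for some compact symmetric neighbourhood $U$ of the identity in $L$, one has $U^2\Sigma=X$, and $y,gy\in\Sigma$ with $g\in U$ implies $gy=y$. Let $a^*\lambda=\int \mathrm{Card}_{a^{-1}(x)}\,d\lambda(x)$ on $L\times\Sigma$, where $a(g,y)=gy$. Let $\lambda_\Sigma$ be the projection to $\Sigma$ of a finite measure equivalent to $a^*\lambda$, and disintegrate $a^*\lambda=\int \sigma_\Sigma(y)\otimes\delta_y\,d\lambda_\Sigma(y)$. Then there is a $\lambda$-conull set $X'\subset X$ such that, for $\lambda_\Sigma$-almost every $y\in\Sigma$ and every $g\in L$ with $gy\in X'$, the push-forward of $\sigma_L(gy)$ under $h\mapsto hg$ is a positive multiple of $\sigma_\Sigma(y)$. **Proposition.** There exist real numbers $\dim(\lambda,G)$, $\dim(\lambda,H)$ and $\underline{\dim}^{\mathrm T}(\lambda,G/H)$ with the following properties. 1. For $L=G$ and for $L=H$: for $\lambda$-almost every $x\in X$ and $\sigma_L(x)$-almost every $g\in L$, $$\lim_{\rho\to0}\frac{\log\sigma_L(x)(B(g,\rho))}{\log\rho}=\dim(\lambda,L).$$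 2. (The transverse dimension is almost surely constant.) For every compact neighbourhood $B$ of the identity in $G$, let $\theta^B(x)=\pi_*\left(\dfrac{\sigma_G(x)|_B}{\sigma_G(x)(B)}\right)$. Then for $\lambda$-almost every $x\in X$ and $\theta^B(x)$-almost every $q\in G/H$, $$\liminf_{\rho\to0}\frac{\log\theta^B(x)(B(q,\rho))}{\log\rho}=\underline{\dim}^{\mathrm T}(\lambda,G/H).$$ 3. $\dim(\lambda,G)\ \ge\ \dim(\lambda,H)+\underline{\dim}^{\mathrm T}(\lambda,G/H)$. -/

import Mathlib

open MeasureTheory ProbabilityTheory Filter Topology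
open scoped ENNReal

/-- The action of `G` on `X` has discrete stabilizers. -/
def HasDiscreteStabilizers (G X : Type*) [Group G] [TopologicalSpace G] [MulAction G X] : Prop :=
  ∀ x : X, ∃ V ∈ 𝓝 (1 : G), ∀ g ∈ V, g • x = x → g = 1

/-- `S` is a (Borel) complete lacunary section: for some compact symmetric neighbourhood `U` of
the identity, `S` is `U`-lacunary and `U²`-complete. -/
def IsCompleteLacunarySection (G : Type*) {X : Type*} [Group G] [TopologicalSpace G]
    [MeasurableSpace X] [MulAction G X] (S : Set X) : Prop :=
  MeasurableSet S ∧ ∃ U : Set G, IsCompact U ∧ U ∈ 𝓝 (1 : G) ∧ (∀ g ∈ U, g⁻¹ ∈ U) ∧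
    (∀ y ∈ S, ∀ g ∈ U, g • y ∈ S → g • y = y) ∧
    (∀ x : X, ∃ g ∈ U, ∃ h ∈ U, ∃ y ∈ S, (g * h) • y = x)

/-- `A` is the measure `∫ dμ(x) Card_{a⁻¹(x)}`, where `a : S × G → X`, `a (y, g) = g • y`. It is
written as a measure on `X × G`; it is carried by `S × G`. -/
def IsLiftToSection {G X : Type*} [MeasurableSpace G] [MeasurableSpace X] [SMul G X]
    (μ : Measure X) (S : Set X) (A : Measure (X × G)) : Prop :=
  ∀ B : Set (X × G), MeasurableSet B →
    A B = ∫⁻ x, Measure.count {p : X × G | p ∈ B ∧ p.1 ∈ S ∧ p.2 • p.1 = x} ∂μ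

/-- `ν` is a pseudo-image of `A` on the first factor: the push-forward of some finite measure
equivalent to `A`. -/
def IsPseudoImage {G X : Type*} [MeasurableSpace G] [MeasurableSpace X]
    (A : Measure (X × G)) (ν : Measure X) : Prop :=
  ∃ m : Measure (X × G), IsFiniteMeasure m ∧ m ≪ A ∧ A ≪ m ∧ ν = m.map Prod.fst

/-- `σ` is the disintegration of `μ` along the action of `G`, with `σ x` a representative of the
projective class attached to `x`. Let `S` be a complete lacunary section, `A` the lift of `μ`,
`ν` a pseudo-image of `A`, and `A = ∫ dν(y) δ_y ⊗ κ y`. There is a conull set `X'` such that, for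
almost every `y` and every `g` with `g • y ∈ X'`, the push-forward of `σ (g • y)` through
`h ↦ h * g` is a positive finite multiple of `κ y`. -/
def IsDisintegrationAlong {G X : Type*} [Group G] [TopologicalSpace G] [MeasurableSpace G]
    [MeasurableSpace X] [MulAction G X] (μ : Measure X) (σ : X → Measure G) : Prop :=
  ∃ (S : Set X) (A : Measure (X × G)) (ν : Measure X) (κ : Kernel X G),
    IsCompleteLacunarySection G S ∧ IsLiftToSection μ S A ∧ IsPseudoImage A ν ∧
    IsSFiniteKernel κ ∧ A = ν ⊗ₘ κ ∧
    ∃ X' ∈ ae μ, ∀ᵐ y ∂ν, ∀ g : G, g • y ∈ X' →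
      ∃ c : ℝ≥0∞, c ≠ 0 ∧ c ≠ ∞ ∧ (σ (g • y)).map (fun h => h * g) = c • κ y

/-- The quotient `log m(ρ) / log ρ`, where `m ρ` is the mass of a ball of radius `ρ`. -/
noncomputable def logRatio (m : ℝ → ℝ≥0∞) (ρ : ℝ) : EReal :=
  ENNReal.log (m ρ) / ((Real.log ρ : ℝ) : EReal)

/-- `d` is the dimension of `μ` along `G`: the conditional measures are almost surely
exact-dimensional, of dimension `d`. -/
def IsDimensionAlong (G : Type*) {X : Type*} [Group G] [PseudoMetricSpace G] [MeasurableSpace G]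
    [MeasurableSpace X] [MulAction G X] (μ : Measure X) (d : ℝ) : Prop :=
  ∀ σ : X → Measure G, IsDisintegrationAlong μ σ →
    ∀ᵐ x ∂μ, ∀ᵐ g ∂(σ x),
      Tendsto (logRatio fun ρ => σ x (Metric.ball g ρ)) (𝓝[>] 0) (𝓝 (d : EReal))

/-- The quotient distance on `G ⧸ H`: the infimum of the distances between representatives. -/
noncomputable def quotientDist {G : Type*} [Group G] [PseudoMetricSpace G] (H : Subgroup G)
    (p q : G ⧸ H) : ℝ :=
  ⨅ a : {a : G × G // (a.1 : G ⧸ H) = p ∧ (a.2 : G ⧸ H) = q}, dist a.1.1 a.1.2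

/-- The open ball of `G ⧸ H` for the quotient distance. -/
def quotientBall {G : Type*} [Group G] [PseudoMetricSpace G] (H : Subgroup G)
    (p : G ⧸ H) (ρ : ℝ) : Set (G ⧸ H) :=
  {q | quotientDist H q p < ρ}

/-- The push-forward to `G ⧸ H` of the measure `s` on `G` conditioned on `B`. -/
noncomputable def transverseMeasure {G : Type*} [Group G] [MeasurableSpace G] (H : Subgroup G)
    (s : Measure G) (B : Set G) : Measure (G ⧸ H) :=
  (ProbabilityTheory.cond s B).map (fun g : G => (g : G ⧸ H))

/-- `d` is the transverse to `H` dimension of `μ` along `G`. -/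
def IsTransverseDimension {G X : Type*} [Group G] [PseudoMetricSpace G] [MeasurableSpace G]
    [MeasurableSpace X] [MulAction G X] (H : Subgroup G) (μ : Measure X) (d : ℝ) : Prop :=
  ∀ σ : X → Measure G, IsDisintegrationAlong μ σ →
    ∀ B : Set G, IsCompact B → B ∈ 𝓝 (1 : G) →
      ∀ᵐ x ∂μ, ∀ᵐ q ∂(transverseMeasure H (σ x) B),
        liminf (logRatio fun ρ => transverseMeasure H (σ x) B (quotientBall H q ρ)) (𝓝[>] 0)
          = (d : EReal)

/-! The conditional measures along the action are rigid in two ways. Up to scalars, `σ (g • x)` is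
the right translate of `σ x` by `g⁻¹`, and `σ (αX x)` is the image of `σ x` under the contraction
`αG`. The first rule exchanges statements at the identity for almost every `x` with statements at `σ
x`-almost every `g`. The second turns the passage from radius `α ^ n` to `α ^ (n + 1)` into a change
of base point, which brings in ergodic theory.

Exact dimension: up to a term independent of `n`, `-log (σ x (B(1, α ^ n)))` is the Birkhoff sum,
for the inverse of `αX`, of `φ x = log (σ x (B(1, 1))) - log (σ x (B(1, α)))`, in which the unknown
scalars cancel. The unit ball is covered by exponentially many balls of radius `α ^ n / 2`, so
typical balls have at least exponential mass (`exists_polynomial_lower_bound`). This forces `φ` to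
be integrable, and Birkhoff's theorem gives the rate (`IsRegularFamily.exists_ae_tendsto_log_ball`).

Transverse dimension: balls of `G ⧸ H` pull back to tubes around cosets of `H`. Tubes around a
separated family have bounded overlap, so at typical points the exponent of the mass in thin tubes
does not depend on the compact window in which it is measured (`ae_cosetTube_inter_ge`). The
exponent is therefore invariant under `αX`, hence constant.

Inequality: fix `x` and let `s`, `t` be the conditional measures along `G` and `H`. By Fubini, the
`t`-average of `s (B(h, ρ))` is the integral of `t (B(u, ρ))` over `u` in a tube around `H`, so it
is at most about `ρ ^ dim H` times the mass of the tube. Markov's inequality and Borel–Cantelli give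
this bound at `t`-almost every `h` (`ae_ball_le_pow_mul_tube`), where the tube itself has mass at
most about `ρ ^ dimT`. No disintegration of `s` along the cosets of `H` is needed.

All this presupposes measurable representatives and uniqueness of the disintegration
(`IsDisintegrationAlong.exists_regularFamily`, `SectionData.ae_unique`). These rest on the null
measurability of images of Borel sets and on cutting the section into countably many boxes on which
the action is injective. -/

/-! ### The pointwise ergodic theorem -/

/-- The running maximum `max_{k ≤ n} S_k f` of the Birkhoff sums, with `S_0 f = 0`. -/
noncomputable def birkhoffMax {X : Type*} (T : X → X) (f : X → ℝ) : ℕ → X → ℝ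
  | 0 => fun _ => 0
  | n + 1 => fun x => max 0 (f x + birkhoffMax T f n (T x))

section BirkhoffMax

variable {X : Type*} {T : X → X} {f : X → ℝ}

lemma birkhoffMax_nonneg (n : ℕ) (x : X) : 0 ≤ birkhoffMax T f n x := by
  cases n with
  | zero => exact le_rfl
  | succ n => exact le_max_left _ _

lemma birkhoffSum_le_birkhoffMax (n : ℕ) (x : X) : birkhoffSum T f n x ≤ birkhoffMax T f n x := by
  induction n generalizing x with
  | zero => simp [birkhoffMax]
  | succ n ih =>
    rw [birkhoffSum_succ']
    exact le_max_of_le_right (by simpa using ih (T x))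

lemma birkhoffMax_le_succ (n : ℕ) (x : X) : birkhoffMax T f n x ≤ birkhoffMax T f (n + 1) x := by
  induction n generalizing x with
  | zero => exact birkhoffMax_nonneg 1 x
  | succ n ih => exact max_le_max le_rfl (by simpa using ih (T x))

lemma birkhoffMax_mono (x : X) : Monotone fun n => birkhoffMax T f n x :=
  monotone_nat_of_le_succ fun n => birkhoffMax_le_succ n x

variable [MeasurableSpace X] {μ : Measure X}

lemma measurable_birkhoffMax (hT : Measurable T) (hf : Measurable f) (n : ℕ) :
    Measurable (birkhoffMax T f n) := by
  induction n with
  | zero => exact measurable_const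
  | succ n ih => exact measurable_const.max (hf.add (ih.comp hT))

lemma integrable_birkhoffMax (hT : MeasurePreserving T μ μ) (hf : Integrable f μ) (n : ℕ) :
    Integrable (birkhoffMax T f n) μ := by
  induction n with
  | zero => exact integrable_zero _ _ _
  | succ n ih => exact (integrable_zero _ _ _).sup (hf.add (hT.integrable_comp_of_integrable ih))

/-- If the Birkhoff sums of `f` are almost surely unbounded above, then `f` has nonnegative mean. -/
lemma integral_nonneg_of_birkhoffMax_unbounded (hT : MeasurePreserving T μ μ)
    (hf : Integrable f μ) (hunb : ∀ᵐ x ∂μ, ∀ K : ℝ, ∃ n, K < birkhoffMax T f n x) :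
    0 ≤ ∫ x, f x ∂μ := by
  have hM := integrable_birkhoffMax hT hf
  have hMT : ∀ n, Integrable (fun x => birkhoffMax T f n (T x)) μ :=
    fun n => hT.integrable_comp_of_integrable (hM n)
  -- Invariance of `μ` replaces `M_n ∘ T` by `M_n` under the integral, where `M_n` is the running
  -- maximum, and `M_n ≤ M_{n+1}`.
  have hpos : ∀ n, 0 ≤ ∫ x, (birkhoffMax T f (n + 1) x - birkhoffMax T f n (T x)) ∂μ := by
    intro n
    have h1 : ∫ x, birkhoffMax T f n (T x) ∂μ = ∫ x, birkhoffMax T f n x ∂μ := by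
      have h2 : AEStronglyMeasurable (birkhoffMax T f n) (μ.map T) := by
        rw [hT.map_eq]; exact (hM n).aestronglyMeasurable
      rw [← integral_map hT.aemeasurable h2, hT.map_eq]
    rw [integral_sub (hM _) (hMT n), h1, sub_nonneg]
    exact integral_mono (hM _) (hM _) (birkhoffMax_le_succ n)
  -- The integrand is `max (f x) (-M_n (T x))`. Since `M_n ≥ 0` it is bounded by `|f x|`, and it
  -- equals `f x` as soon as `M_n (T x) ≥ -f x`.
  have hlim : Tendsto (fun n => ∫ x, (birkhoffMax T f (n + 1) x - birkhoffMax T f n (T x)) ∂μ)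
      atTop (𝓝 (∫ x, f x ∂μ)) := by
    refine tendsto_integral_of_dominated_convergence (fun x => |f x|)
      (fun n => ((hM _).sub (hMT n)).aestronglyMeasurable) hf.abs ?_ ?_
    · intro n
      refine Eventually.of_forall fun x => ?_
      have h0 : 0 ≤ birkhoffMax T f n (T x) := birkhoffMax_nonneg n (T x)
      rw [Real.norm_eq_abs]
      simp only [birkhoffMax]
      rcases le_total 0 (f x + birkhoffMax T f n (T x)) with h | h
      · rw [max_eq_right h, add_sub_cancel_right]
      · rw [max_eq_left h, zero_sub, abs_neg, abs_of_nonneg h0]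
        linarith [neg_abs_le (f x)]
    · have hunb' : ∀ᵐ x ∂μ, ∀ K : ℝ, ∃ n, K < birkhoffMax T f n (T x) :=
        hT.quasiMeasurePreserving.ae hunb
      filter_upwards [hunb'] with x hx
      obtain ⟨N, hN⟩ := hx (-f x)
      refine tendsto_const_nhds.congr' ?_
      filter_upwards [eventually_ge_atTop N] with n hn
      have h1 := birkhoffMax_mono (T := T) (f := f) (T x) hn
      simp only [birkhoffMax]
      rw [max_eq_right (by simp only at h1; linarith)]
      ring
  exact ge_of_tendsto' hlim hpos

/-- If `f` has negative mean, its Birkhoff sums are almost surely bounded above. -/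
lemma ae_birkhoffSum_bddAbove_of_integral_neg (hT : Ergodic T μ) (hfm : Measurable f)
    (hf : Integrable f μ) (hneg : ∫ x, f x ∂μ < 0) :
    ∀ᵐ x ∂μ, ∃ K : ℝ, ∀ n, birkhoffSum T f n x ≤ K := by
  -- Passing from `x` to `T x` changes the Birkhoff sums by the finite amount `f x`, so
  -- unboundedness is an invariant event and ergodicity makes it null or conull.
  set B : Set X := {x | ∀ K : ℕ, ∃ n, (K : ℝ) < birkhoffMax T f n x} with hB
  have hBm : MeasurableSet B := by
    have : B = ⋂ K : ℕ, ⋃ n, {x | (K : ℝ) < birkhoffMax T f n x} := by ext; simp [hB]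
    rw [this]
    exact .iInter fun K => .iUnion fun n =>
      measurableSet_lt measurable_const (measurable_birkhoffMax hT.measurable hfm n)
  have hinv : T ⁻¹' B = B := by
    ext x
    simp only [Set.mem_preimage, hB, Set.mem_ofPred_eq]
    constructor
    · intro h K
      obtain ⟨K', hK'⟩ := exists_nat_gt ((K : ℝ) - f x)
      obtain ⟨n, hn⟩ := h K'
      exact ⟨n + 1, lt_max_of_lt_right (by linarith)⟩
    · intro h K
      obtain ⟨K', hK'⟩ := exists_nat_gt ((K : ℝ) + f x)
      obtain ⟨n, hn⟩ := h K'
      cases n with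
      | zero =>
        exact absurd hn (not_lt.2 (Nat.cast_nonneg K'))
      | succ n =>
        rcases lt_max_iff.1 hn with h | h
        · exact absurd h (not_lt.2 (Nat.cast_nonneg K'))
        · exact ⟨n, by linarith⟩
  rcases hT.toPreErgodic.ae_empty_or_univ hBm hinv with h | h
  · filter_upwards [h] with x hx
    have hx' : ¬ x ∈ B := by
      intro hxB
      have : (∅ : Set X) x := by rw [← hx]; exact hxB
      exact this
    simp only [hB, Set.mem_ofPred_eq, not_forall, not_exists, not_lt] at hx'
    obtain ⟨K, hK⟩ := hx'
    exact ⟨K, fun n => (birkhoffSum_le_birkhoffMax n x).trans (hK n)⟩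
  · exfalso
    refine absurd (integral_nonneg_of_birkhoffMax_unbounded hT.toMeasurePreserving hf ?_)
      (not_le.2 hneg)
    filter_upwards [h] with x hx K
    have hxB : x ∈ B := by
      have : (Set.univ : Set X) x := trivial
      rw [← hx] at this; exact this
    obtain ⟨K', hK'⟩ := exists_nat_gt K
    obtain ⟨n, hn⟩ := hxB K'
    exact ⟨n, hK'.trans hn⟩

/-- Subtracting a number strictly between the mean and `c` makes the mean negative; the resulting
upper bound `K` on the sums vanishes after division by `n`. -/
lemma ae_birkhoffSum_le_mul (hT : Ergodic T μ) [IsProbabilityMeasure μ] (hfm : Measurable f)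
    (hf : Integrable f μ) {c : ℝ} (hc : ∫ x, f x ∂μ < c) :
    ∀ᵐ x ∂μ, ∀ᶠ n : ℕ in atTop, birkhoffSum T f n x / n ≤ c := by
  obtain ⟨d, hd, hdc⟩ := exists_between hc
  have h := ae_birkhoffSum_bddAbove_of_integral_neg (f := fun x => f x - d) hT
    (hfm.sub measurable_const) (hf.sub (integrable_const d))
    (by rw [integral_sub hf (integrable_const d)]; simp; linarith)
  filter_upwards [h] with x ⟨K, hK⟩
  have hlim : Tendsto (fun n : ℕ => K / (n : ℝ) + d) atTop (𝓝 (0 + d)) :=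
    (tendsto_const_div_atTop_nhds_zero_nat K).add tendsto_const_nhds
  rw [zero_add] at hlim
  filter_upwards [hlim.eventually (gt_mem_nhds hdc), eventually_gt_atTop 0] with n hn hn0
  have hn0' : (0 : ℝ) < n := Nat.cast_pos.2 hn0
  have h1 := hK n
  simp only [birkhoffSum, Finset.sum_sub_distrib, Finset.sum_const, Finset.card_range,
    nsmul_eq_mul] at h1
  rw [div_le_iff₀ hn0']
  have h2 : K / n * n = K := div_mul_cancel₀ _ hn0'.ne'
  simp only [birkhoffSum]
  nlinarith

/-- **Birkhoff's ergodic theorem** for an ergodic probability-preserving map. -/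
theorem Ergodic.ae_tendsto_birkhoffSum_div (hT : Ergodic T μ) [IsProbabilityMeasure μ]
    (hfm : Measurable f) (hf : Integrable f μ) :
    ∀ᵐ x ∂μ, Tendsto (fun n : ℕ => birkhoffSum T f n x / n) atTop (𝓝 (∫ x, f x ∂μ)) := by
  obtain ⟨u, -, hu, hulim⟩ := exists_seq_strictAnti_tendsto (0 : ℝ)
  have h1 : ∀ᵐ x ∂μ, ∀ k : ℕ, ∀ᶠ n : ℕ in atTop, birkhoffSum T f n x / n ≤ ∫ x, f x ∂μ + u k :=
    ae_all_iff.2 fun k => ae_birkhoffSum_le_mul hT hfm hf (by linarith [hu k])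
  have h2 : ∀ᵐ x ∂μ, ∀ k : ℕ, ∀ᶠ n : ℕ in atTop,
      birkhoffSum T (fun x => - f x) n x / n ≤ - ∫ x, f x ∂μ + u k :=
    ae_all_iff.2 fun k => ae_birkhoffSum_le_mul hT hfm.neg hf.neg
      (by
        have : ∫ x, (-f) x ∂μ = - ∫ x, f x ∂μ := integral_neg f
        linarith [hu k])
  filter_upwards [h1, h2] with x hx1 hx2
  rw [tendsto_order]
  constructor
  · intro a ha
    obtain ⟨k, hk⟩ := (hulim.eventually (gt_mem_nhds (sub_pos.2 ha))).exists
    filter_upwards [hx2 k] with n hn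
    have : birkhoffSum T (fun x => - f x) n x = - birkhoffSum T f n x := by
      simp [birkhoffSum]
    rw [this, neg_div] at hn
    linarith
  · intro a ha
    obtain ⟨k, hk⟩ := (hulim.eventually (gt_mem_nhds (sub_pos.2 ha))).exists
    filter_upwards [hx1 k] with n hn
    linarith

end BirkhoffMax

/-! ### Analytic sets are universally measurable -/

/-- Choquet's capacitability argument: the coordinates of Baire space are bounded one after the
other, each time keeping the measure of the image above `c`. The bounds define a compact product,
whose image is the required compact set. -/
lemma exists_compact_subset_range_lt {X : Type*} [TopologicalSpace X] [T2Space X] [RegularSpace X]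
    [MeasurableSpace X] [OpensMeasurableSpace X] (μ : Measure X) [IsFiniteMeasure μ]
    {f : (ℕ → ℕ) → X} (hf : Continuous f) {c : ℝ≥0∞} (hc : c < μ (Set.range f)) :
    ∃ K ⊆ Set.range f, IsCompact K ∧ c ≤ μ K := by
  have step : ∀ E : Set (ℕ → ℕ), c < μ (f '' E) → ∀ n : ℕ,
      ∃ m : ℕ, c < μ (f '' (E ∩ {x | x n ≤ m})) := by
    intro E hE n
    have hU : f '' E = ⋃ m : ℕ, f '' (E ∩ {x | x n ≤ m}) := by
      rw [← Set.image_iUnion, ← Set.inter_iUnion]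
      congr 1
      have : (⋃ m : ℕ, {x : ℕ → ℕ | x n ≤ m}) = Set.univ :=
        Set.eq_univ_of_forall fun x => Set.mem_iUnion.2 ⟨x n, le_refl (x n)⟩
      rw [this, Set.inter_univ]
    have hmono : Monotone fun m : ℕ => f '' (E ∩ {x | x n ≤ m}) := fun m m' h =>
      Set.image_mono (Set.inter_subset_inter_right _ fun x hx => le_trans hx h)
    rw [hU, hmono.measure_iUnion] at hE
    exact lt_iSup_iff.1 hE
  choose! b hb using step
  let E : ℕ → Set (ℕ → ℕ) := fun n => Nat.rec Set.univ (fun n F => F ∩ {x | x n ≤ b F n}) n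
  have hEs : ∀ n, E (n + 1) = E n ∩ {x | x n ≤ b (E n) n} := fun n => rfl
  have hE : ∀ n, c < μ (f '' E n) := by
    intro n
    induction n with
    | zero => simpa [E] using hc
    | succ n ih => rw [hEs]; exact hb _ ih n
  let β : ℕ → ℕ := fun n => b (E n) n
  have hEβ : ∀ n, E n = {x | ∀ i < n, x i ≤ β i} := by
    intro n
    induction n with
    | zero => simp [E]
    | succ n ih =>
      rw [hEs, ih]
      ext x
      simp only [Set.mem_inter_iff, Set.mem_ofPred_eq, Nat.lt_succ_iff_lt_or_eq]
      constructor
      · rintro ⟨h1, h2⟩ i (hi | rfl)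
        · exact h1 i hi
        · simpa only [β, ih] using h2
      · intro h
        exact ⟨fun i hi => h i (Or.inl hi), by simpa only [β, ih] using h n (Or.inr rfl)⟩
  have hEanti : Antitone E := antitone_nat_of_succ_le fun n => by
    rw [hEs]; exact Set.inter_subset_left
  let K : Set (ℕ → ℕ) := Set.univ.pi fun i => Set.Iic (β i)
  have hK : IsCompact K := isCompact_univ_pi fun i => (Set.finite_Iic (β i)).isCompact
  refine ⟨f '' K, Set.image_subset_range _ _, hK.image hf, ?_⟩
  have hsub : (⋂ n, closure (f '' E n)) ⊆ f '' K := by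
    intro y hy
    by_contra hyK
    obtain ⟨U, V, hU, hV, hKU, hyV, hUV⟩ :=
      SeparatedNhds.of_isCompact_isCompact (hK.image hf) (isCompact_singleton (x := y))
        (Set.disjoint_singleton_right.2 hyK)
    have hyV' : y ∈ V := hyV rfl
    have hz : ∀ n, ∃ z ∈ E n, f z ∈ V := by
      intro n
      obtain ⟨w, hwV, z, hz, rfl⟩ := mem_closure_iff.1 (Set.mem_iInter.1 hy n) V hV hyV'
      exact ⟨z, hz, hwV⟩
    choose z hzE hzV using hz
    -- Truncation moves `z n` into the compact set `K` without changing its first `n` coordinates,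
    -- so a limit of truncations is also a limit of the points themselves.
    let z' : ℕ → ℕ → ℕ := fun n i => min (z n i) (β i)
    have hz' : ∀ n, z' n ∈ K := fun n i _ => Set.mem_Iic.2 (min_le_right _ _)
    obtain ⟨w, hw, φ, hφ, hlim⟩ := hK.tendsto_subseq hz'
    have hlim2 : Tendsto (z ∘ φ) atTop (𝓝 w) := by
      rw [tendsto_pi_nhds] at hlim ⊢
      intro i
      refine (hlim i).congr' ?_
      filter_upwards [hφ.tendsto_atTop.eventually_gt_atTop i] with n hn
      have : z (φ n) ∈ E (φ n) := hzE _
      rw [hEβ] at this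
      exact min_eq_left (this i hn)
    have h1 : ∀ᶠ n in atTop, f (z (φ n)) ∈ U :=
      ((hf.tendsto w).comp hlim2).eventually (hU.mem_nhds (hKU ⟨w, hw, rfl⟩))
    obtain ⟨n, hn⟩ := h1.exists
    exact Set.disjoint_left.1 hUV hn (hzV _)
  refine le_trans ?_ (measure_mono hsub)
  rw [Antitone.measure_iInter (fun m n h => closure_mono (Set.image_mono (hEanti h)))
    (fun n => isClosed_closure.measurableSet.nullMeasurableSet) ⟨0, measure_ne_top _ _⟩]
  exact le_iInf fun n => (hE n).le.trans (measure_mono subset_closure)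

lemma MeasureTheory.AnalyticSet.nullMeasurableSet_of_isFiniteMeasure {X : Type*}
    [TopologicalSpace X] [T2Space X] [RegularSpace X]
    [MeasurableSpace X] [OpensMeasurableSpace X] (μ : Measure X) [IsFiniteMeasure μ]
    {s : Set X} (hs : AnalyticSet s) : NullMeasurableSet s μ := by
  rw [AnalyticSet] at hs
  rcases hs with rfl | ⟨f, hf, rfl⟩
  · exact nullMeasurableSet_empty
  rcases eq_or_ne (μ (Set.range f)) 0 with h0 | h0
  · exact NullMeasurableSet.of_null h0
  obtain ⟨u, -, hu, hulim⟩ := exists_seq_strictMono_tendsto' (pos_iff_ne_zero.2 h0)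
  choose K hKs hK hKu using fun n => exists_compact_subset_range_lt μ hf (hu n).2
  have hm : MeasurableSet (⋃ n, K n) := .iUnion fun n => (hK n).measurableSet
  have hsub : (⋃ n, K n) ⊆ Set.range f := Set.iUnion_subset hKs
  have hle : μ (Set.range f) ≤ μ (⋃ n, K n) :=
    le_of_tendsto' hulim fun n => (hKu n).trans (measure_mono (Set.subset_iUnion K n))
  exact hm.nullMeasurableSet.congr
    (ae_eq_of_subset_of_measure_ge hsub hle hm.nullMeasurableSet (measure_ne_top _ _))

/-- Images of Borel sets under the action map or under a projection are analytic in general; this is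
what allows them to be treated as measurable up to null sets. -/
lemma MeasurableSet.nullMeasurableSet_image {Y X : Type*} [MeasurableSpace Y] [StandardBorelSpace Y]
    [MeasurableSpace X] [StandardBorelSpace X] (μ : Measure X) [IsFiniteMeasure μ] {f : Y → X}
    (hf : Measurable f) {s : Set Y} (hs : MeasurableSet s) : NullMeasurableSet (f '' s) μ := by
  let := upgradeStandardBorel X
  exact (hs.analyticSet_image hf).nullMeasurableSet_of_isFiniteMeasure μ


/-! ### Logarithmic ratios and power bounds -/

section LogRatio

variable {m : ℝ → ℝ≥0∞} {ρ : ℝ}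

lemma logRatio_of_eq_zero (h0 : 0 < ρ) (h1 : ρ < 1) (hm : m ρ = 0) : logRatio m ρ = ⊤ := by
  rw [logRatio, hm, ENNReal.log_zero, EReal.bot_div_of_neg_ne_bot]
  · exact_mod_cast Real.log_neg h0 h1
  · exact EReal.coe_ne_bot _

lemma logRatio_of_eq_top (h0 : 0 < ρ) (h1 : ρ < 1) (hm : m ρ = ⊤) : logRatio m ρ = ⊥ := by
  rw [logRatio, hm, ENNReal.log_top, EReal.top_div_of_neg_ne_bot]
  · exact_mod_cast Real.log_neg h0 h1
  · exact EReal.coe_ne_bot _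

lemma logRatio_of_eq_ofReal {v : ℝ} (hv : 0 < v) (hm : m ρ = ENNReal.ofReal v) :
    logRatio m ρ = ((Real.log v / Real.log ρ : ℝ) : EReal) := by
  rw [logRatio, hm, ENNReal.log_ofReal_of_pos hv, EReal.coe_div]

/-- Since `log ρ < 0`, lower bounds on the ratio are upper bounds on the mass. The equivalence
survives masses `0` and `∞`, so later estimates use powers of `ρ` only. -/
lemma coe_le_logRatio_iff (h0 : 0 < ρ) (h1 : ρ < 1) (t : ℝ) :
    (t : EReal) ≤ logRatio m ρ ↔ m ρ ≤ ENNReal.ofReal (ρ ^ t) := by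
  rcases eq_or_ne (m ρ) 0 with hm | hm
  · simp [logRatio_of_eq_zero h0 h1 hm, hm]
  rcases eq_or_ne (m ρ) ⊤ with hm' | hm'
  · simp [logRatio_of_eq_top h0 h1 hm', hm']
  have hv : 0 < (m ρ).toReal := ENNReal.toReal_pos hm hm'
  rw [logRatio_of_eq_ofReal hv (ENNReal.ofReal_toReal hm').symm, EReal.coe_le_coe_iff,
    le_div_iff_of_neg (Real.log_neg h0 h1), ← Real.log_rpow h0,
    Real.log_le_log_iff hv (Real.rpow_pos_of_pos h0 t), ENNReal.le_ofReal_iff_toReal_le hm'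
    (Real.rpow_pos_of_pos h0 t).le]

lemma logRatio_le_coe_iff (h0 : 0 < ρ) (h1 : ρ < 1) (t : ℝ) :
    logRatio m ρ ≤ (t : EReal) ↔ ENNReal.ofReal (ρ ^ t) ≤ m ρ := by
  have hp := Real.rpow_pos_of_pos h0 t
  rcases eq_or_ne (m ρ) 0 with hm | hm
  · simp [logRatio_of_eq_zero h0 h1 hm, hm, hp]
  rcases eq_or_ne (m ρ) ⊤ with hm' | hm'
  · simp [logRatio_of_eq_top h0 h1 hm', hm']
  have hv : 0 < (m ρ).toReal := ENNReal.toReal_pos hm hm'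
  rw [logRatio_of_eq_ofReal hv (ENNReal.ofReal_toReal hm').symm, EReal.coe_le_coe_iff,
    div_le_iff_of_neg (Real.log_neg h0 h1), ← Real.log_rpow h0,
    Real.log_le_log_iff hp hv, ENNReal.ofReal_le_iff_le_toReal hm']

end LogRatio

/-! ### Reduction of small radii to the geometric scales `α ^ n` -/

section Scales

variable {m : ℝ → ℝ≥0∞} {α : ℝ}

lemma eventually_scale_mem (h0 : 0 < α) (h1 : α < 1) {p : ℝ → Prop}
    (h : ∀ᶠ ρ in 𝓝[>] (0 : ℝ), p ρ) : ∀ᶠ n : ℕ in atTop, p (α ^ n) := by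
  refine Tendsto.eventually (f := fun n : ℕ => α ^ n) ?_ h
  exact tendsto_nhdsWithin_iff.2 ⟨tendsto_pow_atTop_nhds_zero_of_lt_one h0.le h1,
    Eventually.of_forall fun n => pow_pos h0 n⟩

/-- Every small radius lies in a scale interval `(α ^ (n + 1), α ^ n]`, with `n` large. -/
lemma eventually_exists_scale (h0 : 0 < α) (h1 : α < 1) {q : ℕ → Prop}
    (hq : ∀ᶠ n in atTop, q n) :
    ∀ᶠ ρ in 𝓝[>] (0 : ℝ), ∃ n, q n ∧ q (n + 1) ∧ α ^ (n + 1) < ρ ∧ ρ ≤ α ^ n := by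
  obtain ⟨N, hN⟩ := eventually_atTop.1 hq
  filter_upwards [Ioo_mem_nhdsGT (pow_pos h0 N)] with ρ hρ
  obtain ⟨n, hn1, hn2⟩ := exists_nat_pow_near_of_lt_one hρ.1
    (hρ.2.le.trans (pow_le_one₀ h0.le h1.le)) h0 h1
  have hNn : N ≤ n := by
    by_contra h
    have : α ^ N ≤ α ^ (n + 1) := pow_le_pow_of_le_one h0.le h1.le (by omega)
    linarith [hρ.2]
  exact ⟨n, hN n hNn, hN _ (by omega), hn1, hn2⟩

/-- Multiplicative constants cost only an arbitrarily small loss in the exponent. -/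
lemma eventually_rpow_absorb {c : ℝ} {t t' : ℝ} (ht : t' < t) :
    ∀ᶠ ρ in 𝓝[>] (0 : ℝ), c * ρ ^ t ≤ ρ ^ t' := by
  have h1 : Tendsto (fun ρ : ℝ => c * ρ ^ (t - t')) (𝓝[>] 0) (𝓝 0) := by
    have h2 : ContinuousAt (fun ρ : ℝ => ρ ^ (t - t')) 0 :=
      Real.continuousAt_rpow_const 0 _ (Or.inr (by linarith))
    have h3 : Tendsto (fun ρ : ℝ => ρ ^ (t - t')) (𝓝[>] 0) (𝓝 0) := by
      have h4 := h2.tendsto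
      rw [Real.zero_rpow (by linarith)] at h4
      exact h4.mono_left nhdsWithin_le_nhds
    simpa using h3.const_mul c
  filter_upwards [h1.eventually (gt_mem_nhds one_pos), self_mem_nhdsWithin] with ρ hρ hρ0
  have hρ0' : (0 : ℝ) < ρ := hρ0
  have h5 : ρ ^ t = ρ ^ (t - t') * ρ ^ t' := by
    rw [← Real.rpow_add hρ0']; ring_nf
  rw [h5, ← mul_assoc]
  exact mul_le_of_le_one_left (Real.rpow_nonneg hρ0'.le _) hρ.le

lemma le_liminf_logRatio (h0 : 0 < α) (h1 : α < 1) (hm : Monotone m) {t : ℝ} {C : ℝ≥0∞}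
    (hC : C ≠ ⊤) (h : ∀ᶠ n : ℕ in atTop, m (α ^ n) ≤ C * ENNReal.ofReal ((α ^ n) ^ t)) :
    (t : EReal) ≤ liminf (logRatio m) (𝓝[>] 0) := by
  refine EReal.ge_of_forall_gt_iff_ge.1 fun t' ht' => ?_
  have ht : t' < t := by exact_mod_cast ht'
  refine le_liminf_of_le (by isBoundedDefault) ?_
  have hCpos : 0 < C.toReal + 1 := by positivity
  have hCle : C ≤ ENNReal.ofReal (C.toReal + 1) := by
    rw [ENNReal.le_ofReal_iff_toReal_le hC hCpos.le]; linarith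
  -- The maximum covers both signs of `t`: for `t ≥ 0` one uses `α ^ n < α⁻¹ * ρ`, for `t ≤ 0` one
  -- uses `ρ ≤ α ^ n`.
  have habs := eventually_rpow_absorb (c := (C.toReal + 1) * max 1 (α⁻¹ ^ t)) ht
  filter_upwards [habs, eventually_exists_scale h0 h1 h, Ioo_mem_nhdsGT one_pos]
    with ρ hρ ⟨n, hn, _, hn1, hn2⟩ hρ1
  have hρ0 : 0 < ρ := hρ1.1
  refine (coe_le_logRatio_iff hρ0 hρ1.2 t').2 (((hm hn2).trans hn).trans ?_)
  refine (mul_le_mul_left hCle _).trans ?_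
  rw [← ENNReal.ofReal_mul hCpos.le]
  refine ENNReal.ofReal_le_ofReal (le_trans ?_ hρ)
  rw [mul_assoc]
  refine mul_le_mul_of_nonneg_left ?_ hCpos.le
  have hαn : 0 < α ^ n := pow_pos h0 n
  rcases le_total 0 t with h | h
  · have h2 : α ^ n ≤ α⁻¹ * ρ := by
      rw [inv_mul_eq_div, le_div_iff₀ h0, ← pow_succ]; exact hn1.le
    calc (α ^ n) ^ t ≤ (α⁻¹ * ρ) ^ t := Real.rpow_le_rpow hαn.le h2 h
      _ = α⁻¹ ^ t * ρ ^ t := Real.mul_rpow (by positivity) hρ0.le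
      _ ≤ _ := by gcongr; exact le_max_right _ _
  · calc (α ^ n) ^ t ≤ ρ ^ t := Real.rpow_le_rpow_of_nonpos hρ0 hn2 h
      _ ≤ _ := le_mul_of_one_le_left (by positivity) (le_max_left _ _)

lemma limsup_logRatio_le (h0 : 0 < α) (h1 : α < 1) (hm : Monotone m) {t : ℝ} {c : ℝ≥0∞}
    (hc : c ≠ 0) (h : ∀ᶠ n : ℕ in atTop, c * ENNReal.ofReal ((α ^ n) ^ t) ≤ m (α ^ n)) :
    limsup (logRatio m) (𝓝[>] 0) ≤ (t : EReal) := by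
  refine EReal.le_of_forall_lt_iff_le.1 fun t' ht' => ?_
  have ht : t < t' := by exact_mod_cast ht'
  refine limsup_le_of_le (by isBoundedDefault) ?_
  -- As `c` may be infinite, a finite positive constant below it is used instead.
  obtain ⟨d, hd0, hdc⟩ := ENNReal.lt_iff_exists_nnreal_btwn.1 (pos_iff_ne_zero.2 hc)
  have hd : (0 : ℝ) < d := by exact_mod_cast hd0
  have hle : ENNReal.ofReal (d : ℝ) ≤ c := by rw [ENNReal.ofReal_coe_nnreal]; exact hdc.le
  have habs := eventually_rpow_absorb (c := (d : ℝ)⁻¹ * max 1 (α⁻¹ ^ t)) ht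
  filter_upwards [habs, eventually_exists_scale h0 h1 h, Ioo_mem_nhdsGT one_pos]
    with ρ hρ ⟨n, _, hn, hn1, hn2⟩ hρ1
  have hρ0 : 0 < ρ := hρ1.1
  refine (logRatio_le_coe_iff hρ0 hρ1.2 t').2 (le_trans ?_ (hn.trans (hm hn1.le)))
  refine le_trans ?_ (mul_le_mul_left hle _)
  rw [← ENNReal.ofReal_mul hd.le]
  refine ENNReal.ofReal_le_ofReal ?_
  have hαn : 0 < α ^ (n + 1) := pow_pos h0 _
  have hK : ρ ^ t ≤ max 1 (α⁻¹ ^ t) * (α ^ (n + 1)) ^ t := by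
    rcases le_total 0 t with h | h
    · have h2 : ρ ≤ α⁻¹ * α ^ (n + 1) := by
        rw [pow_succ', inv_mul_cancel_left₀ h0.ne']; exact hn2
      calc ρ ^ t ≤ (α⁻¹ * α ^ (n + 1)) ^ t := Real.rpow_le_rpow hρ0.le h2 h
        _ = α⁻¹ ^ t * (α ^ (n + 1)) ^ t := Real.mul_rpow (by positivity) hαn.le
        _ ≤ _ := by gcongr; exact le_max_right _ _
    · calc ρ ^ t ≤ (α ^ (n + 1)) ^ t := Real.rpow_le_rpow_of_nonpos hαn hn1.le h
        _ ≤ _ := le_mul_of_one_le_left (by positivity) (le_max_left _ _)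
  have h3 := hρ.trans hK
  rw [mul_comm (d : ℝ)⁻¹, mul_assoc] at h3
  have h4 := le_of_mul_le_mul_left h3 (lt_of_lt_of_le one_pos (le_max_left _ _))
  rwa [inv_mul_le_iff₀ hd] at h4

lemma eventually_le_of_lt_liminf_logRatio {t : ℝ}
    (h : (t : EReal) < liminf (logRatio m) (𝓝[>] 0)) :
    ∀ᶠ ρ in 𝓝[>] (0 : ℝ), m ρ ≤ ENNReal.ofReal (ρ ^ t) := by
  filter_upwards [eventually_lt_of_lt_liminf h, Ioo_mem_nhdsGT one_pos] with ρ hρ hρ1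
  exact (coe_le_logRatio_iff hρ1.1 hρ1.2 t).1 hρ.le

lemma eventually_ge_of_limsup_logRatio_lt {t : ℝ}
    (h : limsup (logRatio m) (𝓝[>] 0) < (t : EReal)) :
    ∀ᶠ ρ in 𝓝[>] (0 : ℝ), ENNReal.ofReal (ρ ^ t) ≤ m ρ := by
  filter_upwards [eventually_lt_of_limsup_lt h, Ioo_mem_nhdsGT one_pos] with ρ hρ hρ1
  exact (logRatio_le_coe_iff hρ1.1 hρ1.2 t).1 hρ.le

end Scales


/-! ### Comparison, invariance and measurability of the exponents -/

section Scales

variable {m m₁ m₂ : ℝ → ℝ≥0∞} {α : ℝ}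

lemma ofReal_pow_mul_rpow {α : ℝ} (h0 : 0 < α) (n : ℕ) (s t : ℝ) :
    ENNReal.ofReal (α ^ s) ^ n * ENNReal.ofReal ((α ^ n) ^ t)
      = ENNReal.ofReal ((α ^ n) ^ (s + t)) := by
  rw [← ENNReal.ofReal_pow (Real.rpow_nonneg h0.le _),
    ← ENNReal.ofReal_mul (pow_nonneg (Real.rpow_nonneg h0.le _) _), Real.rpow_add (pow_pos h0 n),
    Real.rpow_pow_comm h0.le]

lemma ofReal_rpow_pow {α : ℝ} (h0 : 0 < α) (n : ℕ) (s : ℝ) :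
    ENNReal.ofReal (α ^ s) ^ n = ENNReal.ofReal ((α ^ n) ^ s) := by
  rw [← ENNReal.ofReal_pow (Real.rpow_nonneg h0.le _), Real.rpow_pow_comm h0.le]

/-- A lower bound of `m₁` by `m₂` up to subexponential factors compares the lower exponents. -/
lemma liminf_logRatio_le_of_subexp (h0 : 0 < α) (h1 : α < 1) (hm₂ : Monotone m₂)
    {C : ℝ≥0∞} (hC : C ≠ ⊤)
    (h : ∀ ε : ℝ, 0 < ε → ∀ᶠ n : ℕ in atTop,
      ENNReal.ofReal (α ^ ε) ^ n * m₂ (α ^ n) ≤ C * m₁ (α ^ n)) :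
    liminf (logRatio m₁) (𝓝[>] 0) ≤ liminf (logRatio m₂) (𝓝[>] 0) := by
  refine EReal.ge_of_forall_gt_iff_ge.1 fun t ht => ?_
  refine EReal.ge_of_forall_gt_iff_ge.1 fun t' ht' => ?_
  have htt : t' < t := by exact_mod_cast ht'
  refine le_liminf_logRatio h0 h1 hm₂ hC ?_
  filter_upwards [h (t - t') (by linarith),
    eventually_scale_mem h0 h1 (eventually_le_of_lt_liminf_logRatio ht)] with n hn1 hn2
  have h3 := hn1.trans (mul_le_mul_right hn2 C)
  have hq0 : ENNReal.ofReal (α ^ (t - t')) ^ n ≠ 0 :=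
    pow_ne_zero _ (by simpa using Real.rpow_pos_of_pos h0 _)
  have hqt : ENNReal.ofReal (α ^ (t - t')) ^ n ≠ ⊤ := ENNReal.pow_ne_top ENNReal.ofReal_ne_top
  rw [← ENNReal.mul_le_mul_iff_right hq0 hqt]
  refine h3.trans (le_of_eq ?_)
  rw [mul_left_comm, ofReal_pow_mul_rpow h0]
  ring_nf

lemma liminf_logRatio_le_of_le_mul (h0 : 0 < α) (h1 : α < 1) (hm₂ : Monotone m₂)
    {C : ℝ≥0∞} (hC : C ≠ ⊤) (h : ∀ ρ, m₂ ρ ≤ C * m₁ ρ) :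
    liminf (logRatio m₁) (𝓝[>] 0) ≤ liminf (logRatio m₂) (𝓝[>] 0) := by
  refine liminf_logRatio_le_of_subexp h0 h1 hm₂ hC fun ε hε => Eventually.of_forall fun n => ?_
  refine le_trans (mul_le_of_le_one_left' ?_) (h _)
  refine pow_le_one₀ zero_le ?_
  rw [ENNReal.ofReal_le_one]
  exact Real.rpow_le_one h0.le h1.le hε.le

lemma liminf_logRatio_const_mul (h0 : 0 < α) (h1 : α < 1) (hm : Monotone m) {c : ℝ≥0∞}
    (hc0 : c ≠ 0) (hc : c ≠ ⊤) :
    liminf (logRatio fun ρ => c * m ρ) (𝓝[>] 0) = liminf (logRatio m) (𝓝[>] 0) := by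
  refine le_antisymm (liminf_logRatio_le_of_le_mul h0 h1 hm (C := c⁻¹) (by simpa using hc0) ?_)
    (liminf_logRatio_le_of_le_mul h0 h1 (fun a b hab => mul_le_mul_right (hm hab) c) hc ?_)
  · intro ρ
    rw [← mul_assoc, ENNReal.inv_mul_cancel hc0 hc, one_mul]
  · exact fun ρ => le_rfl

/-- Rescaling the radius by `α` shifts `n` by one, at the cost of the constant factor `α ^ t`. -/
lemma liminf_logRatio_comp_mul (h0 : 0 < α) (h1 : α < 1) (hm : Monotone m) :
    liminf (logRatio fun ρ => m (α * ρ)) (𝓝[>] 0) = liminf (logRatio m) (𝓝[>] 0) := by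
  have key : ∀ (t : ℝ) (n : ℕ), (α ^ (n + 1)) ^ t = α ^ t * (α ^ n) ^ t := fun t n => by
    rw [pow_succ', Real.mul_rpow h0.le (pow_pos h0 n).le]
  apply le_antisymm
  · refine EReal.ge_of_forall_gt_iff_ge.1 fun t ht => ?_
    refine le_liminf_logRatio h0 h1 hm (C := ENNReal.ofReal (α ^ t)⁻¹) ENNReal.ofReal_ne_top ?_
    rw [← Filter.map_add_atTop_eq_nat 1, eventually_map]
    filter_upwards [eventually_scale_mem h0 h1 (eventually_le_of_lt_liminf_logRatio ht)] with n hn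
    rw [← pow_succ'] at hn
    rw [key, ← ENNReal.ofReal_mul (by positivity),
      inv_mul_cancel_left₀ (Real.rpow_pos_of_pos h0 t).ne']
    exact hn
  · refine EReal.ge_of_forall_gt_iff_ge.1 fun t ht => ?_
    refine le_liminf_logRatio h0 h1 (fun a b hab => hm (mul_le_mul_of_nonneg_left hab h0.le))
      (C := ENNReal.ofReal (α ^ t)) ENNReal.ofReal_ne_top ?_
    have h2 := eventually_scale_mem h0 h1 (eventually_le_of_lt_liminf_logRatio ht)
    filter_upwards [(tendsto_add_atTop_nat 1).eventually h2] with n hn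
    rw [← pow_succ', ← ENNReal.ofReal_mul (by positivity), ← key]
    exact hn

/-- Countably many radii determine the lower exponent, which makes it measurable in a parameter. -/
lemma liminf_logRatio_eq_liminf_scale (h0 : 0 < α) (h1 : α < 1) (hm : Monotone m) :
    liminf (logRatio m) (𝓝[>] 0) = liminf (fun n : ℕ => logRatio m (α ^ n)) atTop := by
  have hlt : ∀ᶠ n : ℕ in atTop, 0 < α ^ n ∧ α ^ n < 1 :=
    eventually_scale_mem h0 h1 (Ioo_mem_nhdsGT one_pos)
  apply le_antisymm
  · refine EReal.ge_of_forall_gt_iff_ge.1 fun t ht => ?_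
    refine le_liminf_of_le (by isBoundedDefault) ?_
    filter_upwards [eventually_scale_mem h0 h1 (eventually_le_of_lt_liminf_logRatio ht), hlt]
      with n hn hn1
    exact (coe_le_logRatio_iff hn1.1 hn1.2 t).2 hn
  · refine EReal.ge_of_forall_gt_iff_ge.1 fun t ht => ?_
    refine le_liminf_logRatio h0 h1 hm (C := 1) ENNReal.one_ne_top ?_
    filter_upwards [eventually_lt_of_lt_liminf ht, hlt] with n hn hn1
    rw [one_mul]
    exact (coe_le_logRatio_iff hn1.1 hn1.2 t).1 hn.le

lemma measurable_liminf_logRatio (h0 : 0 < α) (h1 : α < 1) {Y : Type*} [MeasurableSpace Y]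
    {m : Y → ℝ → ℝ≥0∞} (hm : ∀ y, Monotone (m y)) (hmeas : ∀ n : ℕ, Measurable fun y => m y (α ^ n)) :
    Measurable fun y => liminf (logRatio (m y)) (𝓝[>] 0) := by
  simp_rw [fun y => liminf_logRatio_eq_liminf_scale h0 h1 (hm y)]
  refine Measurable.liminf fun n => ?_
  have hdiv : Measurable fun a : EReal => a / ((Real.log (α ^ n) : ℝ) : EReal) := by
    refine Antitone.measurable (EReal.antitone_div_right_of_nonpos ?_)
    exact_mod_cast Real.log_nonpos (pow_pos h0 n).le (pow_le_one₀ h0.le h1.le)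
  exact hdiv.comp (ENNReal.measurable_log.comp (hmeas n))

/-- Matching power bounds at the scales `α ^ n` give convergence of the logarithmic ratio. -/
lemma tendsto_logRatio_of_scale (h0 : 0 < α) (h1 : α < 1) (hm : Monotone m) {d : ℝ}
    (hpos : ∀ n : ℕ, m (α ^ n) ≠ 0) (htop : ∀ n : ℕ, m (α ^ n) ≠ ⊤)
    (h : Tendsto (fun n : ℕ => Real.log (m (α ^ n)).toReal / n) atTop (𝓝 (d * Real.log α))) :
    Tendsto (logRatio m) (𝓝[>] 0) (𝓝 (d : EReal)) := by
  have hlog := Real.log_neg h0 h1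
  have hrepr : ∀ n, m (α ^ n) = ENNReal.ofReal (Real.exp (Real.log (m (α ^ n)).toReal)) :=
    fun n => by
      rw [Real.exp_log (ENNReal.toReal_pos (hpos n) (htop n)), ENNReal.ofReal_toReal (htop n)]
  have hpow : ∀ (n : ℕ) (t : ℝ), (α ^ n) ^ t = Real.exp (n * (t * Real.log α)) := fun n t => by
    rw [Real.rpow_def_of_pos (pow_pos h0 n), Real.log_pow]; ring_nf
  refine tendsto_of_le_liminf_of_limsup_le ?_ ?_
  · refine EReal.ge_of_forall_gt_iff_ge.1 fun t ht => ?_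
    have ht' : t < d := by exact_mod_cast ht
    refine le_liminf_logRatio h0 h1 hm (C := 1) ENNReal.one_ne_top ?_
    have h2 : d * Real.log α < t * Real.log α := mul_lt_mul_of_neg_right ht' hlog
    filter_upwards [h.eventually (gt_mem_nhds h2), eventually_gt_atTop 0] with n hn hn0
    rw [one_mul, hrepr n, hpow]
    refine ENNReal.ofReal_le_ofReal (Real.exp_le_exp.2 ?_)
    rw [div_lt_iff₀ (by exact_mod_cast hn0)] at hn
    linarith
  · refine EReal.le_of_forall_lt_iff_le.1 fun t ht => ?_
    have ht' : d < t := by exact_mod_cast ht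
    refine limsup_logRatio_le h0 h1 hm (c := 1) one_ne_zero ?_
    have h2 : t * Real.log α < d * Real.log α := mul_lt_mul_of_neg_right ht' hlog
    filter_upwards [h.eventually (lt_mem_nhds h2), eventually_gt_atTop 0] with n hn hn0
    rw [one_mul, hrepr n, hpow]
    refine ENNReal.ofReal_le_ofReal (Real.exp_le_exp.2 ?_)
    rw [lt_div_iff₀ (by exact_mod_cast hn0)] at hn
    linarith

lemma tendsto_logRatio_const_mul (h0 : 0 < α) (h1 : α < 1) (hm : Monotone m) {d : ℝ} {c : ℝ≥0∞}
    (hc0 : c ≠ 0) (hc : c ≠ ⊤) (h : Tendsto (logRatio m) (𝓝[>] 0) (𝓝 (d : EReal))) :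
    Tendsto (logRatio fun ρ => c * m ρ) (𝓝[>] 0) (𝓝 (d : EReal)) := by
  refine tendsto_of_le_liminf_of_limsup_le ?_ ?_
  · rw [liminf_logRatio_const_mul h0 h1 hm hc0 hc, h.liminf_eq]
  · refine EReal.le_of_forall_lt_iff_le.1 fun t ht => ?_
    rw [← h.limsup_eq] at ht
    refine limsup_logRatio_le h0 h1 (fun a b hab => mul_le_mul_right (hm hab) c) hc0 ?_
    filter_upwards [eventually_scale_mem h0 h1 (eventually_ge_of_limsup_logRatio_lt ht)] with n hn
    exact mul_le_mul_right hn c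

end Scales


/-! ### Groups with a right-invariant metric and a contracting similarity -/

section Geometry

variable {G : Type*} [Group G] [MetricSpace G]

lemma dist_eq_dist_mul_inv_one (hdist : ∀ g h k : G, dist (g * k) (h * k) = dist g h) (g h : G) :
    dist g h = dist (g * h⁻¹) 1 := by
  rw [← hdist g h h⁻¹, mul_inv_cancel]

/-- The similarity `u ↦ αG ^ n u * g` of ratio `α ^ n`. -/
lemma exists_similarity (hdist : ∀ g h k : G, dist (g * k) (h * k) = dist g h) {α : ℝ}
    {αG : G ≃* G} (hsim : ∀ g h : G, dist (αG g) (αG h) = α * dist g h) (n : ℕ) (g : G) :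
    ∃ τ : G ≃ G, τ 1 = g ∧ ∀ u v, dist (τ u) (τ v) = α ^ n * dist u v := by
  have hit : ∀ (n : ℕ) (u v : G), dist ((αG ^ n : MulAut G) u) ((αG ^ n : MulAut G) v)
      = α ^ n * dist u v := by
    intro n
    induction n with
    | zero => simp
    | succ n ih =>
      intro u v
      rw [pow_succ' αG]
      change dist (αG ((αG ^ n : MulAut G) u)) (αG ((αG ^ n : MulAut G) v)) = _
      rw [hsim, ih, pow_succ']
      ring
  refine ⟨(MulEquiv.toEquiv (αG ^ n : MulAut G)).trans (Equiv.mulRight g), ?_, fun u v => ?_⟩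
  · simp
  · simp only [Equiv.trans_apply, Equiv.coe_mulRight, hdist]
    exact hit n u v

/-- A power of the contraction shrinks any closed ball, up to a translation, into a compact ball
around the identity; the inverse similarity is Lipschitz and carries compactness back. -/
lemma properSpace_of_contracting [LocallyCompactSpace G]
    (hdist : ∀ g h k : G, dist (g * k) (h * k) = dist g h) {α : ℝ} (hα0 : 0 < α) (hα1 : α < 1)
    {αG : G ≃* G} (hsim : ∀ g h : G, dist (αG g) (αG h) = α * dist g h) : ProperSpace G := by
  refine ⟨fun x R => ?_⟩
  obtain ⟨K, hK, hKn⟩ := exists_compact_mem_nhds (1 : G)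
  obtain ⟨r, hr, hrK⟩ := Metric.nhds_basis_closedBall.mem_iff.1 hKn
  obtain ⟨n, hn⟩ := exists_pow_lt_of_lt_one (show 0 < r / (|R| + 1) by positivity) hα1
  obtain ⟨τ, -, hτ⟩ := exists_similarity hdist hsim n (1 : G)
  have hαn : 0 < α ^ n := pow_pos hα0 n
  -- With exponent `0` this is merely an isometry taking `1` to `τ x`.
  obtain ⟨τ', hτ'1, hτ'⟩ := exists_similarity hdist hsim 0 (τ x)
  have hinv : ∀ u v, dist (τ.symm u) (τ.symm v) = (α ^ n)⁻¹ * dist u v := fun u v => by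
    have := hτ (τ.symm u) (τ.symm v)
    simp only [Equiv.apply_symm_apply] at this
    rw [this, inv_mul_cancel_left₀ hαn.ne']
  have hcont : Continuous fun u => τ.symm (τ' u) := by
    have : LipschitzWith (Real.toNNReal ((α ^ n)⁻¹)) fun u => τ.symm (τ' u) :=
      LipschitzWith.of_dist_le_mul fun u v => by
        rw [hinv, hτ', pow_zero, one_mul, Real.coe_toNNReal _ (inv_pos.2 hαn).le]
    exact this.continuous
  have hcl : IsCompact (Metric.closedBall (1 : G) r) := hK.of_isClosed_subset
    Metric.isClosed_closedBall hrK
  refine (hcl.image hcont).of_isClosed_subset Metric.isClosed_closedBall fun y hy => ?_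
  refine ⟨τ'.symm (τ y), ?_, by simp⟩
  have h1 := hτ' (τ'.symm (τ y)) 1
  rw [Equiv.apply_symm_apply, hτ'1, hτ, pow_zero, one_mul] at h1
  rw [Metric.mem_closedBall, ← h1]
  rw [Metric.mem_closedBall] at hy
  rw [lt_div_iff₀ (by positivity)] at hn
  calc α ^ n * dist y x ≤ α ^ n * (|R| + 1) := by
        gcongr; linarith [le_abs_self R]
    _ ≤ r := hn.le

/-- The unit ball is covered by at most `N ^ (n + 1)` balls of radius `α ^ n / 2`. -/
lemma exists_covering_number [ProperSpace G]
    (hdist : ∀ g h k : G, dist (g * k) (h * k) = dist g h) {α : ℝ} (hα0 : 0 < α)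
    {αG : G ≃* G} (hsim : ∀ g h : G, dist (αG g) (αG h) = α * dist g h) (hα1 : α < 1) :
    ∃ N : ℕ, ∀ n : ℕ, ∃ F : Finset G, F.card ≤ N ^ (n + 1) ∧
      Metric.ball (1 : G) 1 ⊆ ⋃ g ∈ F, Metric.ball g (α ^ n / 2) := by
  classical
  obtain ⟨t, -, htf, ht⟩ := (isCompact_closedBall (1 : G) 1).finite_cover_balls (half_pos hα0)
  lift t to Finset G using htf
  refine ⟨t.card, fun n => ?_⟩
  induction n with
  | zero =>
    refine ⟨t, by simp, fun u hu => ?_⟩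
    obtain ⟨y, hy, huy⟩ := Set.mem_iUnion₂.1 (ht (Metric.ball_subset_closedBall hu))
    refine Set.mem_iUnion₂.2 ⟨y, hy, Metric.ball_subset_ball ?_ huy⟩
    rw [pow_zero]; linarith
  | succ n ih =>
    obtain ⟨F, hF, hcov⟩ := ih
    choose τ hτ1 hτ using fun g => exists_similarity hdist hsim n g
    -- Each ball of radius `α ^ n / 2` is the image under `τ g` of a subset of the unit ball, so the
    -- image of the fixed cover by balls of radius `α / 2` covers it at the next scale.
    refine ⟨F.biUnion fun g => t.image (τ g), ?_, fun u hu => ?_⟩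
    · calc (F.biUnion fun g => t.image (τ g)).card ≤ F.card * t.card :=
            Finset.card_biUnion_le_card_mul _ _ _ fun g _ => Finset.card_image_le
        _ ≤ t.card ^ (n + 1) * t.card := Nat.mul_le_mul_right _ hF
        _ = _ := (pow_succ _ _).symm
    · obtain ⟨g, hg, hug⟩ := Set.mem_iUnion₂.1 (hcov hu)
      have hαn : 0 < α ^ n := pow_pos hα0 n
      have h1 := hτ g ((τ g).symm u) 1
      rw [Equiv.apply_symm_apply, hτ1] at h1
      rw [Metric.mem_ball, h1] at hug
      have h2 : dist ((τ g).symm u) 1 ≤ 1 := by nlinarith [dist_nonneg (x := (τ g).symm u) (y := 1)]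
      obtain ⟨y, hy, huy⟩ := Set.mem_iUnion₂.1 (ht h2)
      refine Set.mem_iUnion₂.2 ⟨τ g y, ?_, ?_⟩
      · exact Finset.mem_biUnion.2 ⟨g, hg, Finset.mem_image_of_mem _ hy⟩
      · have h3 := hτ g ((τ g).symm u) y
        rw [Equiv.apply_symm_apply] at h3
        rw [Metric.mem_ball] at huy ⊢
        rw [h3, pow_succ]
        calc α ^ n * dist ((τ g).symm u) y < α ^ n * (α / 2) := by gcongr
          _ = _ := by ring

/-- Uniform bound for the number of `α ^ n`-separated points in a ball of radius `α ^ n`. -/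
lemma exists_separated_bound [ProperSpace G]
    (hdist : ∀ g h k : G, dist (g * k) (h * k) = dist g h) {α : ℝ} (hα0 : 0 < α)
    {αG : G ≃* G} (hsim : ∀ g h : G, dist (αG g) (αG h) = α * dist g h) :
    ∃ M : ℕ, ∀ (n : ℕ) (u : G) (F : Finset G), (∀ g ∈ F, dist g u < α ^ n) →
      (∀ g ∈ F, ∀ g' ∈ F, g ≠ g' → α ^ n ≤ dist g g') → F.card ≤ M := by
  classical
  obtain ⟨t, -, htf, ht⟩ := (isCompact_closedBall (1 : G) 1).finite_cover_balls
    (show (0 : ℝ) < 1 / 2 by norm_num)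
  lift t to Finset G using htf
  refine ⟨t.card, fun n u F hF hsep => ?_⟩
  obtain ⟨τ, hτ1, hτ⟩ := exists_similarity hdist hsim n u
  have hαn : 0 < α ^ n := pow_pos hα0 n
  have hcov : ∀ g ∈ F, ∃ y ∈ t, dist (τ.symm g) y < 1 / 2 := by
    intro g hg
    have h1 := hτ (τ.symm g) 1
    rw [Equiv.apply_symm_apply, hτ1] at h1
    have h2 := hF g hg
    have h3 : τ.symm g ∈ Metric.closedBall (1 : G) 1 := by
      rw [Metric.mem_closedBall]
      nlinarith [dist_nonneg (x := τ.symm g) (y := 1)]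
    obtain ⟨y, hy, hyy⟩ := Set.mem_iUnion₂.1 (ht h3)
    exact ⟨y, hy, hyy⟩
  -- After rescaling to unit size, two points sharing a centre `c` would be at distance less than
  -- `1`, against the separation; hence `c` is injective.
  choose! c hc hcd using hcov
  refine Finset.card_le_card_of_injOn c hc fun g hg g' hg' hgg' => ?_
  by_contra hne
  have h1 := hsep g hg g' hg' hne
  have h2 := hτ (τ.symm g) (τ.symm g')
  simp only [Equiv.apply_symm_apply] at h2
  have h3 : dist (τ.symm g) (τ.symm g') < 1 := by
    have h4 := hcd g hg
    have h5 := hcd g' hg'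
    rw [← hgg'] at h5
    calc dist (τ.symm g) (τ.symm g') ≤ dist (τ.symm g) (c g) + dist (τ.symm g') (c g) :=
          dist_triangle_right _ _ _
      _ < 1 := by linarith
  nlinarith

/-! ### Tubes around the cosets of a normal subgroup -/

/-- The open tube of radius `ρ` around the coset `H g`. -/
def cosetTube (H : Subgroup G) (g : G) (ρ : ℝ) : Set G := ⋃ h ∈ H, Metric.ball (h * g) ρ

variable {H : Subgroup G} {g u : G} {ρ : ℝ}

lemma mem_cosetTube : u ∈ cosetTube H g ρ ↔ ∃ h ∈ H, dist u (h * g) < ρ := by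
  simp [cosetTube]

lemma isOpen_cosetTube : IsOpen (cosetTube H g ρ) :=
  isOpen_iUnion fun _ => isOpen_iUnion fun _ => Metric.isOpen_ball

lemma cosetTube_mono (g : G) : Monotone (cosetTube H g) := fun _ _ hab =>
  Set.iUnion₂_mono fun _ _ => Metric.ball_subset_ball hab

lemma ball_subset_cosetTube : Metric.ball g ρ ⊆ cosetTube H g ρ := fun u hu =>
  mem_cosetTube.2 ⟨1, H.one_mem, by simpa using hu⟩

lemma cosetTube_mul_left {h : G} (hh : h ∈ H) : cosetTube H (h * g) ρ = cosetTube H g ρ := by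
  ext u
  simp only [mem_cosetTube]
  constructor
  · rintro ⟨k, hk, hd⟩
    exact ⟨k * h, H.mul_mem hk hh, by rwa [mul_assoc]⟩
  · rintro ⟨k, hk, hd⟩
    exact ⟨k * h⁻¹, H.mul_mem hk (H.inv_mem hh), by simpa [mul_assoc] using hd⟩

lemma mem_cosetTube_iff_mul_inv (hdist : ∀ g h k : G, dist (g * k) (h * k) = dist g h) :
    u ∈ cosetTube H g ρ ↔ u * g⁻¹ ∈ cosetTube H 1 ρ := by
  simp only [mem_cosetTube, mul_one]
  refine exists_congr fun h => and_congr_right fun _ => ?_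
  rw [← hdist u (h * g) g⁻¹, mul_inv_cancel_right]

/-- Points of a tube, moved along the normal subgroup on the right. -/
lemma mem_cosetTube_iff_right [H.Normal] : u ∈ cosetTube H g ρ ↔ ∃ h ∈ H, dist u (g * h) < ρ := by
  rw [mem_cosetTube]
  constructor
  · rintro ⟨h, hh, hd⟩
    exact ⟨g⁻¹ * h * g, by simpa using Subgroup.Normal.conj_mem ‹_› h hh g⁻¹, by
      simpa [mul_assoc] using hd⟩
  · rintro ⟨h, hh, hd⟩
    exact ⟨g * h * g⁻¹, Subgroup.Normal.conj_mem ‹_› h hh g, by simpa [mul_assoc] using hd⟩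

/-- Normality moves the element of `H` to the right, where right-invariance of the metric lets it
pass to the other point. -/
lemma mem_cosetTube_comm [H.Normal] (hdist : ∀ g h k : G, dist (g * k) (h * k) = dist g h) :
    u ∈ cosetTube H g ρ ↔ g ∈ cosetTube H u ρ := by
  have key : ∀ u g : G, u ∈ cosetTube H g ρ → g ∈ cosetTube H u ρ := by
    intro u g hu
    obtain ⟨h, hh, hd⟩ := mem_cosetTube_iff_right.1 hu
    refine mem_cosetTube_iff_right.2 ⟨h⁻¹, H.inv_mem hh, ?_⟩
    rw [dist_comm, ← hdist _ _ h]
    simpa using hd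
  exact ⟨key u g, key g u⟩

lemma apply_mem_cosetTube_one_iff {α : ℝ} (hα0 : 0 < α) {αG : G ≃* G}
    (hsim : ∀ g h : G, dist (αG g) (αG h) = α * dist g h) (hHα : H.map (αG : G →* G) = H) :
    αG u ∈ cosetTube H 1 (α * ρ) ↔ u ∈ cosetTube H 1 ρ := by
  simp only [mem_cosetTube, mul_one]
  constructor
  · rintro ⟨h, hh, hd⟩
    rw [← hHα] at hh
    obtain ⟨k, hk, rfl⟩ := hh
    refine ⟨k, hk, ?_⟩
    have h2 : dist (αG u) (αG k) < α * ρ := hd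
    rw [hsim] at h2
    exact lt_of_mul_lt_mul_left h2 hα0.le
  · rintro ⟨h, hh, hd⟩
    refine ⟨αG h, ?_, ?_⟩
    · rw [← hHα]; exact ⟨h, hh, rfl⟩
    · rw [hsim]; gcongr

/-- This is how tubes enter. By right-invariance, both representatives can be shifted by an element
of `H` so that the first becomes `u`; the second remains in the coset of `g`. -/
lemma mem_quotientBall_iff [H.Normal] (hdist : ∀ g h k : G, dist (g * k) (h * k) = dist g h) :
    (u : G ⧸ H) ∈ quotientBall H (g : G ⧸ H) ρ ↔ u ∈ cosetTube H g ρ := by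
  have hne : Nonempty {a : G × G // (a.1 : G ⧸ H) = (u : G ⧸ H) ∧ (a.2 : G ⧸ H) = (g : G ⧸ H)} :=
    ⟨⟨(u, g), rfl, rfl⟩⟩
  have hbdd : BddBelow (Set.range fun a : {a : G × G //
      (a.1 : G ⧸ H) = (u : G ⧸ H) ∧ (a.2 : G ⧸ H) = (g : G ⧸ H)} => dist a.1.1 a.1.2) :=
    ⟨0, by rintro _ ⟨a, rfl⟩; exact dist_nonneg⟩
  change quotientDist H (u : G ⧸ H) (g : G ⧸ H) < ρ ↔ _
  rw [quotientDist, ciInf_lt_iff hbdd, mem_cosetTube_iff_right]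
  constructor
  · rintro ⟨⟨⟨a, b⟩, ha, hb⟩, hd⟩
    have ha' : u⁻¹ * a ∈ H := QuotientGroup.eq.1 ha.symm
    have hb' : g⁻¹ * b ∈ H := QuotientGroup.eq.1 hb.symm
    refine ⟨g⁻¹ * b * (u⁻¹ * a)⁻¹, H.mul_mem hb' (H.inv_mem ha'), ?_⟩
    rw [← hdist _ _ (u⁻¹ * a)]
    simpa [mul_assoc] using hd
  · rintro ⟨h, hh, hd⟩
    refine ⟨⟨(u, g * h), rfl, ?_⟩, hd⟩
    exact QuotientGroup.eq.2 (by simpa using H.inv_mem hh)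

end Geometry


/-! ### Measures of balls and tubes at typical points -/

/-- Borel–Cantelli with a geometric tail; the exceptional sets below are all estimated in this form.
-/
lemma ae_eventually_notMem_of_le_geometric {Y : Type*} [MeasurableSpace Y] {s : Measure Y}
    {E : ℕ → Set Y} {q C : ℝ≥0∞} (hq : q < 1) (hC : C ≠ ⊤)
    (h : ∀ᶠ n in atTop, s (E n) ≤ C * q ^ n) : ∀ᵐ y ∂s, ∀ᶠ n in atTop, y ∉ E n := by
  obtain ⟨N, hN⟩ := eventually_atTop.1 h
  have h1 : ∑' n, s (E (n + N)) ≠ ⊤ := by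
    refine ne_top_of_le_ne_top ?_ (ENNReal.tsum_le_tsum fun n => hN (n + N) (Nat.le_add_left _ _))
    simp_rw [pow_add, ← mul_assoc, mul_comm (C * _) (q ^ N), ← mul_assoc]
    rw [ENNReal.tsum_mul_left, ENNReal.tsum_geometric]
    refine ENNReal.mul_ne_top (ENNReal.mul_ne_top (ENNReal.pow_ne_top (hq.trans ENNReal.one_lt_top).ne) hC) ?_
    exact ENNReal.inv_ne_top.2 (tsub_pos_of_lt hq).ne'
  filter_upwards [ae_eventually_notMem h1] with y hy
  obtain ⟨K, hK⟩ := eventually_atTop.1 hy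
  refine eventually_atTop.2 ⟨K + N, fun n hn => ?_⟩
  have := hK (n - N) (by omega)
  rwa [Nat.sub_add_cancel (by omega)] at this

/-- If separated finite subsets of `E` have bounded cardinality, a maximal one exists. -/
lemma exists_maximal_separated {Y : Type*} (E : Set Y) (R : Y → Y → Prop)
    (N : ℕ) (hN : ∀ F : Finset Y, (∀ g ∈ F, g ∈ E) → (∀ g ∈ F, ∀ g' ∈ F, g ≠ g' → ¬ R g g') →
      F.card ≤ N) (hR : ∀ g g', R g g' → R g' g) :
    ∃ F : Finset Y, (∀ g ∈ F, g ∈ E) ∧ (∀ g ∈ F, ∀ g' ∈ F, g ≠ g' → ¬ R g g') ∧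
      ∀ y ∈ E, ∃ g ∈ F, y = g ∨ R y g := by
  classical
  by_contra! hcon
  have hbig : ∀ k : ℕ, ∃ F : Finset Y, (∀ g ∈ F, g ∈ E) ∧
      (∀ g ∈ F, ∀ g' ∈ F, g ≠ g' → ¬ R g g') ∧ F.card = k := by
    intro k
    induction k with
    | zero => exact ⟨∅, by simp, by simp, rfl⟩
    | succ k ih =>
      obtain ⟨F, hF1, hF2, hF3⟩ := ih
      obtain ⟨y, hy, hyF⟩ := hcon F hF1 hF2
      have hynot : y ∉ F := fun h => (hyF y h).1 rfl
      refine ⟨insert y F, ?_, ?_, by rw [Finset.card_insert_of_notMem hynot, hF3]⟩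
      · intro g hg
        rcases Finset.mem_insert.1 hg with rfl | hg
        · exact hy
        · exact hF1 g hg
      · intro g hg g' hg' hne
        rcases Finset.mem_insert.1 hg with h1 | h1 <;> rcases Finset.mem_insert.1 hg' with h2 | h2
        · exact absurd (h1.trans h2.symm) hne
        · rw [h1]; exact (hyF g' h2).2
        · rw [h2]; exact fun h => (hyF g h1).2 (hR _ _ h)
        · exact hF2 g h1 g' h2 hne
  obtain ⟨F, hF1, hF2, hF3⟩ := hbig (N + 1)
  have := hN F hF1 hF2
  omega

section

variable {G : Type*} [Group G] [MetricSpace G] [ProperSpace G] [MeasurableSpace G] [BorelSpace G]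
  {α : ℝ} {αG : G ≃* G} {H : Subgroup G} [H.Normal]

omit [BorelSpace G] in
/-- Balls around typical points have at least polynomial mass. -/
lemma exists_polynomial_lower_bound
    (hdist : ∀ g h k : G, dist (g * k) (h * k) = dist g h) (hα0 : 0 < α) (hα1 : α < 1)
    (hsim : ∀ g h : G, dist (αG g) (αG h) = α * dist g h) :
    ∃ a : ℝ, 0 < a ∧ ∀ s : Measure G, ∀ᵐ g ∂s, g ∈ Metric.ball (1 : G) 1 →
      ∀ᶠ n : ℕ in atTop, ENNReal.ofReal a ^ n ≤ s (Metric.ball g (α ^ n)) := by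
  obtain ⟨N, hN⟩ := exists_covering_number hdist hα0 hsim hα1
  have hN1 : (0 : ℝ) < N + 1 := by positivity
  -- With this rate, `N ^ (n + 1)` pieces of mass at most `a ^ n` add up to at most `N * 2⁻¹ ^ n`,
  -- which is summable.
  refine ⟨(2 * (N + 1))⁻¹, by positivity, fun s => ?_⟩
  let E : ℕ → Set G := fun n => {g | g ∈ Metric.ball (1 : G) 1 ∧
    s (Metric.ball g (α ^ n)) < ENNReal.ofReal (2 * ((N : ℝ) + 1))⁻¹ ^ n}
  have hE : ∀ n, s (E n) ≤ N * (2⁻¹ : ℝ≥0∞) ^ n := by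
    intro n
    obtain ⟨F, hF, hcov⟩ := hN n
    have hsub : E n ⊆ ⋃ g ∈ F, (Metric.ball g (α ^ n / 2) ∩ E n) := fun u hu => by
      obtain ⟨g, hg, hug⟩ := Set.mem_iUnion₂.1 (hcov hu.1)
      exact Set.mem_iUnion₂.2 ⟨g, hg, hug, hu⟩
    -- A ball of radius `α ^ n / 2` containing a bad point `u` lies inside the ball of radius `α ^
    -- n` around `u`, which has small mass by definition of `E n`.
    have hball : ∀ g ∈ F, s (Metric.ball g (α ^ n / 2) ∩ E n)
        ≤ ENNReal.ofReal (2 * ((N : ℝ) + 1))⁻¹ ^ n := by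
      intro g _
      rcases (Metric.ball g (α ^ n / 2) ∩ E n).eq_empty_or_nonempty with h | ⟨u, hu1, hu2⟩
      · rw [h, measure_empty]; exact zero_le
      · refine (measure_mono fun v hv => ?_).trans hu2.2.le
        have h1 : dist v g < α ^ n / 2 := hv.1
        have h2 : dist u g < α ^ n / 2 := hu1
        rw [Metric.mem_ball]
        linarith [dist_triangle_right v u g]
    calc s (E n) ≤ ∑ g ∈ F, s (Metric.ball g (α ^ n / 2) ∩ E n) :=
          (measure_mono hsub).trans (measure_biUnion_finset_le _ _)
      _ ≤ F.card * ENNReal.ofReal (2 * ((N : ℝ) + 1))⁻¹ ^ n := by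
          rw [← nsmul_eq_mul]; exact Finset.sum_le_card_nsmul _ _ _ hball
      _ ≤ (N : ℝ≥0∞) ^ (n + 1) * ENNReal.ofReal (2 * ((N : ℝ) + 1))⁻¹ ^ n := by
          gcongr; exact_mod_cast hF
      _ = N * (N * ENNReal.ofReal (2 * ((N : ℝ) + 1))⁻¹) ^ n := by ring
      _ ≤ N * (2⁻¹ : ℝ≥0∞) ^ n := by
          gcongr
          rw [← ENNReal.ofReal_natCast, ← ENNReal.ofReal_mul (Nat.cast_nonneg N),
            ← ENNReal.ofReal_ofNat 2, ← ENNReal.ofReal_inv_of_pos two_pos]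
          refine ENNReal.ofReal_le_ofReal ?_
          rw [mul_inv, mul_left_comm]
          refine mul_le_of_le_one_right (by norm_num) ?_
          rw [← div_eq_mul_inv, div_le_one hN1]
          linarith
  filter_upwards [ae_eventually_notMem_of_le_geometric (q := 2⁻¹) (C := N)
    (ENNReal.inv_lt_one.2 ENNReal.one_lt_two) (ENNReal.natCast_ne_top N)
    (Eventually.of_forall hE)] with g hg hg1
  filter_upwards [hg] with n hn
  exact not_lt.1 fun h => hn ⟨hg1, h⟩

/-- Tubes around a separated family have bounded overlap. -/
lemma exists_cosetTube_overlap_bound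
    (hdist : ∀ g h k : G, dist (g * k) (h * k) = dist g h) (hα0 : 0 < α)
    (hsim : ∀ g h : G, dist (αG g) (αG h) = α * dist g h) (H : Subgroup G) [H.Normal] :
    ∃ M : ℕ, ∀ (s : Measure G) (n : ℕ) (F : Finset G),
      (∀ g ∈ F, ∀ g' ∈ F, g ≠ g' → g ∉ cosetTube H g' (α ^ n)) → ∀ B : Set G,
      ∑ g ∈ F, s (B ∩ cosetTube H g (α ^ n)) ≤ M * s B := by
  classical
  obtain ⟨M, hM⟩ := exists_separated_bound hdist hα0 hsim
  refine ⟨M, fun s n F hF B => ?_⟩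
  -- Each centre whose tube contains `u` can be moved within its coset to a point `α ^ n`-close to
  -- `u`. The moved points stay `α ^ n`-separated because the original cosets are, so there are at
  -- most `M` of them.
  have hcount : ∀ u : G, ((F.filter fun g => u ∈ cosetTube H g (α ^ n)).card : ℝ≥0∞) ≤ M := by
    intro u
    have hb : ∀ g ∈ F.filter fun g => u ∈ cosetTube H g (α ^ n),
        ∃ h ∈ H, dist (g * h) u < α ^ n := by
      intro g hg
      obtain ⟨h, hh, hd⟩ := mem_cosetTube_iff_right.1 (Finset.mem_filter.1 hg).2
      exact ⟨h, hh, by rwa [dist_comm]⟩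
    choose! h hh hd using hb
    have hsep : ∀ g ∈ F.filter fun g => u ∈ cosetTube H g (α ^ n),
        ∀ g' ∈ F.filter fun g => u ∈ cosetTube H g (α ^ n), g ≠ g' →
        α ^ n ≤ dist (g * h g) (g' * h g') := by
      intro g hg g' hg' hne
      by_contra hlt
      refine hF g (Finset.mem_filter.1 hg).1 g' (Finset.mem_filter.1 hg').1 hne ?_
      refine mem_cosetTube_iff_right.2 ⟨h g' * (h g)⁻¹, H.mul_mem (hh g' hg')
        (H.inv_mem (hh g hg)), ?_⟩
      rw [← hdist _ _ (h g)]
      simpa [mul_assoc] using not_le.1 hlt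
    have hinj : Set.InjOn (fun g => g * h g) (F.filter fun g => u ∈ cosetTube H g (α ^ n)) := by
      intro g hg g' hg' heq
      by_contra hne
      have := hsep g hg g' hg' hne
      rw [show g * h g = g' * h g' from heq, dist_self] at this
      exact absurd (pow_pos hα0 n) (not_lt.2 this)
    rw [← Finset.card_image_of_injOn hinj]
    refine Nat.cast_le.2 (hM n u _ ?_ ?_)
    · intro v hv
      obtain ⟨g, hg, rfl⟩ := Finset.mem_image.1 hv
      exact hd g hg
    · intro v hv w hw hne
      obtain ⟨g, hg, rfl⟩ := Finset.mem_image.1 hv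
      obtain ⟨g', hg', rfl⟩ := Finset.mem_image.1 hw
      exact hsep g hg g' hg' fun h => hne (by rw [h])
  calc ∑ g ∈ F, s (B ∩ cosetTube H g (α ^ n))
      = ∑ g ∈ F, ∫⁻ u in B, (cosetTube H g (α ^ n)).indicator 1 u ∂s := by
        refine Finset.sum_congr rfl fun g _ => ?_
        rw [lintegral_indicator_one isOpen_cosetTube.measurableSet,
          Measure.restrict_apply isOpen_cosetTube.measurableSet, Set.inter_comm]
    _ = ∫⁻ u in B, ∑ g ∈ F, (cosetTube H g (α ^ n)).indicator 1 u ∂s := by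
        rw [lintegral_finsetSum]
        exact fun g _ => measurable_one.indicator isOpen_cosetTube.measurableSet
    _ ≤ ∫⁻ _ in B, M ∂s := by
        refine lintegral_mono fun u => ?_
        refine le_trans (le_of_eq ?_) (hcount u)
        simp [Set.indicator_apply, Finset.sum_boole]
    _ = M * s B := by simp

/-- At typical points of `B`, the mass of `B` in thin tubes is, up to subexponential factors, at
least that of a larger set `B'`. -/
lemma ae_cosetTube_inter_ge
    (hdist : ∀ g h k : G, dist (g * k) (h * k) = dist g h) (hα0 : 0 < α)
    (hsim : ∀ g h : G, dist (αG g) (αG h) = α * dist g h) (s : Measure G) {B B' : Set G}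
    (hB : IsCompact B) (hB' : s B' ≠ ⊤) {q : ℝ≥0∞} (hq : q < 1) :
    ∀ᵐ g ∂s, g ∈ B → ∀ᶠ n : ℕ in atTop,
      q ^ n * s (B' ∩ cosetTube H g (α ^ n)) ≤ s (B ∩ cosetTube H g (α ^ n)) := by
  classical
  obtain ⟨M, hM⟩ := exists_cosetTube_overlap_bound hdist hα0 hsim H
  let E : ℕ → Set G := fun n => {g | g ∈ B ∧
    s (B ∩ cosetTube H g (α ^ n)) < q ^ n * s (B' ∩ cosetTube H g (α ^ n))}
  have hE : ∀ n, s (E n) ≤ (M * s B') * q ^ n := by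
    intro n
    have hαn : 0 < α ^ n := pow_pos hα0 n
    obtain ⟨t, -, htf, ht⟩ := hB.finite_cover_balls (half_pos hαn)
    lift t to Finset G using htf
    -- Compactness of `B` only serves to make separated families finite; their size does not enter
    -- the final bound.
    obtain ⟨F, hF1, hF2, hF3⟩ := exists_maximal_separated (E n)
      (fun g g' => g ∈ cosetTube H g' (α ^ n)) t.card (fun F hFE hF => by
        have hcov : ∀ g ∈ F, ∃ y ∈ t, dist g y < α ^ n / 2 := fun g hg => by
          obtain ⟨y, hy, hyy⟩ := Set.mem_iUnion₂.1 (ht (hFE g hg).1)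
          exact ⟨y, hy, hyy⟩
        choose! c hc hcd using hcov
        refine Finset.card_le_card_of_injOn c hc fun g hg g' hg' hgg' => ?_
        by_contra hne
        refine hF g hg g' hg' hne (ball_subset_cosetTube ?_)
        have h4 := hcd g hg
        have h5 := hcd g' hg'
        rw [← hgg'] at h5
        rw [Metric.mem_ball]
        linarith [dist_triangle_right g g' (c g)])
      (fun g g' h => (mem_cosetTube_comm hdist).1 h)
    have hsub : E n ⊆ ⋃ g ∈ F, (B ∩ cosetTube H g (α ^ n)) := fun u hu => by
      obtain ⟨g, hg, hug⟩ := hF3 u hu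
      refine Set.mem_iUnion₂.2 ⟨g, hg, hu.1, ?_⟩
      rcases hug with rfl | hug
      · exact ball_subset_cosetTube (Metric.mem_ball_self hαn)
      · exact hug
    -- The centres belong to `E n`, so the mass of `B` in each tube is beaten by `q ^ n` times that
    -- of `B'`; the overlap bound then controls the sum over all tubes.
    calc s (E n) ≤ ∑ g ∈ F, s (B ∩ cosetTube H g (α ^ n)) :=
          (measure_mono hsub).trans (measure_biUnion_finset_le _ _)
      _ ≤ ∑ g ∈ F, q ^ n * s (B' ∩ cosetTube H g (α ^ n)) :=
          Finset.sum_le_sum fun g hg => (hF1 g hg).2.le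
      _ = q ^ n * ∑ g ∈ F, s (B' ∩ cosetTube H g (α ^ n)) := by rw [Finset.mul_sum]
      _ ≤ q ^ n * (M * s B') := by gcongr; exact hM s n F hF2 B'
      _ = _ := mul_comm _ _
  filter_upwards [ae_eventually_notMem_of_le_geometric hq
    (ENNReal.mul_ne_top (ENNReal.natCast_ne_top M) hB') (Eventually.of_forall hE)] with g hg hg1
  filter_upwards [hg] with n hn
  exact not_lt.1 fun h => hn ⟨hg1, h⟩

end

/-! ### Balls centred on the subgroup compared with tubes around it -/

section

variable {G : Type*} [Group G] [MetricSpace G] [ProperSpace G] [SecondCountableTopology G]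
  [MeasurableSpace G] [BorelSpace G] {α : ℝ} {H : Subgroup G}

lemma measurable_measure_ball {Y Z : Type*} [PseudoMetricSpace Y] [SecondCountableTopology Y]
    [MeasurableSpace Y] [BorelSpace Y] [MeasurableSpace Z]
    (t : Measure Y) [SFinite t] {f : Z → Y} (hf : Measurable f) (r : ℝ) :
    Measurable fun z => t (Metric.ball (f z) r) := by
  have h : MeasurableSet {p : Z × Y | dist p.2 (f p.1) < r} :=
    measurableSet_lt (measurable_snd.dist (hf.comp measurable_fst)) measurable_const
  exact measurable_measure_prodMk_left h

/-- If the balls of a measure `t` on the subgroup `H` are small at typical points, then at typical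
points of `t` the balls of a measure `s` on `G` are small compared with tubes around `H`. -/
lemma ae_ball_le_pow_mul_tube (hα0 : 0 < α) (hα1 : α < 1)
    (s : Measure G) [IsFiniteMeasureOnCompacts s] (t : Measure H) [SFinite t]
    {a b : ℝ≥0∞} (hab : a < b) (hb : b ≠ ⊤)
    (ht : ∀ᵐ h : H ∂t, ∀ᶠ n : ℕ in atTop, t (Metric.ball h (2 * α ^ n)) ≤ a ^ n) :
    ∀ᵐ h : H ∂t, ∀ᶠ n : ℕ in atTop, s (Metric.ball (h : G) (α ^ n))
      ≤ b ^ n * s (Metric.closedBall (h : G) 1 ∩ cosetTube H 1 (α ^ n)) := by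
  have hb0 : b ≠ 0 := (pos_of_gt hab).ne'
  obtain ⟨D, hDc, hDd⟩ := TopologicalSpace.exists_countable_dense H
  have main : ∀ (k : ℕ) (c : H), ∀ᵐ h : H ∂t, dist h c < 1 / 3 →
      (∀ n ≥ k, t (Metric.ball h (2 * α ^ n)) ≤ a ^ n) →
      ∀ᶠ n : ℕ in atTop, s (Metric.ball (h : G) (α ^ n))
        ≤ b ^ n * s (Metric.closedBall (h : G) 1 ∩ cosetTube H 1 (α ^ n)) := by
    intro k c
    -- Localising near `c` with a common threshold `k` gives one window `W n` of finite mass that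
    -- contains all the balls considered.
    let F : Set H := {h | dist h c < 1 / 3 ∧ ∀ n ≥ k, t (Metric.ball h (2 * α ^ n)) ≤ a ^ n}
    have hFm : MeasurableSet F := by
      have hset : {h : H | ∀ n ≥ k, t (Metric.ball h (2 * α ^ n)) ≤ a ^ n}
          = ⋂ n, ⋂ _ : n ≥ k, {h : H | t (Metric.ball h (2 * α ^ n)) ≤ a ^ n} := by ext; simp
      refine MeasurableSet.inter (s₂ := {h : H | ∀ n ≥ k, t (Metric.ball h (2 * α ^ n)) ≤ a ^ n})
        (Metric.isOpen_ball (x := c) (ε := 1 / 3)).measurableSet ?_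
      rw [hset]
      exact .iInter fun n => .iInter fun _ =>
        measurableSet_le (measurable_measure_ball t measurable_id _) measurable_const
    let W : ℕ → Set G := fun n => Metric.ball (c : G) (2 / 3) ∩ cosetTube H 1 (α ^ n)
    have hWm : ∀ n, MeasurableSet (W n) := fun n =>
      Metric.isOpen_ball.measurableSet.inter isOpen_cosetTube.measurableSet
    have hWtop : ∀ n, s (W n) ≠ ⊤ := fun n =>
      ne_top_of_le_ne_top (isCompact_closedBall (c : G) (2 / 3)).measure_lt_top.ne
        (measure_mono (Set.inter_subset_left.trans Metric.ball_subset_closedBall))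
    have hballW : ∀ n, α ^ n < 1 / 3 → ∀ h ∈ F, Metric.ball (h : G) (α ^ n) ⊆ W n := by
      intro n hn h hh u hu
      have h1 : dist (h : G) c < 1 / 3 := hh.1
      rw [Metric.mem_ball] at hu
      refine ⟨?_, mem_cosetTube.2 ⟨h, h.2, by rwa [mul_one]⟩⟩
      rw [Metric.mem_ball]
      linarith [dist_triangle u (h : G) c]
    let E : ℕ → Set H := fun n => {h | h ∈ F ∧ b ^ n * s (W n) < s (Metric.ball (h : G) (α ^ n))}
    have hE : ∀ n ≥ k, α ^ n < 1 / 3 → t (E n) ≤ 1 * (a / b) ^ n := by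
      intro n hnk hn
      rw [one_mul]
      rcases eq_or_ne (s (W n)) 0 with hW0 | hW0
      · have : E n = ∅ := by
          refine Set.eq_empty_of_forall_notMem fun h hh => ?_
          have h2 := hh.2.trans_le (measure_mono (hballW n hn h hh.1))
          rw [hW0] at h2
          exact not_lt_zero h2
        rw [this, measure_empty]
        exact zero_le
      -- Fubini: after exchanging the integrals the inner one is the `t`-mass of the points of `F`
      -- within `α ^ n` of `u`. Two such points are within `2 * α ^ n` of each other, so this mass
      -- is at most `a ^ n`.
      have hfub : ∫⁻ h in F, s (Metric.ball (h : G) (α ^ n)) ∂t ≤ a ^ n * s (W n) := by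
        have hset : MeasurableSet {p : H × G | dist p.2 (p.1 : G) < α ^ n} :=
          measurableSet_lt (measurable_snd.dist (measurable_subtype_coe.comp measurable_fst))
            measurable_const
        have hmeas : Measurable (Function.uncurry fun (h : H) (u : G) =>
            (Metric.ball (h : G) (α ^ n)).indicator (1 : G → ℝ≥0∞) u) := by
          have : (Function.uncurry fun (h : H) (u : G) =>
              (Metric.ball (h : G) (α ^ n)).indicator (1 : G → ℝ≥0∞) u)
              = {p : H × G | dist p.2 (p.1 : G) < α ^ n}.indicator 1 := by
            ext ⟨h, u⟩
            simp only [Function.uncurry, Set.indicator_apply]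
            rfl
          rw [this]
          exact measurable_one.indicator hset
        calc ∫⁻ h in F, s (Metric.ball (h : G) (α ^ n)) ∂t
            = ∫⁻ h in F, ∫⁻ u in W n,
                (Metric.ball (h : G) (α ^ n)).indicator (1 : G → ℝ≥0∞) u ∂s ∂t := by
              refine setLIntegral_congr_fun hFm fun h hh => ?_
              rw [lintegral_indicator_one Metric.isOpen_ball.measurableSet,
                Measure.restrict_apply Metric.isOpen_ball.measurableSet,
                Set.inter_eq_left.2 (hballW n hn h hh)]
          _ = ∫⁻ u in W n, ∫⁻ h in F,
                (Metric.ball (h : G) (α ^ n)).indicator (1 : G → ℝ≥0∞) u ∂t ∂s :=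
              lintegral_lintegral_swap hmeas.aemeasurable
          _ ≤ ∫⁻ _ in W n, a ^ n ∂s := by
              refine lintegral_mono fun u => ?_
              have hme : MeasurableSet {h : H | dist u (h : G) < α ^ n} :=
                measurableSet_lt (measurable_const.dist measurable_subtype_coe) measurable_const
              have : ∀ h : H, (Metric.ball (h : G) (α ^ n)).indicator (1 : G → ℝ≥0∞) u
                  = {h : H | dist u (h : G) < α ^ n}.indicator 1 h := fun h => by
                simp only [Set.indicator_apply]
                rfl
              simp_rw [this]
              rw [lintegral_indicator_one hme, Measure.restrict_apply hme]
              rcases ({h : H | dist u (h : G) < α ^ n} ∩ F).eq_empty_or_nonempty with h | ⟨h₀, h1, h2⟩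
              · rw [h, measure_empty]; exact zero_le
              · refine (measure_mono fun h hh => ?_).trans (h2.2 n hnk)
                have h3 : dist u (h : G) < α ^ n := hh.1
                have h4 : dist u (h₀ : G) < α ^ n := h1
                change dist (h : G) h₀ < _
                linarith [dist_triangle_left (h : G) h₀ u]
          _ = _ := by simp
      have hEsub : E n ⊆ {h | b ^ n * s (W n) ≤ s (Metric.ball (h : G) (α ^ n))} ∩ F :=
        fun h hh => ⟨hh.2.le, hh.1⟩
      -- Markov's inequality leaves `t (E n) ≤ (a / b) ^ n`, summable because `a < b`.
      have hmk := (mul_meas_ge_le_lintegral (μ := t.restrict F)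
        (measurable_measure_ball s measurable_subtype_coe (α ^ n)) (b ^ n * s (W n))).trans hfub
      have hbn0 : b ^ n ≠ 0 := pow_ne_zero _ hb0
      have hbnt : b ^ n ≠ ⊤ := ENNReal.pow_ne_top hb
      have h5 : b ^ n * s (W n) * t (E n) ≤ a ^ n * s (W n) := by
        exact le_trans (mul_le_mul_right ((measure_mono hEsub).trans
          (Measure.le_restrict_apply _ _)) _) hmk
      rw [mul_right_comm, ENNReal.mul_le_mul_iff_left hW0 (hWtop n)] at h5
      rw [ENNReal.div_eq_inv_mul, mul_pow, ← ENNReal.inv_pow, ← ENNReal.div_eq_inv_mul,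
        ENNReal.le_div_iff_mul_le (Or.inl hbn0) (Or.inl hbnt), mul_comm]
      exact h5
    have hev : ∀ᶠ n : ℕ in atTop, n ≥ k ∧ α ^ n < 1 / 3 :=
      (eventually_ge_atTop k).and ((tendsto_pow_atTop_nhds_zero_of_lt_one hα0.le hα1).eventually
        (gt_mem_nhds (by norm_num)))
    have hlt : a / b < 1 := by
      rw [ENNReal.div_lt_iff (Or.inl hb0) (Or.inl hb), one_mul]; exact hab
    filter_upwards [ae_eventually_notMem_of_le_geometric hlt ENNReal.one_ne_top
      (hev.mono fun n hn => hE n hn.1 hn.2)] with h hh h1 h2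
    filter_upwards [hh] with n hn
    have h3 : s (Metric.ball (h : G) (α ^ n)) ≤ b ^ n * s (W n) :=
      not_lt.1 fun h4 => hn ⟨⟨h1, h2⟩, h4⟩
    refine h3.trans ?_
    gcongr
    refine Set.inter_subset_inter_left _ fun u hu => ?_
    rw [Metric.mem_ball] at hu
    have h4 : dist (h : G) c < 1 / 3 := h1
    rw [Metric.mem_closedBall]
    linarith [dist_triangle_right u (h : G) c]
  have main' : ∀ᵐ h : H ∂t, ∀ k : ℕ, ∀ c ∈ D, dist h c < 1 / 3 →
      (∀ n ≥ k, t (Metric.ball h (2 * α ^ n)) ≤ a ^ n) →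
      ∀ᶠ n : ℕ in atTop, s (Metric.ball (h : G) (α ^ n))
        ≤ b ^ n * s (Metric.closedBall (h : G) 1 ∩ cosetTube H 1 (α ^ n)) :=
    ae_all_iff.2 fun k => (ae_ball_iff hDc).2 fun c _ => main k c
  filter_upwards [main', ht] with h hh1 hh2
  obtain ⟨k, hk⟩ := eventually_atTop.1 hh2
  obtain ⟨c, hc, hcd⟩ := hDd.exists_dist_lt h (show (0 : ℝ) < 1 / 3 by norm_num)
  exact hh1 k c hc hcd hk

end


/-! ### Regular representatives of disintegrations along a group action -/

section Lift

variable {G X : Type*} [MeasurableSpace G] [StandardBorelSpace G]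
  [MeasurableSpace X] [StandardBorelSpace X] [SMul G X] [MeasurableSMul₂ G X]
  {μ : Measure X} {S : Set X} {A : Measure (X × G)}

/-- `A` counts preimages, so `A B` dominates the measure of the set of points represented by `B`.
That set is only analytic, hence the passage through an inner measurable set. -/
lemma IsLiftToSection.ae_notMem [IsFiniteMeasure μ] (hA : IsLiftToSection μ S A)
    (hS : MeasurableSet S) {B : Set (X × G)} (hB : MeasurableSet B) (h0 : A B = 0) :
    ∀ᵐ x ∂μ, ∀ p ∈ B, p.1 ∈ S → p.2 • p.1 ≠ x := by
  have ha : Measurable fun p : X × G => p.2 • p.1 := measurable_snd.smul measurable_fst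
  let I : Set X := (fun p : X × G => p.2 • p.1) '' (B ∩ Prod.fst ⁻¹' S)
  have hI : NullMeasurableSet I μ :=
    (hB.inter (measurable_fst hS)).nullMeasurableSet_image μ ha
  obtain ⟨J, hJI, hJ, hJe⟩ := hI.exists_measurable_subset_ae_eq
  have h1 : μ J ≤ A B := by
    rw [hA B hB, ← lintegral_indicator_one hJ]
    refine lintegral_mono fun x => ?_
    by_cases hx : x ∈ J
    · obtain ⟨p, ⟨hpB, hpS⟩, hpx⟩ := hJI hx
      rw [Set.indicator_of_mem hx, Pi.one_apply, ← Measure.count_singleton p]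
      exact measure_mono (Set.singleton_subset_iff.2 ⟨hpB, hpS, hpx⟩)
    · rw [Set.indicator_of_notMem hx]; exact zero_le
  have h2 : μ I = 0 := by
    rw [← measure_congr hJe]; exact le_antisymm (h1.trans h0.le) zero_le
  filter_upwards [measure_eq_zero_iff_ae_notMem.1 h2] with x hx p hp hpS hpx
  exact hx ⟨p, ⟨hp, hpS⟩, hpx⟩

-- The transfer in the other direction: over a null set of base points the fibres contribute nothing
-- to `A`.
omit [StandardBorelSpace G] [StandardBorelSpace X] in
lemma IsLiftToSection.ae_of_ae (hA : IsLiftToSection μ S A) {p : X → Prop}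
    (hp : ∀ᵐ x ∂μ, p x) : ∀ᵐ q ∂A, p (q.2 • q.1) := by
  have ha : Measurable fun p : X × G => p.2 • p.1 := measurable_snd.smul measurable_fst
  obtain ⟨N, hN, hNm, hN0⟩ := exists_measurable_superset_of_null (ae_iff.1 hp)
  rw [ae_iff]
  refine measure_mono_null (t := (fun p : X × G => p.2 • p.1) ⁻¹' N) (fun q hq => hN hq) ?_
  rw [hA _ (ha hNm)]
  have h1 : ∀ᵐ x ∂μ, x ∉ N := measure_eq_zero_iff_ae_notMem.1 hN0
  rw [← lintegral_zero (μ := μ)]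
  refine lintegral_congr_ae ?_
  filter_upwards [h1] with x hx
  have : {p : X × G | p ∈ (fun p : X × G => p.2 • p.1) ⁻¹' N ∧ p.1 ∈ S ∧ p.2 • p.1 = x} = ∅ := by
    refine Set.eq_empty_of_forall_notMem fun p hp => hx ?_
    obtain ⟨h1, -, h3⟩ := hp
    rw [← h3]; exact h1
  rw [this, measure_empty]

-- Where the action map is injective every fibre has at most one point. This is the source of local
-- finiteness of the conditional measures.
omit [StandardBorelSpace G] [StandardBorelSpace X] [MeasurableSMul₂ G X] in
lemma IsLiftToSection.measure_le [MeasurableSingletonClass (X × G)] (hA : IsLiftToSection μ S A)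
    {B : Set (X × G)} (hB : MeasurableSet B)
    (hinj : ∀ p ∈ B, ∀ q ∈ B, p.1 ∈ S → q.1 ∈ S → p.2 • p.1 = q.2 • q.1 → p = q) :
    A B ≤ μ Set.univ := by
  rw [hA B hB, ← lintegral_one]
  refine lintegral_mono fun x => ?_
  have hsub : {p : X × G | p ∈ B ∧ p.1 ∈ S ∧ p.2 • p.1 = x}.Subsingleton :=
    fun p hp q hq => hinj p hp.1 q hq.1 hp.2.1 hq.2.1 (hp.2.2.trans hq.2.2.symm)
  rcases hsub.eq_empty_or_singleton with h | ⟨p, h⟩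
  · rw [h, measure_empty]; exact zero_le
  · rw [h, Measure.count_singleton]

omit [StandardBorelSpace G] [StandardBorelSpace X] [MeasurableSMul₂ G X] in
lemma IsLiftToSection.ae_mem (hA : IsLiftToSection μ S A) (hS : MeasurableSet S) :
    ∀ᵐ q ∂A, q.1 ∈ S := by
  rw [ae_iff]
  have hm : MeasurableSet {q : X × G | ¬ q.1 ∈ S} := measurable_fst hS.compl
  rw [hA _ hm]
  refine (lintegral_congr fun x => ?_).trans lintegral_zero
  have : {p : X × G | p ∈ {q : X × G | ¬ q.1 ∈ S} ∧ p.1 ∈ S ∧ p.2 • p.1 = x} = ∅ :=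
    Set.eq_empty_of_forall_notMem fun p hp => hp.1 hp.2.1
  rw [this, measure_empty]

omit [StandardBorelSpace G] [StandardBorelSpace X] [SMul G X] [MeasurableSMul₂ G X] in
lemma IsPseudoImage.isFiniteMeasure {ν : Measure X} (h : IsPseudoImage A ν) :
    IsFiniteMeasure ν := by
  obtain ⟨m, hm, -, -, rfl⟩ := h
  infer_instance

omit [StandardBorelSpace G] [StandardBorelSpace X] [SMul G X] [MeasurableSMul₂ G X] in
lemma IsPseudoImage.ae_of_ae {ν : Measure X} (h : IsPseudoImage A ν) {p : X → Prop}
    (hpm : MeasurableSet {x | p x}) (hp : ∀ᵐ q ∂A, p q.1) : ∀ᵐ x ∂ν, p x := by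
  obtain ⟨m, hm, hmA, -, rfl⟩ := h
  rw [ae_map_iff measurable_fst.aemeasurable hpm]
  exact hmA.ae_le hp

omit [StandardBorelSpace G] [StandardBorelSpace X] [SMul G X] [MeasurableSMul₂ G X] in
lemma IsPseudoImage.measure_eq_zero {ν : Measure X} (h : IsPseudoImage A ν) {N : Set X}
    (hN : MeasurableSet N) (h0 : ν N = 0) : A (Prod.fst ⁻¹' N) = 0 := by
  obtain ⟨m, hm, -, hAm, rfl⟩ := h
  rw [Measure.map_apply measurable_fst hN] at h0
  exact hAm h0

end Lift

/-- Translates of small pieces of a section: the action map is injective on such boxes. -/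
lemma lacunary_box_injective {G X : Type*} [Group G] [MulAction G X] {S T : Set X} {U W C : Set G}
    (hlac : ∀ y ∈ S, ∀ g ∈ U, g • y ∈ S → g • y = y)
    (hT : ∀ y ∈ T, ∀ g ∈ W, g • y = y → g = 1)
    (hC : ∀ g ∈ C, ∀ h ∈ C, g⁻¹ * h ∈ U ∩ W) {y y' : X} {g g' : G} (hy : y ∈ S) (hyT : y ∈ T)
    (hy' : y' ∈ S) (hg : g ∈ C) (hg' : g' ∈ C) (heq : g • y = g' • y') : y = y' ∧ g = g' := by
  have h1 : (g'⁻¹ * g) • y = y' := by rw [mul_smul, heq, inv_smul_smul]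
  have h2 : y' = y := by
    rw [← h1]
    exact hlac y hy _ (hC g' hg' g hg).1 (by rwa [h1])
  subst h2
  refine ⟨rfl, ?_⟩
  have h3 := hT y' hyT _ (hC g' hg' g hg).2 h1
  exact (inv_mul_eq_one.1 h3).symm

/-! ### Countable decompositions into regions with injective action -/

section Pieces

variable {G X : Type*} [Group G] [MetricSpace G] [ProperSpace G] [IsTopologicalGroup G]
  [MeasurableSpace G] [BorelSpace G]
  [MeasurableSpace X] [StandardBorelSpace X] [MulAction G X] [MeasurableSMul₂ G X]

omit [IsTopologicalGroup G] in
/-- Up to a null set, `X` is a countable union of measurable sets on each of which the stabilizers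
meet a fixed neighbourhood of the identity trivially. -/
lemma HasDiscreteStabilizers.exists_pieces (hstab : HasDiscreteStabilizers G X)
    (ν : Measure X) [IsFiniteMeasure ν] :
    ∃ (T : ℕ → Set X) (W : ℕ → Set G), (∀ k, MeasurableSet (T k)) ∧ (∀ k, W k ∈ 𝓝 (1 : G)) ∧
      (∀ k, ∀ y ∈ T k, ∀ g ∈ W k, g • y = y → g = 1) ∧ ∀ᵐ y ∂ν, ∃ k, y ∈ T k := by
  let W : ℕ → Set G := fun k => Metric.ball 1 (1 / ((k : ℝ) + 1))
  let E : ℕ → Set X := fun k => {y | ∀ g ∈ W k, g • y = y → g = 1}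
  -- The complement of `E k` is the projection of a Borel set; `T k` will be a measurable subset of
  -- `E k` of full measure in it.
  have hE : ∀ k, NullMeasurableSet (E k) ν := by
    intro k
    have hm : MeasurableSet {p : X × G | p.2 ∈ W k ∧ p.2 • p.1 = p.1 ∧ p.2 ≠ 1} := by
      refine (measurable_snd Metric.isOpen_ball.measurableSet).inter (.inter ?_ ?_)
      · exact measurableSet_eq_fun (measurable_snd.smul measurable_fst) measurable_fst
      · exact (measurable_snd (measurableSet_singleton (1 : G))).compl
    have h1 := (hm.nullMeasurableSet_image ν measurable_fst).compl
    refine h1.congr (Eventually.of_forall fun y => propext ?_)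
    change ¬ (y ∈ _ '' _) ↔ y ∈ E k
    constructor
    · intro h g hg hgy
      by_contra hne
      exact h ⟨(y, g), ⟨hg, hgy, hne⟩, rfl⟩
    · rintro h ⟨⟨y', g⟩, ⟨hg, hgy, hne⟩, rfl⟩
      exact hne (h g hg hgy)
  choose T hTE hT hTe using fun k => (hE k).exists_measurable_subset_ae_eq
  refine ⟨T, W, hT, fun k => Metric.ball_mem_nhds _ (by positivity), fun k y hy => hTE k hy, ?_⟩
  filter_upwards [ae_all_iff.2 fun k => (hTe k).mem_iff] with y hy
  obtain ⟨V, hV, hVy⟩ := hstab y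
  obtain ⟨r, hr, hrV⟩ := Metric.mem_nhds_iff.1 hV
  obtain ⟨k, hk⟩ := exists_nat_one_div_lt hr
  exact ⟨k, (hy k).2 fun g hg => hVy g (hrV (Metric.ball_subset_ball hk.le hg))⟩

-- Both quotients are needed: `g⁻¹ * h` makes the action injective on boxes, and `g * h⁻¹` allows
-- lacunarity to be applied at the endpoint of a transition between two sections.
omit [MeasurableSpace G] [BorelSpace G] in
lemma exists_small_cover {W : Set G} (hW : W ∈ 𝓝 (1 : G)) :
    ∃ C : ℕ → Set G, (∀ i, IsOpen (C i)) ∧ (∀ g, ∃ i, g ∈ C i) ∧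
      ∀ i, ∀ g ∈ C i, ∀ h ∈ C i, g⁻¹ * h ∈ W ∧ g * h⁻¹ ∈ W := by
  have h1 : ∀ a : G, ∃ V : Set G, IsOpen V ∧ a ∈ V ∧ ∀ g ∈ V, ∀ h ∈ V, g⁻¹ * h ∈ W ∧ g * h⁻¹ ∈ W := by
    intro a
    have hc1 : ContinuousAt (fun p : G × G => p.1⁻¹ * p.2) (a, a) := by fun_prop
    have hc2 : ContinuousAt (fun p : G × G => p.1 * p.2⁻¹) (a, a) := by fun_prop
    have h2 : ∀ᶠ p : G × G in 𝓝 (a, a), p.1⁻¹ * p.2 ∈ W ∧ p.1 * p.2⁻¹ ∈ W := by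
      refine (hc1.eventually (p := (· ∈ W)) ?_).and (hc2.eventually (p := (· ∈ W)) ?_)
      · simpa using hW
      · simpa using hW
    rw [nhds_prod_eq] at h2
    obtain ⟨V, hV, hVW⟩ := (eventually_prod_self_iff (r := fun g h => g⁻¹ * h ∈ W ∧ g * h⁻¹ ∈ W)).1 h2
    refine ⟨interior V, isOpen_interior, mem_interior_iff_mem_nhds.2 hV, fun g hg h hh => ?_⟩
    exact hVW g (interior_subset hg) h (interior_subset hh)
  choose V hVo hVm hVW using h1
  obtain ⟨s, hsc, hs⟩ := TopologicalSpace.countable_cover_nhds fun a => (hVo a).mem_nhds (hVm a)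
  have hne : s.Nonempty := by
    have : (1 : G) ∈ ⋃ x ∈ s, V x := by rw [hs]; trivial
    obtain ⟨a, ha, -⟩ := Set.mem_iUnion₂.1 this
    exact ⟨a, ha⟩
  obtain ⟨f, rfl⟩ := hsc.exists_eq_range hne
  refine ⟨fun i => V (f i), fun i => hVo _, fun g => ?_, fun i => hVW _⟩
  have : g ∈ ⋃ x ∈ Set.range f, V x := by rw [hs]; trivial
  simpa using this

end Pieces

/-- The data of a disintegration along a group action, restricted to sets on which everything
is regular. -/
structure SectionData (G : Type*) {X : Type*} [Group G] [TopologicalSpace G] [MeasurableSpace G]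
    [MeasurableSpace X] [MulAction G X] (μ : Measure X) (σ : X → Measure G) where
  S : Set X
  A : Measure (X × G)
  ν : Measure X
  κ : Kernel X G
  U : Set G
  X₀ : Set X
  Y₀ : Set X
  measurableSet_S : MeasurableSet S
  U_mem : U ∈ 𝓝 (1 : G)
  lacunary : ∀ y ∈ S, ∀ g ∈ U, g • y ∈ S → g • y = y
  complete : ∀ x : X, ∃ y ∈ S, ∃ g : G, g • y = x
  isLift : IsLiftToSection μ S A
  isPseudoImage : IsPseudoImage A ν
  isFiniteMeasure : IsFiniteMeasure ν
  isSFiniteKernel : IsSFiniteKernel κ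
  A_eq : A = ν ⊗ₘ κ
  X₀_mem : X₀ ∈ ae μ
  Y₀_mem : Y₀ ∈ ae ν
  ne_zero : ∀ y ∈ Y₀, κ y ≠ 0
  finite : ∀ y ∈ Y₀, ∀ K : Set G, IsCompact K → κ y K < ∞
  rel : ∀ y ∈ Y₀, ∀ g : G, g • y ∈ X₀ →
    ∃ c : ℝ≥0∞, c ≠ 0 ∧ c ≠ ∞ ∧ (σ (g • y)).map (fun h => h * g) = c • κ y
  mem_Y₀ : ∀ y ∈ S, ∀ g : G, g • y ∈ X₀ → y ∈ Y₀

section Regular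

variable {G X : Type*} [Group G] [MetricSpace G] [ProperSpace G] [IsTopologicalGroup G]
  [MeasurableSpace G] [BorelSpace G]
  [MeasurableSpace X] [StandardBorelSpace X] [MulAction G X] [MeasurableSMul₂ G X]
  {μ : Measure X} [IsFiniteMeasure μ] {σ : X → Measure G}

lemma IsDisintegrationAlong.nonempty_sectionData (hstab : HasDiscreteStabilizers G X)
    (hσ : IsDisintegrationAlong μ σ) : Nonempty (SectionData G μ σ) := by
  obtain ⟨S, A, ν, κ, ⟨hS, U, -, hU, -, hlac, hcomp⟩, hA, hν, hκ, hAeq, X', hX', hrel⟩ := hσ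
  have hνf := hν.isFiniteMeasure
  have hSae : ∀ᵐ y ∂ν, y ∈ S := hν.ae_of_ae hS (hA.ae_mem hS)
  -- Base points with zero fibre carry no `A`-mass, so they are null for the pseudo-image `ν`.
  have hne : ∀ᵐ y ∂ν, κ y ≠ 0 := by
    have hm : MeasurableSet {y | κ y Set.univ ≠ 0} :=
      (κ.measurable_coe .univ (measurableSet_singleton 0)).compl
    have h1 : ∀ᵐ y ∂ν, κ y Set.univ ≠ 0 := by
      refine hν.ae_of_ae hm ?_
      rw [ae_iff, hAeq]
      have hm2 : MeasurableSet {q : X × G | ¬ κ q.1 Set.univ ≠ 0} := measurable_fst hm.compl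
      rw [Measure.compProd_apply hm2]
      refine (lintegral_congr fun y => ?_).trans lintegral_zero
      by_cases hy : κ y Set.univ = 0
      · exact measure_mono_null (Set.subset_univ _) hy
      · have : Prod.mk y ⁻¹' {q : X × G | ¬ κ q.1 Set.univ ≠ 0} = ∅ :=
          Set.eq_empty_of_forall_notMem fun g hg => hg hy
        rw [this, measure_empty]
    filter_upwards [h1] with y hy h0
    exact hy (by rw [h0]; rfl)
  -- The action is injective on each box, so boxes have `A`-mass at most `μ univ` and almost every
  -- fibre is finite on every `C k i`. Finitely many of these cover a compact set.
  have hfin : ∀ᵐ y ∂ν, ∀ K : Set G, IsCompact K → κ y K < ∞ := by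
    obtain ⟨T, W, hT, hW, hTW, hTae⟩ := hstab.exists_pieces ν
    choose C hCo hCc hCW using fun k => exists_small_cover (Filter.inter_mem hU (hW k))
    have h1 : ∀ k i, ∀ᵐ y ∂ν, y ∈ S ∩ T k → κ y (C k i) < ∞ := by
      intro k i
      have hm : MeasurableSet ((S ∩ T k) ×ˢ C k i) :=
        (hS.inter (hT k)).prod (hCo k i).measurableSet
      have h2 : A ((S ∩ T k) ×ˢ C k i) ≤ μ Set.univ := by
        refine hA.measure_le hm ?_
        rintro ⟨y, g⟩ hp ⟨y', g'⟩ hq h3 h4 h5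
        obtain ⟨h6, h7⟩ := lacunary_box_injective hlac (hTW k)
          (fun g hg h hh => (hCW k i g hg h hh).1) hp.1.1 hp.1.2 hq.1.1 hp.2 hq.2 h5
        exact Prod.ext h6 h7
      rw [hAeq, Measure.compProd_apply_prod (hS.inter (hT k)) (hCo k i).measurableSet] at h2
      have h3 := ae_lt_top (κ.measurable_coe (hCo k i).measurableSet)
        (ne_top_of_le_ne_top (measure_ne_top μ _) h2)
      rwa [ae_restrict_iff' (hS.inter (hT k))] at h3
    filter_upwards [ae_all_iff.2 fun k => ae_all_iff.2 (h1 k), hTae, hSae] with y hy ⟨k, hk⟩ hyS K hK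
    obtain ⟨t, ht⟩ := hK.elim_finite_subcover (C k) (hCo k)
      fun g _ => Set.mem_iUnion.2 (hCc k g)
    refine (measure_mono ht).trans_lt ((measure_biUnion_finset_le _ _).trans_lt ?_)
    exact ENNReal.sum_lt_top.2 fun i _ => hy k i ⟨hyS, hk⟩
  have hgood := hne.and (hfin.and hrel)
  obtain ⟨N, hN, hNm, hN0⟩ := exists_measurable_superset_of_null (ae_iff.1 hgood)
  -- Points represented by some bad base point form a `μ`-null set. Removing them makes every
  -- representative in the section of a remaining point good.
  have hrep : ∀ᵐ x ∂μ, ∀ p ∈ (Prod.fst ⁻¹' N : Set (X × G)), p.1 ∈ S → p.2 • p.1 ≠ x :=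
    hA.ae_notMem hS (measurable_fst hNm) (hν.measure_eq_zero hNm hN0)
  refine ⟨{
    S := S, A := A, ν := ν, κ := κ, U := U
    X₀ := X' ∩ {x | ∀ p ∈ (Prod.fst ⁻¹' N : Set (X × G)), p.1 ∈ S → p.2 • p.1 ≠ x}
    Y₀ := Nᶜ
    measurableSet_S := hS
    U_mem := hU
    lacunary := hlac
    complete := fun x => ?_
    isLift := hA
    isPseudoImage := hν
    isFiniteMeasure := hνf
    isSFiniteKernel := hκ
    A_eq := hAeq
    X₀_mem := Filter.inter_mem hX' hrep
    Y₀_mem := compl_mem_ae_iff.2 hN0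
    ne_zero := fun y hy => (not_not.1 fun h => hy (hN h)).1
    finite := fun y hy => (not_not.1 fun h => hy (hN h)).2.1
    rel := fun y hy g hg => (not_not.1 fun h => hy (hN h)).2.2 g hg.1
    mem_Y₀ := fun y hy g hg hyN => hg.2 (y, g) hyN hy rfl }⟩
  obtain ⟨g, -, h, -, y, hy, hx⟩ := hcomp x
  exact ⟨y, hy, g * h, hx⟩

end Regular


/-! ### Uniqueness of disintegrations -/

/-- Two disintegrations of the same measure, with possibly inequivalent normalisations, have
proportional fibres. -/
lemma ae_proportional_of_setLIntegral_eq {Y Z : Type*} [MeasurableSpace Y] [MeasurableSpace Z]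
    [MeasurableSpace.CountablyGenerated Z] {ν₁ ν₂ : Measure Y} [SigmaFinite ν₁]
    {k₁ k₂ : Y → Measure Z} (hk₁ : ∀ C, MeasurableSet C → Measurable fun y => k₁ y C)
    (hk₂ : ∀ C, MeasurableSet C → Measurable fun y => k₂ y C)
    (heq : ∀ N C, MeasurableSet N → MeasurableSet C →
      ∫⁻ y in N, k₁ y C ∂ν₁ = ∫⁻ y in N, k₂ y C ∂ν₂)
    {V : ℕ → Set Z} (hV : ∀ n, MeasurableSet (V n)) (hVmono : Monotone V)
    (hVuniv : ⋃ n, V n = Set.univ)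
    (hf₁ : ∀ᵐ y ∂ν₁, ∀ n, k₁ y (V n) < ∞) (hf₂ : ∀ᵐ y ∂ν₂, ∀ n, k₂ y (V n) < ∞) :
    ∀ᵐ y ∂ν₁, k₁ y ≠ 0 → ∃ c : ℝ≥0∞, c ≠ 0 ∧ c ≠ ∞ ∧ k₁ y = c • k₂ y := by
  have hdens : ∀ C, MeasurableSet C →
      ν₁.withDensity (fun y => k₁ y C) = ν₂.withDensity fun y => k₂ y C := by
    intro C hC
    ext N hN
    rw [withDensity_apply _ hN, withDensity_apply _ hN, heq N C hN hC]
  -- The measures `k₁(C) ν₁` and `k₂(C) ν₂` coincide. Both sides multiplied by `ν₁` therefore equal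
  -- `k₂(C) k₂(C') ν₂`, which eliminates the unrelated normalisations.
  have hcross : ∀ C C', MeasurableSet C → MeasurableSet C' →
      (fun y => k₂ y C' * k₁ y C) =ᵐ[ν₁] fun y => k₁ y C' * k₂ y C := by
    intro C C' hC hC'
    refine ae_eq_of_forall_setLIntegral_eq_of_sigmaFinite ((hk₂ _ hC').mul (hk₁ _ hC))
      ((hk₁ _ hC').mul (hk₂ _ hC)) fun N hN _ => ?_
    have h1 := setLIntegral_withDensity_eq_setLIntegral_mul ν₁ (hk₁ C hC) (hk₂ C' hC') hN
    have h2 := setLIntegral_withDensity_eq_setLIntegral_mul ν₂ (hk₂ C hC) (hk₂ C' hC') hN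
    have h3 := setLIntegral_withDensity_eq_setLIntegral_mul ν₂ (hk₂ C' hC') (hk₂ C hC) hN
    have h4 := setLIntegral_withDensity_eq_setLIntegral_mul ν₁ (hk₁ C' hC') (hk₂ C hC) hN
    rw [hdens C hC] at h1
    rw [← hdens C' hC'] at h3
    calc ∫⁻ y in N, k₂ y C' * k₁ y C ∂ν₁ = ∫⁻ y in N, k₁ y C * k₂ y C' ∂ν₁ := by
          simp_rw [mul_comm]
      _ = ∫⁻ y in N, k₂ y C * k₂ y C' ∂ν₂ := h1.symm.trans h2
      _ = ∫⁻ y in N, k₂ y C' * k₂ y C ∂ν₂ := by simp_rw [mul_comm]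
      _ = _ := h3.symm.trans h4
  have hzero : ∀ n, ∀ᵐ y ∂ν₁, (k₂ y (V n) = 0 ∨ k₂ y (V n) = ∞) → k₁ y (V n) = 0 := by
    intro n
    have hm : MeasurableSet {y | k₂ y (V n) = 0 ∨ k₂ y (V n) = ∞} :=
      (hk₂ _ (hV n) (measurableSet_singleton 0)).union
        (hk₂ _ (hV n) (measurableSet_singleton ∞))
    have h1 : ∫⁻ y in {y | k₂ y (V n) = 0 ∨ k₂ y (V n) = ∞}, k₁ y (V n) ∂ν₁ = 0 := by
      rw [heq _ _ hm (hV n), setLIntegral_eq_zero_iff hm (hk₂ _ (hV n))]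
      filter_upwards [hf₂] with y hy h
      exact h.resolve_right (hy n).ne
    rwa [setLIntegral_eq_zero_iff hm (hk₁ _ (hV n))] at h1
  -- A countable generating algebra lets one null set serve for all measurable sets at once.
  let 𝒞 := generateSetAlgebra (MeasurableSpace.countableGeneratingSet Z)
  have h𝒞c : 𝒞.Countable := countable_generateSetAlgebra (MeasurableSpace.countable_countableGeneratingSet)
  have h𝒞g : ‹MeasurableSpace Z› = MeasurableSpace.generateFrom 𝒞 := by
    rw [generateFrom_generateSetAlgebra_eq, MeasurableSpace.generateFrom_countableGeneratingSet]
  have h𝒞m : ∀ C ∈ 𝒞, MeasurableSet C := fun C hC => by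
    rw [h𝒞g]; exact MeasurableSpace.measurableSet_generateFrom hC
  have h𝒞p : IsPiSystem 𝒞 := isSetAlgebra_generateSetAlgebra.isSetRing.isSetSemiring.isPiSystem
  have hae : ∀ᵐ y ∂ν₁, ∀ n, ∀ C ∈ 𝒞,
      k₂ y (V n) * k₁ y (C ∩ V n) = k₁ y (V n) * k₂ y (C ∩ V n) :=
    ae_all_iff.2 fun n => (ae_ball_iff h𝒞c).2 fun C hC =>
      hcross _ _ ((h𝒞m C hC).inter (hV n)) (hV n)
  filter_upwards [hae, ae_all_iff.2 hzero, hf₁] with y hy1 hy2 hy3 hne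
  have hrestr : ∀ n, k₁ y (V n) ≠ 0 →
      (k₁ y).restrict (V n) = (k₁ y (V n) / k₂ y (V n)) • (k₂ y).restrict (V n) := by
    intro n hn
    have h20 : k₂ y (V n) ≠ 0 := fun h => hn (hy2 n (Or.inl h))
    have h2t : k₂ y (V n) ≠ ∞ := fun h => hn (hy2 n (Or.inr h))
    have hfin : IsFiniteMeasure ((k₁ y).restrict (V n)) :=
      ⟨by rw [Measure.restrict_apply_univ]; exact hy3 n⟩
    refine ext_of_generate_finite 𝒞 h𝒞g h𝒞p (fun C hC => ?_) ?_
    · rw [Measure.smul_apply, Measure.restrict_apply (h𝒞m C hC),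
        Measure.restrict_apply (h𝒞m C hC), smul_eq_mul, ← ENNReal.mul_div_right_comm,
        ENNReal.eq_div_iff h20 h2t]
      exact hy1 n C hC
    · rw [Measure.smul_apply, Measure.restrict_apply_univ, Measure.restrict_apply_univ, smul_eq_mul,
        ENNReal.div_mul_cancel h20 h2t]
  obtain ⟨n₀, hn₀⟩ : ∃ n, k₁ y (V n) ≠ 0 := by
    by_contra! h
    refine hne (Measure.measure_univ_eq_zero.1 ?_)
    rw [← hVuniv]
    exact measure_iUnion_null h
  have h20 : k₂ y (V n₀) ≠ 0 := fun h => hn₀ (hy2 n₀ (Or.inl h))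
  have h2t : k₂ y (V n₀) ≠ ∞ := fun h => hn₀ (hy2 n₀ (Or.inr h))
  refine ⟨k₁ y (V n₀) / k₂ y (V n₀), ENNReal.div_ne_zero.2 ⟨hn₀, h2t⟩,
    ENNReal.div_ne_top (hy3 n₀).ne h20, ?_⟩
  have hU : ⋃ n, V (n + n₀) = Set.univ := by
    rw [← hVuniv]
    refine Set.Subset.antisymm (Set.iUnion_subset fun n => Set.subset_iUnion V _)
      (Set.iUnion_subset fun n => ?_)
    exact (hVmono (Nat.le_add_right n n₀)).trans (Set.subset_iUnion (fun n => V (n + n₀)) n)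
  refine (Measure.ext_iff_of_iUnion_eq_univ hU).2 fun n => ?_
  have hle : V n₀ ⊆ V (n + n₀) := hVmono (Nat.le_add_left _ _)
  have hn : k₁ y (V (n + n₀)) ≠ 0 := fun h => hn₀ (measure_mono_null hle h)
  have h1 := hrestr _ hn
  -- Evaluating both restrictions on the common set `V n₀` shows that the ratio is the same for
  -- every member of the exhaustion.
  have h2 : k₁ y (V n₀) = k₁ y (V (n + n₀)) / k₂ y (V (n + n₀)) * k₂ y (V n₀) := by
    have h3 := congrArg (fun m : Measure Z => m (V n₀)) h1
    simp only [Measure.smul_apply, smul_eq_mul, Measure.restrict_apply (hV n₀)] at h3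
    rwa [Set.inter_eq_left.2 hle] at h3
  have h3 : k₁ y (V n₀) / k₂ y (V n₀) = k₁ y (V (n + n₀)) / k₂ y (V (n + n₀)) := by
    rw [h2, ENNReal.mul_div_cancel_right h20 h2t]
  rw [h1, Measure.restrict_smul, h3]

section Uniqueness

variable {G X : Type*} [Group G] [MetricSpace G] [ProperSpace G] [IsTopologicalGroup G]
  [MeasurableSpace G] [BorelSpace G]
  [MeasurableSpace X] [StandardBorelSpace X] [MulAction G X] [MeasurableSMul₂ G X]
  {μ : Measure X} {σ₁ σ₂ : X → Measure G}

/-- Along a partial isomorphism `y ↦ h • y` between two sections, given by a set `D` of pairs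
`(y, h)`, the fibre measures correspond. -/
lemma SectionData.ae_proportional_of_injOn (D₁ : SectionData G μ σ₁) (D₂ : SectionData G μ σ₂)
    {D : Set (X × G)} (hD : MeasurableSet D) (hD₁ : ∀ p ∈ D, p.1 ∈ D₁.S)
    (hD₂ : ∀ p ∈ D, p.2 • p.1 ∈ D₂.S) (hinj₁ : Set.InjOn Prod.fst D)
    (hinj₂ : Set.InjOn (fun p : X × G => p.2 • p.1) D) :
    ∀ᵐ y ∂D₁.ν, ∀ h, (y, h) ∈ D → ∃ c : ℝ≥0∞, c ≠ 0 ∧ c ≠ ∞ ∧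
      D₁.κ y = c • (D₂.κ (h • y)).map fun g => g * h := by
  have := D₁.isFiniteMeasure
  have := D₂.isFiniteMeasure
  have := D₁.isSFiniteKernel
  have := D₂.isSFiniteKernel
  have hDs : StandardBorelSpace D := hD.standardBorel
  let p₁ : D → X := fun d => d.1.1
  let p₂ : D → X := fun d => d.1.2 • d.1.1
  have hp₁m : Measurable p₁ := measurable_fst.comp measurable_subtype_coe
  have hp₂m : Measurable p₂ :=
    (measurable_snd.smul measurable_fst).comp measurable_subtype_coe
  have hp₁i : Function.Injective p₁ := fun d d' h => Subtype.ext (hinj₁ d.2 d'.2 h)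
  have hp₂i : Function.Injective p₂ := fun d d' h => Subtype.ext (hinj₂ d.2 d'.2 h)
  have he₁ : MeasurableEmbedding p₁ := hp₁m.measurableEmbedding hp₁i
  have he₂ : MeasurableEmbedding p₂ := hp₂m.measurableEmbedding hp₂i
  have hmul : ∀ h : G, Measurable fun g : G => g * h := fun h => measurable_mul_const h
  let k₁ : D → Measure G := fun d => D₁.κ (p₁ d)
  let k₂ : D → Measure G := fun d => (D₂.κ (p₂ d)).map fun g => g * d.1.2
  have hk₂ : ∀ C, MeasurableSet C → Measurable fun d => k₂ d C := by
    intro C hC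
    simp only [k₂, Measure.map_apply (hmul _) hC]
    have hs : MeasurableSet {q : D × G | q.2 * q.1.1.2 ∈ C} :=
      (measurable_snd.mul (measurable_snd.comp (measurable_subtype_coe.comp measurable_fst))) hC
    exact (D₂.κ.comap p₂ hp₂m).measurable_kernel_prodMk_left hs
  have heq : ∀ N C, MeasurableSet N → MeasurableSet C →
      ∫⁻ d in N, k₁ d C ∂(D₁.ν.comap p₁) = ∫⁻ d in N, k₂ d C ∂(D₂.ν.comap p₂) := by
    intro N C hN hC
    have hlin : ∀ (p : D → X) (ν : Measure X) (F : X → ℝ≥0∞) (f : D → ℝ≥0∞),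
        MeasurableEmbedding p → (∀ d ∈ N, F (p d) = f d) → (∀ y ∉ p '' N, F y = 0) →
        ∫⁻ y, F y ∂ν = ∫⁻ d in N, f d ∂(ν.comap p) := by
      intro p ν F f hp h1 h2
      have h3 : (p '' N).indicator F = F := by
        rw [Set.indicator_eq_self]
        intro y hy
        by_contra h
        exact hy (h2 y h)
      have h4 : Set.range p ∩ p '' N = p '' N := Set.inter_eq_right.2 (Set.image_subset_range p N)
      rw [← h3, lintegral_indicator (hp.measurableSet_image' hN)]
      have h5 : ν.restrict (p '' N) = ((ν.comap p).restrict N).map p := by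
        ext E hE
        rw [Measure.restrict_apply hE, Measure.map_apply hp.measurable hE,
          Measure.restrict_apply (hp.measurable hE), hp.comap_apply, Set.image_preimage_inter]
      rw [h5, hp.lintegral_map]
      exact setLIntegral_congr_fun hN h1
    have hW : MeasurableSet {q : D × G | q.1 ∈ N ∧ q.2 * q.1.1.2 ∈ C} :=
      (measurable_fst hN).inter
        ((measurable_snd.mul (measurable_snd.comp (measurable_subtype_coe.comp measurable_fst))) hC)
    -- The two sets describe the same points of `X` through the two sections: `(y, g)` corresponds
    -- to `(h • y, g * h⁻¹)`. Each side of the identity is the mass of one of them under its own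
    -- lift.
    let B₁ : Set (X × G) := (p₁ '' N) ×ˢ C
    let B₂ : Set (X × G) := (fun q : D × G => (p₂ q.1, q.2)) '' {q | q.1 ∈ N ∧ q.2 * q.1.1.2 ∈ C}
    have hB₁ : MeasurableSet B₁ := (he₁.measurableSet_image' hN).prod hC
    have hB₂ : MeasurableSet B₂ := (he₂.prodMap MeasurableEmbedding.id).measurableSet_image' hW
    have hA₁ : D₁.A B₁ = ∫⁻ d in N, k₁ d C ∂(D₁.ν.comap p₁) := by
      rw [D₁.A_eq, Measure.compProd_apply hB₁]
      refine hlin p₁ D₁.ν _ _ he₁ (fun d hd => ?_) fun y hy => ?_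
      · congr 1
        ext g
        exact ⟨fun h => h.2, fun h => ⟨⟨d, hd, rfl⟩, h⟩⟩
      · convert measure_empty (μ := D₁.κ y)
        exact Set.eq_empty_of_forall_notMem fun g hg => hy hg.1
    have hA₂ : D₂.A B₂ = ∫⁻ d in N, k₂ d C ∂(D₂.ν.comap p₂) := by
      rw [D₂.A_eq, Measure.compProd_apply hB₂]
      refine hlin p₂ D₂.ν _ _ he₂ (fun d hd => ?_) fun y hy => ?_
      · rw [Measure.map_apply (hmul _) hC]
        congr 1
        ext g
        constructor
        · rintro ⟨⟨d', g'⟩, ⟨h1, h2⟩, h3⟩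
          obtain ⟨h4, h5⟩ := Prod.ext_iff.1 h3
          have h6 : d' = d := hp₂i h4
          have h7 : g' = g := h5
          subst h6 h7
          exact h2
        · exact fun h => ⟨(d, g), ⟨hd, h⟩, rfl⟩
      · convert measure_empty (μ := D₂.κ y)
        refine Set.eq_empty_of_forall_notMem ?_
        rintro g ⟨⟨d', g'⟩, ⟨h1, h2⟩, h3⟩
        exact hy ⟨d', h1, (Prod.ext_iff.1 h3).1⟩
    rw [← hA₁, ← hA₂, D₁.isLift B₁ hB₁, D₂.isLift B₂ hB₂]
    refine lintegral_congr fun x => ?_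
    -- `Q` parametrises both fibres over `x` injectively, so their cardinalities agree.
    let Q : Set (D × G) := {q | q.1 ∈ N ∧ q.2 ∈ C ∧ q.2 • p₁ q.1 = x}
    let f₁ : D × G → X × G := fun q => (p₁ q.1, q.2)
    let f₂ : D × G → X × G := fun q => (p₂ q.1, q.2 * q.1.1.2⁻¹)
    have hf₁ : Function.Injective f₁ := by
      rintro ⟨d, g⟩ ⟨d', g'⟩ h
      obtain ⟨h1, h2⟩ := Prod.ext_iff.1 h
      exact Prod.ext (hp₁i h1) h2
    have hf₂ : Function.Injective f₂ := by
      rintro ⟨d, g⟩ ⟨d', g'⟩ h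
      obtain ⟨h1, h2⟩ := Prod.ext_iff.1 h
      have h3 : d = d' := hp₂i h1
      subst h3
      exact Prod.ext rfl (mul_right_cancel (h2 : g * d.1.2⁻¹ = g' * d.1.2⁻¹))
    have hcount : ∀ {f : D × G → X × G}, Function.Injective f →
        Measure.count (f '' Q) = Measure.count Q := fun hf => Measure.count_injective_image hf Q
    have hQ₁ : {p : X × G | p ∈ B₁ ∧ p.1 ∈ D₁.S ∧ p.2 • p.1 = x} = f₁ '' Q := by
      ext ⟨y, g⟩
      constructor
      · rintro ⟨⟨⟨d, hd, hdy⟩, hg⟩, -, h⟩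
        refine ⟨(d, g), ⟨hd, hg, ?_⟩, Prod.ext hdy rfl⟩
        rw [← h, hdy]
      · rintro ⟨⟨d, g'⟩, ⟨hd, hg, h⟩, hq⟩
        obtain ⟨h1, h2⟩ := Prod.ext_iff.1 hq
        have h1' : d.1.1 = y := h1
        have h2' : g' = g := h2
        subst h1' h2'
        exact ⟨⟨⟨d, hd, rfl⟩, hg⟩, hD₁ d.1 d.2, h⟩
    have hQ₂ : {p : X × G | p ∈ B₂ ∧ p.1 ∈ D₂.S ∧ p.2 • p.1 = x} = f₂ '' Q := by
      ext ⟨y, g⟩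
      constructor
      · rintro ⟨⟨⟨d, g'⟩, ⟨hd, hg⟩, hq⟩, -, h⟩
        obtain ⟨h1, h2⟩ := Prod.ext_iff.1 hq
        have h1' : d.1.2 • d.1.1 = y := h1
        have h2' : g' = g := h2
        subst h1' h2'
        refine ⟨(d, g' * d.1.2), ⟨hd, hg, ?_⟩, Prod.ext rfl ?_⟩
        · rw [← h, smul_smul]
        · exact mul_inv_cancel_right g' d.1.2
      · rintro ⟨⟨d, g'⟩, ⟨hd, hg, h⟩, hq⟩
        obtain ⟨h1, h2⟩ := Prod.ext_iff.1 hq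
        have h1' : d.1.2 • d.1.1 = y := h1
        have h2' : g' * d.1.2⁻¹ = g := h2
        subst h1' h2'
        refine ⟨⟨(d, g' * d.1.2⁻¹), ⟨hd, ?_⟩, rfl⟩, hD₂ _ d.2, ?_⟩
        · simpa using hg
        · change (g' * d.1.2⁻¹) • d.1.2 • d.1.1 = x
          rw [smul_smul, inv_mul_cancel_right]
          exact h
    rw [hQ₁, hQ₂, hcount hf₁, hcount hf₂]
  have hcomap : ∀ (p : D → X) (ν : Measure X) (Y₀ : Set X), MeasurableEmbedding p → Y₀ ∈ ae ν →
      ∀ᵐ d ∂(ν.comap p), p d ∈ Y₀ := by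
    intro p ν Y₀ hp hY
    rw [ae_iff, hp.comap_apply]
    refine measure_mono_null ?_ (mem_ae_iff.1 hY)
    rintro _ ⟨d, hd, rfl⟩
    exact hd
  have hfinV : ∀ n : ℕ, IsCompact (Metric.closedBall (1 : G) n) := fun n => isCompact_closedBall _ _
  have hfin₁ : IsFiniteMeasure (D₁.ν.comap p₁) := by
    refine ⟨?_⟩
    rw [he₁.comap_apply]
    exact measure_lt_top _ _
  have hmain := ae_proportional_of_setLIntegral_eq (k₁ := k₁) (k₂ := k₂)
    (fun C hC => (D₁.κ.measurable_coe hC).comp hp₁m) hk₂ heq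
    (V := fun n : ℕ => Metric.closedBall (1 : G) n)
    (fun n => Metric.isClosed_closedBall.measurableSet)
    (fun m n hmn => Metric.closedBall_subset_closedBall (Nat.cast_le.2 hmn))
    (Metric.iUnion_closedBall_nat 1)
    ((hcomap p₁ _ _ he₁ D₁.Y₀_mem).mono fun d hd n => D₁.finite _ hd _ (hfinV n))
    ((hcomap p₂ _ _ he₂ D₂.Y₀_mem).mono fun d hd n => by
      rw [Measure.map_apply (hmul _) Metric.isClosed_closedBall.measurableSet]
      refine D₂.finite _ hd _ ?_
      exact (Homeomorph.mulRight d.1.2).isCompact_preimage.2 (hfinV n))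
  have hgood := hmain.and (hcomap p₁ _ _ he₁ D₁.Y₀_mem)
  rw [ae_iff, he₁.comap_apply] at hgood
  filter_upwards [measure_eq_zero_iff_ae_notMem.1 hgood] with y hy h hyh
  have h1 := not_not.1 fun hn => hy ⟨⟨(y, h), hyh⟩, hn, rfl⟩
  exact h1.1 (D₁.ne_zero _ h1.2)

omit [ProperSpace G] in
lemma exists_smul_eq_of_map_mul_eq {m₁ m₂ : Measure G} (h : G) {c : ℝ≥0∞}
    (heq : m₁.map (fun g => g * h) = c • m₂.map fun g => g * h) : m₁ = c • m₂ := by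
  have hinv : ∀ m : Measure G, (m.map fun g => g * h).map (fun g => g * h⁻¹) = m := by
    intro m
    rw [Measure.map_map (measurable_mul_const _) (measurable_mul_const _)]
    have : (fun g : G => g * h⁻¹) ∘ (fun g => g * h) = id := by ext; simp
    rw [this, Measure.map_id]
  rw [← hinv m₁, heq, Measure.map_smul, hinv]

/-- If `x = g₁ • y₁ = g₂ • y₂` with `yᵢ` in the two sections, then `g₂⁻¹ * g₁` takes `y₁` to `y₂`.
Countably many boxes of such transitions are partial isomorphisms, along which the fibre measures
are proportional. -/
theorem SectionData.ae_unique [IsFiniteMeasure μ] (hstab : HasDiscreteStabilizers G X)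
    (D₁ : SectionData G μ σ₁) (D₂ : SectionData G μ σ₂) :
    ∀ᵐ x ∂μ, ∃ c : ℝ≥0∞, c ≠ 0 ∧ c ≠ ∞ ∧ σ₁ x = c • σ₂ x := by
  have := D₁.isFiniteMeasure
  obtain ⟨T, W, hT, hW, hTW, hTae⟩ := hstab.exists_pieces D₁.ν
  have hnhd : ∀ k, D₁.U ∩ D₂.U ∩ W k ∈ 𝓝 (1 : G) := fun k =>
    Filter.inter_mem (Filter.inter_mem D₁.U_mem D₂.U_mem) (hW k)
  choose C hCo hCc hCW using fun k => exists_small_cover (hnhd k)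
  let D : ℕ → ℕ → Set (X × G) := fun k i =>
    {p | (p.1 ∈ D₁.S ∩ T k ∧ p.2 ∈ C k i) ∧ p.2 • p.1 ∈ D₂.S}
  have hpiece : ∀ k i, ∀ᵐ y ∂D₁.ν, ∀ h, (y, h) ∈ D k i → ∃ c : ℝ≥0∞, c ≠ 0 ∧ c ≠ ∞ ∧
      D₁.κ y = c • (D₂.κ (h • y)).map fun g => g * h := by
    intro k i
    have hDm : MeasurableSet (D k i) :=
      ((D₁.measurableSet_S.inter (hT k)).prod (hCo k i).measurableSet).inter
        ((measurable_snd.smul measurable_fst) D₂.measurableSet_S)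
    refine D₁.ae_proportional_of_injOn D₂ hDm (fun p hp => hp.1.1.1) (fun p hp => hp.2) ?_ ?_
    -- Lacunarity of the second section forces `h' • y = h • y`, and triviality of small stabilizers
    -- then gives `h' = h`.
    · rintro ⟨y, h⟩ hp ⟨y', h'⟩ hq (heq : y = y')
      subst heq
      have h1 : (h' * h⁻¹) • h • y = h' • y := by rw [smul_smul, inv_mul_cancel_right]
      have h2 : h' • y = h • y := by
        rw [← h1]
        exact D₂.lacunary _ hp.2 _ (hCW k i h' hq.1.2 h hp.1.2).2.1.2 (by rw [h1]; exact hq.2)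
      have h3 := hTW k y hp.1.1.2 (h⁻¹ * h') (hCW k i h hp.1.2 h' hq.1.2).1.2
        (by rw [mul_smul, h2, inv_smul_smul])
      exact Prod.ext rfl (inv_mul_eq_one.1 h3)
    · rintro ⟨y, h⟩ hp ⟨y', h'⟩ hq heq
      obtain ⟨h1, h2⟩ := lacunary_box_injective D₁.lacunary (hTW k)
        (fun g hg h hh => ⟨(hCW k i g hg h hh).1.1.1, (hCW k i g hg h hh).1.2⟩)
        hp.1.1.1 hp.1.1.2 hq.1.1.1 hp.1.2 hq.1.2 heq
      exact Prod.ext h1 h2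
  have hgood := (ae_all_iff.2 fun k => ae_all_iff.2 (hpiece k)).and hTae
  obtain ⟨N, hN, hNm, hN0⟩ := exists_measurable_superset_of_null (ae_iff.1 hgood)
  have hrep := D₁.isLift.ae_notMem D₁.measurableSet_S (measurable_fst hNm)
    (D₁.isPseudoImage.measure_eq_zero hNm hN0)
  filter_upwards [hrep, D₁.X₀_mem, D₂.X₀_mem] with x hx hx₁ hx₂
  obtain ⟨y₁, hy₁, g₁, rfl⟩ := D₁.complete x
  obtain ⟨y₂, hy₂, g₂, h₂⟩ := D₂.complete (g₁ • y₁)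
  have hy₁N : y₁ ∉ N := fun h => hx (y₁, g₁) h hy₁ rfl
  obtain ⟨hp, k, hk⟩ := not_not.1 fun h => hy₁N (hN h)
  have hgy : (g₂⁻¹ * g₁) • y₁ = y₂ := by rw [mul_smul, ← h₂, inv_smul_smul]
  obtain ⟨i, hi⟩ := hCc k (g₂⁻¹ * g₁)
  obtain ⟨c, hc0, hct, hc⟩ := hp k i (g₂⁻¹ * g₁) ⟨⟨⟨hy₁, hk⟩, hi⟩, by
    change (g₂⁻¹ * g₁) • y₁ ∈ D₂.S
    rw [hgy]; exact hy₂⟩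
  obtain ⟨c₁, hc₁0, hc₁t, hc₁⟩ := D₁.rel y₁ (D₁.mem_Y₀ y₁ hy₁ g₁ hx₁) g₁ hx₁
  rw [← h₂] at hx₂
  obtain ⟨c₂, hc₂0, hc₂t, hc₂⟩ := D₂.rel y₂ (D₂.mem_Y₀ y₂ hy₂ g₂ hx₂) g₂ hx₂
  rw [hgy] at hc
  rw [h₂] at hc₂
  have hκ₂ : D₂.κ y₂ = c₂⁻¹ • (σ₂ (g₁ • y₁)).map fun h => h * g₂ := by
    rw [hc₂, smul_smul, ENNReal.inv_mul_cancel hc₂0 hc₂t, one_smul]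
  refine ⟨c₁ * (c * c₂⁻¹), ?_, ?_, exists_smul_eq_of_map_mul_eq g₁ ?_⟩
  · exact mul_ne_zero hc₁0 (mul_ne_zero hc0 (ENNReal.inv_ne_zero.2 hc₂t))
  · exact ENNReal.mul_ne_top hc₁t (ENNReal.mul_ne_top hct (ENNReal.inv_ne_top.2 hc₂0))
  · rw [hc₁, hc, hκ₂, Measure.map_smul,
      Measure.map_map (measurable_mul_const _) (measurable_mul_const _), smul_smul, smul_smul]
    have hfun : ((fun x : G => x * (g₂⁻¹ * g₁)) ∘ fun x => x * g₂) = fun g => g * g₁ := by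
      ext g; simp [mul_assoc]
    rw [hfun, mul_assoc]

end Uniqueness


/-! ### Regular measurable families of conditional measures -/

/-- A measurable family of measures on `G` with the defining properties of the conditional measures
of `μ` along the action of `G`. -/
structure IsRegularFamily {G X : Type*} [Group G] [TopologicalSpace G] [MeasurableSpace G]
    [MeasurableSpace X] [MulAction G X] (μ : Measure X) (s : X → Measure G) : Prop where
  measurable : ∀ B, MeasurableSet B → Measurable fun x => s x B
  ae_ne_zero : ∀ᵐ x ∂μ, s x ≠ 0
  ae_finite : ∀ᵐ x ∂μ, IsFiniteMeasureOnCompacts (s x)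
  ae_translate : ∃ X₀ ∈ ae μ, ∀ x ∈ X₀, ∀ h : G, h • x ∈ X₀ →
    ∃ c : ℝ≥0∞, c ≠ 0 ∧ c ≠ ∞ ∧ (s (h • x)).map (fun g => g * h) = c • s x
  ae_of_ae : ∀ p : X → Prop, (∀ᵐ x ∂μ, p x) → ∀ᵐ x ∂μ, ∀ᵐ g ∂(s x), p (g • x)
  null_of_ae_null : ∀ N, MeasurableSet N → (∀ᵐ x ∂μ, ∀ᵐ g ∂(s x), g • x ∉ N) → μ N = 0

section RegularFamily

variable {G X : Type*} [Group G] [MetricSpace G] [ProperSpace G] [IsTopologicalGroup G]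
  [MeasurableSpace G] [BorelSpace G]
  [MeasurableSpace X] [StandardBorelSpace X] [MulAction G X] [MeasurableSMul₂ G X]
  {μ : Measure X} {σ : X → Measure G}

omit [ProperSpace G] [StandardBorelSpace X] [MeasurableSMul₂ G X] [IsTopologicalGroup G]
  [BorelSpace G] in
lemma SectionData.exists_smul_eq (D : SectionData G μ σ) {y : X} (hy : y ∈ D.Y₀) {g : G}
    (hg : g • y ∈ D.X₀) :
    ∃ c : ℝ≥0∞, c ≠ 0 ∧ c ≠ ∞ ∧ D.κ y = c • (σ (g • y)).map fun h => h * g := by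
  obtain ⟨c, h0, ht, h⟩ := D.rel y hy g hg
  refine ⟨c⁻¹, ENNReal.inv_ne_zero.2 ht, ENNReal.inv_ne_top.2 h0, ?_⟩
  rw [h, smul_smul, ENNReal.inv_mul_cancel h0 ht, one_smul]

/-- On each box the action map is injective between standard Borel spaces, hence a measurable
embedding with measurable inverse. Disjointifying countably many boxes glues the inverses. -/
lemma SectionData.exists_selection [IsFiniteMeasure μ] (hstab : HasDiscreteStabilizers G X)
    (D : SectionData G μ σ) :
    ∃ f : X → X × G, Measurable f ∧ ∀ᵐ x ∂μ, (f x).1 ∈ D.S ∧ (f x).2 • (f x).1 = x := by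
  have := D.isFiniteMeasure
  obtain ⟨T, W, hT, hW, hTW, hTae⟩ := hstab.exists_pieces D.ν
  choose C hCo hCc hCW using fun k => exists_small_cover (Filter.inter_mem D.U_mem (hW k))
  let P : ℕ × ℕ → Set (X × G) := fun k => (D.S ∩ T k.1) ×ˢ C k.1 k.2
  have hP : ∀ k, MeasurableSet (P k) := fun k =>
    (D.measurableSet_S.inter (hT k.1)).prod (hCo k.1 k.2).measurableSet
  let e : ∀ k, P k → X := fun k p => p.1.2 • p.1.1
  have he : ∀ k, MeasurableEmbedding (e k) := by
    intro k
    have := (hP k).standardBorel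
    refine Measurable.measurableEmbedding
      ((measurable_snd.smul measurable_fst).comp measurable_subtype_coe) ?_
    rintro ⟨⟨y, g⟩, hp⟩ ⟨⟨y', g'⟩, hq⟩ heq
    obtain ⟨h1, h2⟩ := lacunary_box_injective D.lacunary (hTW k.1)
      (fun g hg h hh => (hCW k.1 k.2 g hg h hh).1) hp.1.1 hp.1.2 hq.1.1 hp.2 hq.2 heq
    exact Subtype.ext (Prod.ext h1 h2)
  rcases isEmpty_or_nonempty X with hX | ⟨⟨x₀⟩⟩
  · exact ⟨fun x => (x, 1), by fun_prop, Eventually.of_forall fun x => hX.elim x⟩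
  choose F hF hFe using fun k => (he k).exists_measurable_extend
    (g := fun p : P k => p.1) measurable_subtype_coe (fun _ => ⟨(x₀, (1 : G))⟩)
  have hcov : ∀ᵐ x ∂μ, ∃ k, x ∈ Set.range (e k) := by
    obtain ⟨N, hN, hNm, hN0⟩ := exists_measurable_superset_of_null (ae_iff.1 hTae)
    filter_upwards [D.isLift.ae_notMem D.measurableSet_S (measurable_fst hNm)
      (D.isPseudoImage.measure_eq_zero hNm hN0)] with x hx
    obtain ⟨y, hy, g, hyx⟩ := D.complete x
    have hyN : y ∉ N := fun h => hx (y, g) h hy hyx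
    obtain ⟨k, hk⟩ := not_not.1 fun h => hyN (hN h)
    obtain ⟨i, hi⟩ := hCc k g
    exact ⟨(k, i), ⟨⟨(y, g), ⟨hy, hk⟩, hi⟩, hyx⟩⟩
  obtain ⟨ψ, hψ⟩ := exists_surjective_nat (ℕ × ℕ)
  let M : ℕ → Set X := disjointed fun n => Set.range (e (ψ n))
  have hM : ∀ n, MeasurableSet (M n) :=
    fun n => MeasurableSet.disjointed (fun n => (he (ψ n)).measurableSet_range) n
  obtain ⟨f, hf, hfM⟩ := exists_measurable_piecewise M hM (fun n => F (ψ n)) (fun n => hF _) (by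
    intro m n hmn x hx
    exact absurd hx.2 (Set.disjoint_left.1 (disjoint_disjointed _ hmn) hx.1))
  refine ⟨f, hf, ?_⟩
  filter_upwards [hcov] with x ⟨k, hk⟩
  have hx : x ∈ ⋃ n, M n := by
    rw [iUnion_disjointed]
    obtain ⟨n, rfl⟩ := hψ k
    exact Set.mem_iUnion.2 ⟨n, hk⟩
  obtain ⟨n, hn⟩ := Set.mem_iUnion.1 hx
  obtain ⟨p, rfl⟩ := disjointed_subset _ n hn
  have h1 : f (e (ψ n) p) = p.1 := (hfM n hn).trans (congrFun (hFe (ψ n)) p)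
  rw [h1]
  exact ⟨p.2.1.1, rfl⟩

lemma IsDisintegrationAlong.exists_regularFamily [IsFiniteMeasure μ]
    (hstab : HasDiscreteStabilizers G X) (hσ : IsDisintegrationAlong μ σ) :
    ∃ s : X → Measure G, IsRegularFamily μ s ∧
      ∀ᵐ x ∂μ, ∃ c : ℝ≥0∞, c ≠ 0 ∧ c ≠ ∞ ∧ σ x = c • s x := by
  obtain ⟨D⟩ := hσ.nonempty_sectionData hstab
  have := D.isFiniteMeasure
  have := D.isSFiniteKernel
  obtain ⟨f, hf, hfD⟩ := D.exists_selection hstab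
  -- No measurability of `σ` is assumed. Reading the measures off the kernel `D.κ` through the
  -- selected representative of `x` yields a measurable family.
  let s : X → Measure G := fun x => (D.κ (f x).1).map fun h => h * (f x).2⁻¹
  have hsσ : ∀ᵐ x ∂μ, ∃ c : ℝ≥0∞, c ≠ 0 ∧ c ≠ ∞ ∧ s x = c • σ x := by
    filter_upwards [hfD, D.X₀_mem] with x ⟨hS, hx⟩ hx₀
    have hg : (f x).2 • (f x).1 ∈ D.X₀ := by rw [hx]; exact hx₀
    obtain ⟨c, h0, ht, h⟩ := D.exists_smul_eq (D.mem_Y₀ _ hS _ hg) hg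
    refine ⟨c, h0, ht, ?_⟩
    simp only [s]
    rw [h, hx, Measure.map_smul, Measure.map_map (measurable_mul_const _) (measurable_mul_const _)]
    have hfun : ((fun h : G => h * (f x).2⁻¹) ∘ fun h => h * (f x).2) = id := by ext; simp
    rw [hfun, Measure.map_id]
  let Y₁ : Set X := D.X₀ ∩ {x | ∃ c : ℝ≥0∞, c ≠ 0 ∧ c ≠ ∞ ∧ s x = c • σ x}
  have hY₁ : Y₁ ∈ ae μ := Filter.inter_mem D.X₀_mem hsσ
  have hκ : ∀ y ∈ D.Y₀, ∀ g : G, g • y ∈ Y₁ →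
      ∃ c : ℝ≥0∞, c ≠ 0 ∧ c ≠ ∞ ∧ D.κ y = c • (s (g • y)).map fun h => h * g := by
    rintro y hy g ⟨hg, c', h0', ht', h'⟩
    obtain ⟨c, h0, ht, h⟩ := D.exists_smul_eq hy hg
    refine ⟨c * c'⁻¹, mul_ne_zero h0 (ENNReal.inv_ne_zero.2 ht'),
      ENNReal.mul_ne_top ht (ENNReal.inv_ne_top.2 h0'), ?_⟩
    rw [h, h', Measure.map_smul, smul_smul, mul_assoc, ENNReal.inv_mul_cancel h0' ht', mul_one]
  have hs : ∀ x ∈ Y₁, ∃ y ∈ D.Y₀, ∃ g : G, g • y = x ∧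
      ∃ c : ℝ≥0∞, c ≠ 0 ∧ c ≠ ∞ ∧ s x = c • (D.κ y).map fun h => h * g⁻¹ := by
    intro x hx
    obtain ⟨y, hyS, g, rfl⟩ := D.complete x
    have hy := D.mem_Y₀ y hyS g hx.1
    obtain ⟨c, h0, ht, h⟩ := hκ y hy g hx
    refine ⟨y, hy, g, rfl, c⁻¹, ENNReal.inv_ne_zero.2 ht, ENNReal.inv_ne_top.2 h0, ?_⟩
    have hfun : ((fun h : G => h * g⁻¹) ∘ fun h => h * g) = id := by ext; simp
    rw [h, Measure.map_smul, Measure.map_map (measurable_mul_const _) (measurable_mul_const _),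
      hfun, Measure.map_id, smul_smul, ENNReal.inv_mul_cancel h0 ht, one_smul]
  refine ⟨s, ⟨?_, ?_, ?_, ⟨Y₁, hY₁, ?_⟩, ?_, ?_⟩, ?_⟩
  · intro B hB
    simp only [s, Measure.map_apply (measurable_mul_const _) hB]
    have hm : MeasurableSet {q : X × G | q.2 * (f q.1).2⁻¹ ∈ B} :=
      (measurable_snd.mul ((measurable_snd.comp hf).comp measurable_fst).inv) hB
    exact (D.κ.comap (fun x => (f x).1) (measurable_fst.comp hf)).measurable_kernel_prodMk_left hm
  · filter_upwards [hY₁] with x hx h0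
    obtain ⟨y, hy, g, -, c, hc0, hct, h⟩ := hs x hx
    refine D.ne_zero y hy (Measure.measure_univ_eq_zero.1 ?_)
    have h1 := congrArg (fun m : Measure G => m Set.univ) (h.symm.trans h0)
    simpa [Measure.map_apply (measurable_mul_const _) MeasurableSet.univ, hc0] using h1
  · filter_upwards [hY₁] with x hx
    obtain ⟨y, hy, g, -, c, hc0, hct, h⟩ := hs x hx
    refine ⟨fun K hK => ?_⟩
    rw [h, Measure.smul_apply, smul_eq_mul,
      Measure.map_apply (measurable_mul_const _) hK.isClosed.measurableSet]
    exact ENNReal.mul_lt_top hct.lt_top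
      (D.finite y hy _ ((Homeomorph.mulRight g⁻¹).isCompact_preimage.2 hK))
  · intro x hx h hhx
    obtain ⟨y, hyS, g, rfl⟩ := D.complete x
    have hy := D.mem_Y₀ y hyS g hx.1
    obtain ⟨c, h0, ht, h1⟩ := hκ y hy g hx
    rw [smul_smul] at hhx
    obtain ⟨c', h0', ht', h1'⟩ := hκ y hy (h * g) hhx
    rw [mul_smul h g y] at h1'
    refine ⟨c'⁻¹ * c, mul_ne_zero (ENNReal.inv_ne_zero.2 ht') h0,
      ENNReal.mul_ne_top (ENNReal.inv_ne_top.2 h0') ht, exists_smul_eq_of_map_mul_eq g ?_⟩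
    have hfun : ((fun k : G => k * g) ∘ fun k => k * h) = fun k => k * (h * g) := by
      ext; simp [mul_assoc]
    rw [Measure.map_map (measurable_mul_const _) (measurable_mul_const _), hfun,
      mul_smul c'⁻¹ c, ← h1, h1',
      ← mul_smul c'⁻¹ c', ENNReal.inv_mul_cancel h0' ht', one_smul]
  · intro p hp
    have h1 := D.isLift.ae_of_ae hp
    rw [D.A_eq] at h1
    have h2 := Measure.ae_ae_of_ae_compProd h1
    obtain ⟨N, hN, hNm, hN0⟩ := exists_measurable_superset_of_null (ae_iff.1 h2)
    filter_upwards [hY₁, D.isLift.ae_notMem D.measurableSet_S (measurable_fst hNm)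
      (D.isPseudoImage.measure_eq_zero hNm hN0)] with x hx hxN
    obtain ⟨y, hyS, g, rfl⟩ := D.complete x
    have hyN : y ∉ N := fun h => hxN (y, g) h hyS rfl
    have h3 : ∀ᵐ k ∂(D.κ y), p (k • y) := not_not.1 fun h => hyN (hN h)
    obtain ⟨c, h0, ht, h⟩ := hκ y (D.mem_Y₀ y hyS g hx.1) g hx
    rw [h, Measure.ae_ennreal_smul_measure_iff h0] at h3
    have h4 := ae_of_ae_map (measurable_mul_const g).aemeasurable h3
    simpa only [mul_smul] using h4
  · intro N hN hae
    have hm : MeasurableSet {q : X × G | q.2 • q.1 ∈ N} :=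
      (measurable_snd.smul measurable_fst) hN
    -- A single good `g` in the nonzero fibre over `y` suffices: `D.κ y` is a translate of `s (g •
    -- y)`, so it gives no mass to elements sending `y` into `N`.
    have h1 : ∀ᵐ y ∂D.ν, ∀ᵐ g ∂(D.κ y), g • y ∈ Y₁ ∧ ∀ᵐ k ∂(s (g • y)), k • g • y ∉ N := by
      have h2 := D.isLift.ae_of_ae ((show ∀ᵐ x ∂μ, x ∈ Y₁ from hY₁).and hae)
      rw [D.A_eq] at h2
      exact Measure.ae_ae_of_ae_compProd h2
    have h2 : D.A {q : X × G | q.2 • q.1 ∈ N} = 0 := by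
      rw [D.A_eq, Measure.compProd_apply hm, lintegral_eq_zero_iff
        (Kernel.measurable_kernel_prodMk_left hm)]
      filter_upwards [h1, D.Y₀_mem] with y hy hy₀
      have : (ae (D.κ y)).NeBot := ae_neBot.2 (D.ne_zero y hy₀)
      obtain ⟨g, hg, hk⟩ := hy.exists
      obtain ⟨c, h0, ht, h⟩ := hκ y hy₀ g hg
      change D.κ y (Prod.mk y ⁻¹' {q : X × G | q.2 • q.1 ∈ N}) = 0
      rw [h, Measure.smul_apply, smul_eq_mul,
        Measure.map_apply (measurable_mul_const _) (measurable_prodMk_left hm)]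
      refine mul_eq_zero_of_right _ (measure_mono_null ?_ (ae_iff.1 hk))
      intro k hk
      simpa [mul_smul] using hk
    have h3 := D.isLift.ae_notMem D.measurableSet_S hm h2
    rw [measure_eq_zero_iff_ae_notMem]
    filter_upwards [h3] with x hx hxN
    obtain ⟨y, hyS, g, rfl⟩ := D.complete x
    exact hx (y, g) hxN hyS rfl
  · filter_upwards [hsσ] with x ⟨c, h0, ht, h⟩
    refine ⟨c⁻¹, ENNReal.inv_ne_zero.2 ht, ENNReal.inv_ne_top.2 h0, ?_⟩
    rw [h, smul_smul, ENNReal.inv_mul_cancel h0 ht, one_smul]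

end RegularFamily


/-! ### Equivariance of the conditional measures -/

section Equivariance

variable {G X : Type*} [Group G] [MetricSpace G] [ProperSpace G] [IsTopologicalGroup G]
  [MeasurableSpace G] [BorelSpace G]
  [MeasurableSpace X] [StandardBorelSpace X] [MulAction G X] [MeasurableSMul₂ G X]
  {μ : Measure X} {σ : X → Measure G}

omit [ProperSpace G] [MeasurableSMul₂ G X] in
/-- The image of a disintegration under a compatible pair of automorphisms is a disintegration. -/
lemma IsDisintegrationAlong.comp_automorphism (hσ : IsDisintegrationAlong μ σ)
    {αX : X ≃ᵐ X} {αG : G ≃* G} (hμ : MeasurePreserving αX μ μ)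
    (hequiv : ∀ (g : G) (x : X), αX (g • x) = αG g • αX x)
    (hc : Continuous αG) (hc' : Continuous αG.symm) :
    IsDisintegrationAlong μ fun x => (σ (αX x)).map αG.symm := by
  obtain ⟨S, A, ν, κ, ⟨hS, U, hUc, hU, hUs, hlac, hcomp⟩, hA, hν, hκ, hAeq, X', hX', hrel⟩ := hσ
  have hνf := hν.isFiniteMeasure
  have hsymm : ∀ (g : G) (y : X), αX.symm (g • y) = αG.symm g • αX.symm y := by
    intro g y
    rw [αX.symm_apply_eq, hequiv]
    simp
  have hm : Measurable αG := hc.measurable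
  have hm' : Measurable αG.symm := hc'.measurable
  -- All the data are transported by the inverses of the two automorphisms; invariance of `μ` makes
  -- the transported measure again the lift of `μ`.
  let Θ : X × G → X × G := fun p => (αX.symm p.1, αG.symm p.2)
  have hΘ : Measurable Θ := (αX.symm.measurable.comp measurable_fst).prodMk
    (hm'.comp measurable_snd)
  have hΘi : Function.Injective Θ := by
    rintro ⟨y, g⟩ ⟨y', g'⟩ h
    obtain ⟨h1, h2⟩ := Prod.ext_iff.1 h
    exact Prod.ext (αX.symm.injective h1) (αG.symm.injective h2)
  refine ⟨αX ⁻¹' S, A.map Θ, ν.map αX.symm, (κ.comap αX αX.measurable).map αG.symm,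
    ⟨αX.measurable hS, αG ⁻¹' U, ?_, ?_, ?_, ?_, ?_⟩, ?_, ?_, inferInstance, ?_, αX ⁻¹' X', ?_, ?_⟩
  · have : αG ⁻¹' U = αG.symm '' U := by
      ext g
      exact ⟨fun h => ⟨αG g, h, αG.symm_apply_apply g⟩, by
        rintro ⟨u, hu, rfl⟩; simpa using hu⟩
    rw [this]
    exact hUc.image hc'
  · have := hc.tendsto 1
    rw [map_one] at this
    exact this hU
  · intro g hg
    simpa using hUs _ hg
  · intro y hy g hg hgy
    apply αX.injective
    rw [hequiv]
    refine hlac _ hy _ hg ?_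
    rw [← hequiv]; exact hgy
  · intro x
    obtain ⟨g, hg, h, hh, y, hy, hx⟩ := hcomp (αX x)
    refine ⟨αG.symm g, by simpa using hg, αG.symm h, by simpa using hh, αX.symm y, by
      simpa using hy, ?_⟩
    rw [← map_mul, ← hsymm, hx, αX.symm_apply_apply]
  · intro B hB
    rw [Measure.map_apply hΘ hB, hA _ (hΘ hB)]
    rw [← hμ.lintegral_comp_emb αX.measurableEmbedding]
    refine lintegral_congr fun x => ?_
    have himg : {p : X × G | p ∈ B ∧ p.1 ∈ αX ⁻¹' S ∧ p.2 • p.1 = x}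
        = Θ '' {p : X × G | p ∈ Θ ⁻¹' B ∧ p.1 ∈ S ∧ p.2 • p.1 = αX x} := by
      ext ⟨y, g⟩
      constructor
      · rintro ⟨h1, h2, h3⟩
        have h4 : Θ (αX y, αG g) = (y, g) := by simp [Θ]
        refine ⟨(αX y, αG g), ⟨?_, h2, ?_⟩, h4⟩
        · rw [Set.mem_preimage, h4]; exact h1
        · change αG g • αX y = αX x
          rw [← hequiv]
          exact congrArg αX h3
      · rintro ⟨⟨y', g'⟩, ⟨h1, h2, h3⟩, h4⟩
        rw [← h4]
        refine ⟨h1, ?_, ?_⟩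
        · change αX (αX.symm y') ∈ S
          rw [αX.apply_symm_apply]; exact h2
        · change αG.symm g' • αX.symm y' = x
          rw [← hsymm]
          exact (αX.symm_apply_eq).2 h3
    rw [himg, Measure.count_injective_image hΘi]
  · obtain ⟨m, hmf, hmA, hAm, rfl⟩ := hν
    refine ⟨m.map Θ, inferInstance, hmA.map hΘ, hAm.map hΘ, ?_⟩
    rw [Measure.map_map αX.symm.measurable measurable_fst, Measure.map_map measurable_fst hΘ]
    rfl
  · ext B hB
    rw [Measure.map_apply hΘ hB, hAeq, Measure.compProd_apply (hΘ hB), Measure.compProd_apply hB,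
      lintegral_map (Kernel.measurable_kernel_prodMk_left hB) αX.symm.measurable]
    refine lintegral_congr fun y => ?_
    rw [Kernel.map_apply _ hm', Measure.map_apply hm' (measurable_prodMk_left hB),
      Kernel.comap_apply, αX.apply_symm_apply]
    rfl
  · exact hμ.quasiMeasurePreserving.ae hX'
  · rw [αX.symm.measurableEmbedding.ae_map_iff]
    filter_upwards [hrel] with y hy g hg
    have hg' : αG g • y ∈ X' := by
      have : αX (g • αX.symm y) ∈ X' := hg
      rwa [hequiv, αX.apply_symm_apply] at this
    obtain ⟨c, h0, ht, h⟩ := hy (αG g) hg'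
    refine ⟨c, h0, ht, ?_⟩
    have hx : αX (g • αX.symm y) = αG g • y := by rw [hequiv, αX.apply_symm_apply]
    have hfun : (fun h : G => h * g) ∘ αG.symm = αG.symm ∘ fun h => h * αG g := by
      ext h; simp
    rw [hx, Measure.map_map (measurable_mul_const g) hm', hfun,
      ← Measure.map_map hm' (measurable_mul_const _), h, Measure.map_smul,
      Kernel.map_apply _ hm', Kernel.comap_apply, αX.apply_symm_apply]

/-- Pulling `σ ∘ αX` back through `αG` gives a second disintegration of the same invariant measure,
so uniqueness applies. -/
lemma IsRegularFamily.ae_equivariant [IsFiniteMeasure μ] {s : X → Measure G}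
    (hstab : HasDiscreteStabilizers G X) (hσ : IsDisintegrationAlong μ σ)
    (hsσ : ∀ᵐ x ∂μ, ∃ c : ℝ≥0∞, c ≠ 0 ∧ c ≠ ∞ ∧ σ x = c • s x)
    {αX : X ≃ᵐ X} {αG : G ≃* G} (hμ : MeasurePreserving αX μ μ)
    (hequiv : ∀ (g : G) (x : X), αX (g • x) = αG g • αX x)
    (hc : Continuous αG) (hc' : Continuous αG.symm) :
    ∀ᵐ x ∂μ, ∃ c : ℝ≥0∞, c ≠ 0 ∧ c ≠ ∞ ∧ s (αX x) = c • (s x).map αG := by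
  obtain ⟨D⟩ := hσ.nonempty_sectionData hstab
  obtain ⟨D'⟩ := (hσ.comp_automorphism hμ hequiv hc hc').nonempty_sectionData hstab
  filter_upwards [D.ae_unique hstab D', hsσ, hμ.quasiMeasurePreserving.ae hsσ] with x
    ⟨c, h0, ht, h⟩ ⟨c₁, h10, h1t, h1⟩ ⟨c₂, h20, h2t, h2⟩
  have h3 : (σ x).map αG = c • σ (αX x) := by
    rw [h, Measure.map_smul, Measure.map_map hc.measurable hc'.measurable]
    have : (αG : G → G) ∘ αG.symm = id := by ext; simp
    rw [this, Measure.map_id]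
  rw [h1, h2, Measure.map_smul, smul_smul] at h3
  have hcc : c * c₂ ≠ 0 := mul_ne_zero h0 h20
  have hcct : c * c₂ ≠ ∞ := ENNReal.mul_ne_top ht h2t
  refine ⟨(c * c₂)⁻¹ * c₁, mul_ne_zero (ENNReal.inv_ne_zero.2 hcct) h10,
    ENNReal.mul_ne_top (ENNReal.inv_ne_top.2 hcc) h1t, ?_⟩
  rw [mul_smul, h3, smul_smul, ENNReal.inv_mul_cancel hcc hcct, one_smul]

end Equivariance


/-! ### Exact dimension of the conditional measures -/

section Contracting

variable {G : Type*} [Group G] [MetricSpace G] {α : ℝ} {αG : G ≃* G}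

lemma continuous_of_similarity (hα0 : 0 < α)
    (hsim : ∀ g h : G, dist (αG g) (αG h) = α * dist g h) : Continuous αG := by
  have : LipschitzWith (Real.toNNReal α) αG := LipschitzWith.of_dist_le_mul fun u v => by
    rw [hsim, Real.coe_toNNReal _ hα0.le]
  exact this.continuous

lemma continuous_symm_of_similarity (hα0 : 0 < α)
    (hsim : ∀ g h : G, dist (αG g) (αG h) = α * dist g h) : Continuous αG.symm := by
  have : LipschitzWith (Real.toNNReal α⁻¹) αG.symm := LipschitzWith.of_dist_le_mul fun u v => by
    have := hsim (αG.symm u) (αG.symm v)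
    simp only [MulEquiv.apply_symm_apply] at this
    rw [this, Real.coe_toNNReal _ (inv_pos.2 hα0).le, inv_mul_cancel_left₀ hα0.ne']
  exact this.continuous

lemma preimage_ball_one_of_similarity (hα0 : 0 < α)
    (hsim : ∀ g h : G, dist (αG g) (αG h) = α * dist g h) (ρ : ℝ) :
    αG ⁻¹' Metric.ball 1 (α * ρ) = Metric.ball 1 ρ := by
  ext g
  have h1 := hsim g 1
  rw [map_one] at h1
  rw [Set.mem_preimage, Metric.mem_ball, Metric.mem_ball, h1]
  exact mul_lt_mul_iff_right₀ hα0

lemma preimage_ball_mul_right (hdist : ∀ g h k : G, dist (g * k) (h * k) = dist g h) (g k : G)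
    (ρ : ℝ) : (fun h => h * k) ⁻¹' Metric.ball (g * k) ρ = Metric.ball g ρ := by
  ext h
  rw [Set.mem_preimage, Metric.mem_ball, Metric.mem_ball, hdist]

end Contracting

lemma measurableSet_setOf_eventually_atTop {Y : Type*} [MeasurableSpace Y] {p : ℕ → Y → Prop}
    (hp : ∀ n, MeasurableSet {y | p n y}) : MeasurableSet {y | ∀ᶠ n in atTop, p n y} := by
  have : {y | ∀ᶠ n in atTop, p n y} = ⋃ N, ⋂ n, ⋂ _ : N ≤ n, {y | p n y} := by
    ext y; simp [eventually_atTop]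
  rw [this]
  exact .iUnion fun N => .iInter fun n => .iInter fun _ => hp n

section Dimension

variable {G X : Type*} [Group G] [MetricSpace G] [ProperSpace G] [IsTopologicalGroup G]
  [MeasurableSpace G] [BorelSpace G]
  [MeasurableSpace X] [StandardBorelSpace X] [MulAction G X] [MeasurableSMul₂ G X]
  {μ : Measure X} {s : X → Measure G} {α : ℝ} {αG : G ≃* G}

-- Right translates of the unit ball centred on a countable dense set extend the estimate to all of
-- `G`, with the same rate.
omit [MeasurableSpace X] [StandardBorelSpace X] [MulAction G X] [MeasurableSMul₂ G X] in
lemma exists_ae_polynomial_lower_bound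
    (hdist : ∀ g h k : G, dist (g * k) (h * k) = dist g h) (hα0 : 0 < α) (hα1 : α < 1)
    (hsim : ∀ g h : G, dist (αG g) (αG h) = α * dist g h) :
    ∃ a : ℝ, 0 < a ∧ ∀ m : Measure G, ∀ᵐ g ∂m,
      ∀ᶠ n : ℕ in atTop, ENNReal.ofReal a ^ n ≤ m (Metric.ball g (α ^ n)) := by
  obtain ⟨a, ha, h⟩ := exists_polynomial_lower_bound hdist hα0 hα1 hsim
  refine ⟨a, ha, fun m => ?_⟩
  obtain ⟨D, hDc, hDd⟩ := TopologicalSpace.exists_countable_dense G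
  have h1 : ∀ k : G, ∀ᵐ g ∂m, g * k⁻¹ ∈ Metric.ball (1 : G) 1 →
      ∀ᶠ n : ℕ in atTop, ENNReal.ofReal a ^ n ≤ m (Metric.ball g (α ^ n)) := by
    intro k
    have h2 := ae_of_ae_map (measurable_mul_const k⁻¹).aemeasurable (h (m.map fun g => g * k⁻¹))
    filter_upwards [h2] with g hg hgk
    filter_upwards [hg hgk] with n hn
    rwa [Measure.map_apply (measurable_mul_const _) Metric.isOpen_ball.measurableSet,
      preimage_ball_mul_right hdist] at hn
  filter_upwards [(ae_ball_iff hDc).2 fun k _ => h1 k] with g hg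
  obtain ⟨k, hk, hkd⟩ := hDd.exists_dist_lt g one_pos
  refine hg k hk ?_
  rwa [Metric.mem_ball, ← dist_eq_dist_mul_inv_one hdist]

omit [ProperSpace G] [StandardBorelSpace X] [MeasurableSMul₂ G X] in
lemma IsRegularFamily.exists_ae_translate (hs : IsRegularFamily μ s) :
    ∃ X₀ ∈ ae μ, ∀ x ∈ X₀, ∀ g : G, g • x ∈ X₀ → ∃ c : ℝ≥0∞, c ≠ 0 ∧ c ≠ ∞ ∧
      ∀ E, MeasurableSet E → s (g • x) ((fun h => h * g) ⁻¹' E) = c * s x E := by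
  obtain ⟨X₀, hX₀, h⟩ := hs.ae_translate
  refine ⟨X₀, hX₀, fun x hx g hg => ?_⟩
  obtain ⟨c, h0, ht, hc⟩ := h x hx g hg
  refine ⟨c, h0, ht, fun E hE => ?_⟩
  rw [← Measure.map_apply (measurable_mul_const g) hE, hc, Measure.smul_apply, smul_eq_mul]

omit [ProperSpace G] [StandardBorelSpace X] [MeasurableSMul₂ G X] in
/-- Almost surely, `s (g • x)` is a translate of `s x`, for `s x`-almost every `g`. -/
lemma IsRegularFamily.ae_ae_translate (hs : IsRegularFamily μ s) :
    ∀ᵐ x ∂μ, ∀ᵐ g ∂(s x), ∃ c : ℝ≥0∞, c ≠ 0 ∧ c ≠ ∞ ∧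
      ∀ E, MeasurableSet E → s (g • x) ((fun h => h * g) ⁻¹' E) = c * s x E := by
  obtain ⟨X₀, hX₀, h⟩ := hs.exists_ae_translate
  filter_upwards [hX₀, hs.ae_of_ae _ hX₀] with x hx hx'
  filter_upwards [hx'] with g hg
  exact h x hx g hg

omit [ProperSpace G] [IsTopologicalGroup G] in
lemma measure_ball_one_of_translate (hdist : ∀ g h k : G, dist (g * k) (h * k) = dist g h)
    {m m' : Measure G} {g : G} {c : ℝ≥0∞}
    (h : ∀ E, MeasurableSet E → m' ((fun h => h * g) ⁻¹' E) = c * m E) (ρ : ℝ) :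
    m' (Metric.ball 1 ρ) = c * m (Metric.ball g ρ) := by
  have := preimage_ball_mul_right hdist 1 g ρ
  rw [one_mul] at this
  rw [← h _ Metric.isOpen_ball.measurableSet, this]

omit [ProperSpace G] [StandardBorelSpace X] [MeasurableSMul₂ G X] in
lemma IsRegularFamily.ae_ae_ball (hs : IsRegularFamily μ s)
    (hdist : ∀ g h k : G, dist (g * k) (h * k) = dist g h) :
    ∀ᵐ x ∂μ, ∀ᵐ g ∂(s x), ∃ c : ℝ≥0∞, c ≠ 0 ∧ c ≠ ∞ ∧
      ∀ ρ, s (g • x) (Metric.ball 1 ρ) = c * s x (Metric.ball g ρ) := by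
  filter_upwards [hs.ae_ae_translate] with x hx
  filter_upwards [hx] with g ⟨c, h0, ht, hc⟩
  exact ⟨c, h0, ht, measure_ball_one_of_translate hdist hc⟩

-- Almost every `g` for `s x` lies in the support of `s x`, and the ball around `g` corresponds to
-- the ball around `1` for the base point `g • x`. The field `null_of_ae_null` converts this into a
-- statement at `1`.
omit [StandardBorelSpace X] [MeasurableSMul₂ G X] in
lemma IsRegularFamily.ae_ball_pos (hs : IsRegularFamily μ s)
    (hdist : ∀ g h k : G, dist (g * k) (h * k) = dist g h) :
    ∀ᵐ x ∂μ, ∀ ρ, 0 < ρ → s x (Metric.ball 1 ρ) ≠ 0 := by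
  have h1 : ∀ n : ℕ, ∀ᵐ x ∂μ, s x (Metric.ball 1 (1 / ((n : ℝ) + 1))) ≠ 0 := by
    intro n
    have hm : MeasurableSet {x | s x (Metric.ball 1 (1 / ((n : ℝ) + 1))) = 0} :=
      hs.measurable _ Metric.isOpen_ball.measurableSet (measurableSet_singleton 0)
    refine measure_eq_zero_iff_ae_notMem.1 (hs.null_of_ae_null _ hm ?_)
    filter_upwards [hs.ae_ae_ball hdist] with x hx
    have hnull : s x {g | s x (Metric.ball g (1 / ((n : ℝ) + 1))) = 0} = 0 := by
      refine measure_null_of_locally_null _ fun g hg => ?_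
      exact ⟨_, mem_nhdsWithin_of_mem_nhds (Metric.ball_mem_nhds g (by positivity)), hg⟩
    filter_upwards [hx, measure_eq_zero_iff_ae_notMem.1 hnull] with g ⟨c, h0, ht, hc⟩ hg hgx
    have h2 : s (g • x) (Metric.ball 1 (1 / ((n : ℝ) + 1))) = 0 := hgx
    rw [hc, mul_eq_zero] at h2
    exact hg (h2.resolve_left h0)
  filter_upwards [ae_all_iff.2 h1] with x hx ρ hρ h0
  obtain ⟨n, hn⟩ := exists_nat_one_div_lt hρ
  exact hx n (measure_mono_null (Metric.ball_subset_ball hn.le) h0)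

omit [IsTopologicalGroup G] [BorelSpace G] [StandardBorelSpace X] [MeasurableSMul₂ G X] in
lemma IsRegularFamily.ae_ball_ne_top (hs : IsRegularFamily μ s) :
    ∀ᵐ x ∂μ, ∀ ρ, s x (Metric.ball 1 ρ) ≠ ∞ := by
  filter_upwards [hs.ae_finite] with x hx ρ
  exact ne_top_of_le_ne_top (isCompact_closedBall (1 : G) ρ).measure_lt_top.ne
    (measure_mono Metric.ball_subset_closedBall)

-- The lower bound at typical `g` is moved to `1`. Halving the rate absorbs the scalar of the
-- translation, which depends on `x` and `g` but not on `n`.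
omit [StandardBorelSpace X] [MeasurableSMul₂ G X] in
lemma IsRegularFamily.exists_ae_ball_ge (hs : IsRegularFamily μ s)
    (hdist : ∀ g h k : G, dist (g * k) (h * k) = dist g h) (hα0 : 0 < α) (hα1 : α < 1)
    (hsim : ∀ g h : G, dist (αG g) (αG h) = α * dist g h) :
    ∃ a : ℝ, 0 < a ∧ ∀ᵐ x ∂μ, ∀ᶠ n : ℕ in atTop,
      ENNReal.ofReal a ^ n ≤ s x (Metric.ball 1 (α ^ n)) := by
  obtain ⟨a, ha, h⟩ := exists_ae_polynomial_lower_bound hdist hα0 hα1 hsim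
  refine ⟨a / 2, by positivity, ?_⟩
  have hm : MeasurableSet {x | ∀ᶠ n : ℕ in atTop,
      ENNReal.ofReal (a / 2) ^ n ≤ s x (Metric.ball 1 (α ^ n))} :=
    measurableSet_setOf_eventually_atTop fun n => measurableSet_le measurable_const
      (hs.measurable _ Metric.isOpen_ball.measurableSet)
  have h0 := hs.null_of_ae_null _ hm.compl ?_
  · filter_upwards [measure_eq_zero_iff_ae_notMem.1 h0] with x hx
    exact not_not.1 hx
  filter_upwards [hs.ae_ae_ball hdist] with x hx
  filter_upwards [hx, h (s x)] with g ⟨c, hc0, hct, hc⟩ hg hgN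
  refine hgN ?_
  have hlim := (ENNReal.tendsto_pow_atTop_nhds_zero_of_lt_one
    (ENNReal.inv_lt_one.2 ENNReal.one_lt_two)).eventually (gt_mem_nhds (pos_iff_ne_zero.2 hc0))
  change ∀ᶠ n : ℕ in atTop, ENNReal.ofReal (a / 2) ^ n ≤ s (g • x) (Metric.ball 1 (α ^ n))
  filter_upwards [hg, hlim] with n hn1 hn2
  rw [hc, div_eq_inv_mul, ENNReal.ofReal_mul (by norm_num), mul_pow,
    ENNReal.ofReal_inv_of_pos two_pos, ENNReal.ofReal_ofNat]
  exact mul_le_mul' hn2.le hn1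

omit [StandardBorelSpace X] [MeasurableSMul₂ G X] in
/-- The masses of small balls around the identity decay at a constant exponential rate. -/
lemma IsRegularFamily.exists_ae_tendsto_log_ball [IsProbabilityMeasure μ]
    (hs : IsRegularFamily μ s)
    (hdist : ∀ g h k : G, dist (g * k) (h * k) = dist g h) (hα0 : 0 < α) (hα1 : α < 1)
    (hsim : ∀ g h : G, dist (αG g) (αG h) = α * dist g h) {αX : X ≃ᵐ X} (herg : Ergodic αX μ)
    (heq : ∀ᵐ x ∂μ, ∃ c : ℝ≥0∞, c ≠ 0 ∧ c ≠ ∞ ∧ s (αX x) = c • (s x).map αG) :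
    ∃ I : ℝ, 0 ≤ I ∧ ∀ᵐ x ∂μ, Tendsto
      (fun n : ℕ => Real.log (s x (Metric.ball 1 (α ^ n))).toReal / n) atTop (𝓝 (-I)) := by
  have hT : Ergodic αX.symm μ := herg.symm
  let l : ℕ → X → ℝ := fun n x => Real.log (s x (Metric.ball 1 (α ^ n))).toReal
  have hlm : ∀ n, Measurable (l n) := fun n =>
    Real.measurable_log.comp (hs.measurable _ Metric.isOpen_ball.measurableSet).ennreal_toReal
  -- The maximum is almost surely superfluous; it makes `φ` nonnegative everywhere.
  let φ : X → ℝ := fun x => max 0 (l 0 x - l 1 x)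
  have hφm : Measurable φ := measurable_const.max ((hlm 0).sub (hlm 1))
  have hmono : ∀ᵐ x ∂μ, l 1 x ≤ l 0 x := by
    filter_upwards [hs.ae_ball_pos hdist, hs.ae_ball_ne_top] with x hx1 hx2
    refine Real.log_le_log (ENNReal.toReal_pos (hx1 _ (by positivity)) (hx2 _))
      (ENNReal.toReal_mono (hx2 _) (measure_mono (Metric.ball_subset_ball ?_)))
    simpa using hα1.le
  -- Differences of consecutive logarithms cancel the scalar in the equivariance relation. Since
  -- `αX` corresponds to contraction, zooming in is iteration of its inverse, and the Birkhoff sums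
  -- of `φ` telescope.
  have hstep : ∀ᵐ x ∂μ, ∀ n, l (n + 1) x - l (n + 2) x = l n (αX.symm x) - l (n + 1) (αX.symm x) := by
    have h1 : ∀ᵐ x ∂μ, ∀ n, l (n + 1) (αX x) - l (n + 2) (αX x) = l n x - l (n + 1) x := by
      filter_upwards [heq, hs.ae_ball_pos hdist, hs.ae_ball_ne_top] with x ⟨c, hc0, hct, hc⟩ hx1 hx2 n
      have h2 : ∀ n, l (n + 1) (αX x) = Real.log c.toReal + l n x := by
        intro n
        have h3 : s (αX x) (Metric.ball 1 (α ^ (n + 1))) = c * s x (Metric.ball 1 (α ^ n)) := by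
          rw [hc, Measure.smul_apply, smul_eq_mul, Measure.map_apply
            (continuous_of_similarity hα0 hsim).measurable Metric.isOpen_ball.measurableSet,
            pow_succ', preimage_ball_one_of_similarity hα0 hsim]
        simp only [l]
        rw [h3, ENNReal.toReal_mul, Real.log_mul (ENNReal.toReal_pos hc0 hct).ne'
          (ENNReal.toReal_pos (hx1 _ (pow_pos hα0 n)) (hx2 _)).ne']
      rw [h2, h2]
      ring
    filter_upwards [hT.quasiMeasurePreserving.ae h1] with x hx n
    simpa using hx n
  have hsum : ∀ᵐ x ∂μ, ∀ n, birkhoffSum αX.symm φ n x = l 0 x - l n x := by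
    have hall : ∀ᵐ x ∂μ, ∀ k : ℕ, l 1 (αX.symm^[k] x) ≤ l 0 (αX.symm^[k] x) ∧
        ∀ n, l (n + 1) (αX.symm^[k] x) - l (n + 2) (αX.symm^[k] x)
          = l n (αX.symm^[k + 1] x) - l (n + 1) (αX.symm^[k + 1] x) := by
      refine ae_all_iff.2 fun k => ?_
      filter_upwards [(hT.toMeasurePreserving.iterate k).quasiMeasurePreserving.ae
        (hmono.and hstep)] with x hx
      refine ⟨hx.1, fun n => ?_⟩
      rw [Function.iterate_succ_apply']
      exact hx.2 n
    filter_upwards [hall] with x hx n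
    have h1 : ∀ k j, l j (αX.symm^[k] x) - l (j + 1) (αX.symm^[k] x) = l (k + j) x - l (k + j + 1) x := by
      intro k
      induction k with
      | zero => intro j; simp
      | succ k ih =>
        intro j
        rw [← (hx k).2 j, ih (j + 1)]
        congr 2 <;> ring
    rw [← Finset.sum_range_sub' (fun n => l n x) n]
    refine Finset.sum_congr rfl fun k _ => ?_
    have h2 := h1 k 0
    simp only [zero_add, add_zero] at h2
    simp only [φ]
    rw [max_eq_right (sub_nonneg.2 (hx k).1), h2]
  obtain ⟨a, ha, hlow⟩ := hs.exists_ae_ball_ge hdist hα0 hα1 hsim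
  have hφint : Integrable φ μ := by
    -- Integrability of `φ` is not known beforehand. Its bounded truncations have Birkhoff limits at
    -- most `-log a` by the exponential lower bound on ball masses, and monotone convergence passes
    -- this to `φ`.
    let ψ : ℕ → X → ℝ := fun M x => min (φ x) M
    have hψm : ∀ M, Measurable (ψ M) := fun M => hφm.min measurable_const
    have hψ0 : ∀ M x, 0 ≤ ψ M x := fun M x => le_min (le_max_left _ _) (Nat.cast_nonneg M)
    have hψi : ∀ M, Integrable (ψ M) μ := fun M =>
      Integrable.of_bound (hψm M).aestronglyMeasurable (M : ℝ) (Eventually.of_forall fun x => by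
        rw [Real.norm_eq_abs, abs_of_nonneg (hψ0 M x)]; exact min_le_right _ _)
    have hbound : ∀ M, ∫ x, ψ M x ∂μ ≤ -Real.log a := by
      intro M
      have hae := (hT.ae_tendsto_birkhoffSum_div (hψm M) (hψi M)).and (hsum.and (hlow.and
        (hs.ae_ball_pos hdist |>.and hs.ae_ball_ne_top)))
      obtain ⟨x, hx1, hx2, hx3, hx4, hx5⟩ := hae.exists
      have hlim : Tendsto (fun n : ℕ => l 0 x / (n : ℝ) + (-Real.log a)) atTop
          (𝓝 (0 + (-Real.log a))) :=
        (tendsto_const_div_atTop_nhds_zero_nat _).add tendsto_const_nhds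
      rw [zero_add] at hlim
      refine le_of_tendsto_of_tendsto hx1 hlim ?_
      filter_upwards [hx3, eventually_gt_atTop 0] with n hn hn0
      have hn0' : (0 : ℝ) < n := Nat.cast_pos.2 hn0
      have h2 : birkhoffSum αX.symm (ψ M) n x ≤ birkhoffSum αX.symm φ n x :=
        Finset.sum_le_sum fun k _ => min_le_left _ _
      have h3 : n * Real.log a ≤ l n x := by
        rw [← Real.log_pow]
        refine Real.log_le_log (pow_pos ha n) ?_
        rw [← ENNReal.ofReal_pow ha.le, ENNReal.ofReal_le_iff_le_toReal (hx5 _)] at hn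
        exact hn
      rw [hx2] at h2
      rw [div_add' _ _ _ hn0'.ne', div_le_div_iff_of_pos_right hn0']
      linarith
    have hlim : Tendsto (fun M => ∫⁻ x, ENNReal.ofReal (ψ M x) ∂μ) atTop
        (𝓝 (∫⁻ x, ENNReal.ofReal (φ x) ∂μ)) := by
      refine lintegral_tendsto_of_tendsto_of_monotone
        (fun M => (hψm M).ennreal_ofReal.aemeasurable) ?_ ?_
      · refine Eventually.of_forall fun x M M' h => ENNReal.ofReal_le_ofReal ?_
        exact min_le_min_left _ (Nat.cast_le.2 h)
      · refine Eventually.of_forall fun x => tendsto_const_nhds.congr' ?_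
        obtain ⟨K, hK⟩ := exists_nat_ge (φ x)
        filter_upwards [eventually_ge_atTop K] with M hM
        rw [show ψ M x = φ x from min_eq_left (hK.trans (Nat.cast_le.2 hM))]
    refine ⟨hφm.aestronglyMeasurable, ?_⟩
    have hφ0 : ∀ x, 0 ≤ φ x := fun x => le_max_left _ _
    rw [hasFiniteIntegral_iff_ofReal (Eventually.of_forall hφ0)]
    refine (le_of_tendsto' hlim fun M => ?_).trans_lt
      (ENNReal.ofReal_lt_top (r := -Real.log a))
    rw [← ofReal_integral_eq_lintegral_ofReal (hψi M) (Eventually.of_forall (hψ0 M))]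
    exact ENNReal.ofReal_le_ofReal (hbound M)
  refine ⟨∫ x, φ x ∂μ, integral_nonneg fun x => le_max_left _ _, ?_⟩
  filter_upwards [hT.ae_tendsto_birkhoffSum_div hφm hφint, hsum] with x hx1 hx2
  have h1 := (tendsto_const_div_atTop_nhds_zero_nat (l 0 x)).sub hx1
  rw [zero_sub] at h1
  refine h1.congr fun n => ?_
  rw [hx2, ← sub_div, sub_sub_cancel]

end Dimension


section DimensionAlong

variable {G X : Type*} [Group G] [MetricSpace G] [ProperSpace G] [IsTopologicalGroup G]
  [MeasurableSpace G] [BorelSpace G]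
  [MeasurableSpace X] [StandardBorelSpace X] [MulAction G X] [MeasurableSMul₂ G X]
  {μ : Measure X} {s : X → Measure G} {α : ℝ} {αG : G ≃* G}

/-- Two disintegrations along the same action are proportional. -/
lemma IsDisintegrationAlong.ae_eq_smul [IsFiniteMeasure μ] (hstab : HasDiscreteStabilizers G X)
    {σ σ' : X → Measure G} (hσ : IsDisintegrationAlong μ σ) (hσ' : IsDisintegrationAlong μ σ')
    (hsσ : ∀ᵐ x ∂μ, ∃ c : ℝ≥0∞, c ≠ 0 ∧ c ≠ ∞ ∧ σ x = c • s x) :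
    ∀ᵐ x ∂μ, ∃ c : ℝ≥0∞, c ≠ 0 ∧ c ≠ ∞ ∧ σ' x = c • s x := by
  obtain ⟨D⟩ := hσ.nonempty_sectionData hstab
  obtain ⟨D'⟩ := hσ'.nonempty_sectionData hstab
  filter_upwards [SectionData.ae_unique hstab D' D, hsσ] with x ⟨c, h0, ht, hc⟩ ⟨c', h0', ht', hc'⟩
  refine ⟨c * c', mul_ne_zero h0 h0', ENNReal.mul_ne_top ht ht', ?_⟩
  rw [hc, hc', mul_smul]

omit [StandardBorelSpace X] [MeasurableSMul₂ G X] in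
/-- The conditional measures of a regular family are exact-dimensional. -/
theorem IsRegularFamily.exists_dimension [IsProbabilityMeasure μ]
    (hs : IsRegularFamily μ s)
    (hdist : ∀ g h k : G, dist (g * k) (h * k) = dist g h) (hα0 : 0 < α) (hα1 : α < 1)
    (hsim : ∀ g h : G, dist (αG g) (αG h) = α * dist g h) {αX : X ≃ᵐ X} (herg : Ergodic αX μ)
    (heq : ∀ᵐ x ∂μ, ∃ c : ℝ≥0∞, c ≠ 0 ∧ c ≠ ∞ ∧ s (αX x) = c • (s x).map αG) :
    ∃ d : ℝ, ∀ᵐ x ∂μ,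
      Tendsto (logRatio fun ρ => s x (Metric.ball 1 ρ)) (𝓝[>] 0) (𝓝 (d : EReal)) := by
  obtain ⟨I, -, hI⟩ := hs.exists_ae_tendsto_log_ball hdist hα0 hα1 hsim herg heq
  have hlog := Real.log_neg hα0 hα1
  refine ⟨I / (-Real.log α), ?_⟩
  filter_upwards [hI, hs.ae_ball_pos hdist, hs.ae_ball_ne_top] with x hx hpos htop
  refine tendsto_logRatio_of_scale hα0 hα1 (fun a b hab => measure_mono (Metric.ball_subset_ball hab))
    (fun n => hpos _ (pow_pos hα0 n)) (fun n => htop _) ?_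
  have : I / (-Real.log α) * Real.log α = -I := by
    rw [div_neg, neg_mul, div_mul_cancel₀ _ hlog.ne]
  rwa [this]

lemma tendsto_logRatio_of_eq_mul (hα0 : 0 < α) (hα1 : α < 1) {m m' : ℝ → ℝ≥0∞} (hm : Monotone m')
    {c : ℝ≥0∞} (h0 : c ≠ 0) (ht : c ≠ ∞) (h : ∀ ρ, m' ρ = c * m ρ) {d : ℝ}
    (hd : Tendsto (logRatio m') (𝓝[>] 0) (𝓝 (d : EReal))) :
    Tendsto (logRatio m) (𝓝[>] 0) (𝓝 (d : EReal)) := by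
  have h1 := tendsto_logRatio_const_mul hα0 hα1 hm
    (ENNReal.inv_ne_zero.2 ht) (ENNReal.inv_ne_top.2 h0) hd
  simp_rw [h, ← mul_assoc, ENNReal.inv_mul_cancel h0 ht, one_mul] at h1
  exact h1

-- Balls around a typical `g` are balls around `1` for the base point `g • x`, up to a scalar that
-- does not affect the limit.
omit [ProperSpace G] [StandardBorelSpace X] [MeasurableSMul₂ G X] in
lemma IsRegularFamily.ae_ae_tendsto_logRatio_ball (hs : IsRegularFamily μ s)
    (hdist : ∀ g h k : G, dist (g * k) (h * k) = dist g h) (hα0 : 0 < α) (hα1 : α < 1) {d : ℝ}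
    (hd : ∀ᵐ x ∂μ,
      Tendsto (logRatio fun ρ => s x (Metric.ball 1 ρ)) (𝓝[>] 0) (𝓝 (d : EReal))) :
    ∀ᵐ x ∂μ, ∀ᵐ g ∂(s x),
      Tendsto (logRatio fun ρ => s x (Metric.ball g ρ)) (𝓝[>] 0) (𝓝 (d : EReal)) := by
  filter_upwards [hs.ae_ae_ball hdist, hs.ae_of_ae _ hd] with x hx hx'
  filter_upwards [hx, hx'] with g ⟨c, h0, ht, hc⟩ hg
  exact tendsto_logRatio_of_eq_mul hα0 hα1
    (fun a b hab => measure_mono (Metric.ball_subset_ball hab)) h0 ht hc hg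

lemma IsDisintegrationAlong.isDimensionAlong [IsFiniteMeasure μ]
    (hstab : HasDiscreteStabilizers G X) {σ : X → Measure G} (hσ : IsDisintegrationAlong μ σ)
    (hsσ : ∀ᵐ x ∂μ, ∃ c : ℝ≥0∞, c ≠ 0 ∧ c ≠ ∞ ∧ σ x = c • s x)
    (hs : IsRegularFamily μ s)
    (hdist : ∀ g h k : G, dist (g * k) (h * k) = dist g h) (hα0 : 0 < α) (hα1 : α < 1) {d : ℝ}
    (hd : ∀ᵐ x ∂μ,
      Tendsto (logRatio fun ρ => s x (Metric.ball 1 ρ)) (𝓝[>] 0) (𝓝 (d : EReal))) :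
    IsDimensionAlong G μ d := by
  intro σ' hσ'
  filter_upwards [hσ.ae_eq_smul hstab hσ' hsσ, hs.ae_ae_tendsto_logRatio_ball hdist hα0 hα1 hd]
    with x ⟨c, h0, ht, hc⟩ hx
  rw [hc, Measure.ae_ennreal_smul_measure_iff h0]
  filter_upwards [hx] with g hg
  exact tendsto_logRatio_const_mul hα0 hα1
    (fun a b hab => measure_mono (Metric.ball_subset_ball hab)) h0 ht hg

end DimensionAlong


/-! ### Transverse dimension -/

/-- The lower exponent of the mass in `B` of thin tubes around the coset `H g`. -/
noncomputable def tubeExponent {G : Type*} [Group G] [MetricSpace G] [MeasurableSpace G]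
    (H : Subgroup G) (s : Measure G) (B : Set G) (g : G) : EReal :=
  liminf (logRatio fun ρ => s (B ∩ cosetTube H g ρ)) (𝓝[>] 0)

section TubeExponent

variable {G : Type*} [Group G] [MetricSpace G] [MeasurableSpace G]
  {α : ℝ} {αG : G ≃* G} {H : Subgroup G} {s : Measure G} {B B' : Set G}

lemma monotone_measure_inter_cosetTube (s : Measure G) (B : Set G) (g : G) :
    Monotone fun ρ => s (B ∩ cosetTube H g ρ) := fun _ _ hab =>
  measure_mono (Set.inter_subset_inter_right _ (cosetTube_mono g hab))

lemma tubeExponent_anti (hα0 : 0 < α) (hα1 : α < 1) (hB : B ⊆ B') (g : G) :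
    tubeExponent H s B' g ≤ tubeExponent H s B g := by
  refine liminf_logRatio_le_of_le_mul hα0 hα1 (monotone_measure_inter_cosetTube _ _ _)
    ENNReal.one_ne_top fun ρ => ?_
  rw [one_mul]
  exact measure_mono (Set.inter_subset_inter_left _ hB)

lemma tubeExponent_smul (hα0 : 0 < α) (hα1 : α < 1) {c : ℝ≥0∞} (h0 : c ≠ 0) (ht : c ≠ ∞) (g : G) :
    tubeExponent H (c • s) B g = tubeExponent H s B g :=
  liminf_logRatio_const_mul hα0 hα1 (monotone_measure_inter_cosetTube s B g) h0 ht

variable [ProperSpace G] [BorelSpace G] [H.Normal]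

/-- At typical points this reverses `tubeExponent_anti`. A countable sequence of rates `α ^ (1 / (k
+ 1))` tending to `1` suffices for all subexponential losses. -/
lemma ae_tubeExponent_le (hdist : ∀ g h k : G, dist (g * k) (h * k) = dist g h)
    (hα0 : 0 < α) (hα1 : α < 1) (hsim : ∀ g h : G, dist (αG g) (αG h) = α * dist g h)
    (hB : IsCompact B) (hB' : s B' ≠ ∞) :
    ∀ᵐ g ∂s, g ∈ B → tubeExponent H s B g ≤ tubeExponent H s B' g := by
  have h1 : ∀ k : ℕ, ENNReal.ofReal (α ^ (1 / ((k : ℝ) + 1))) < 1 := fun k => by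
    rw [ENNReal.ofReal_lt_one]
    exact Real.rpow_lt_one hα0.le hα1 (by positivity)
  filter_upwards [ae_all_iff.2 fun k => ae_cosetTube_inter_ge (H := H) hdist hα0 hsim s hB hB' (h1 k)]
    with g hg hgB
  refine liminf_logRatio_le_of_subexp hα0 hα1 (monotone_measure_inter_cosetTube _ _ _)
    ENNReal.one_ne_top fun ε hε => ?_
  obtain ⟨k, hk⟩ := exists_nat_one_div_lt hε
  filter_upwards [hg k hgB] with n hn
  rw [one_mul]
  refine le_trans ?_ hn
  gcongr ENNReal.ofReal ?_ ^ n * _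
  exact Real.rpow_le_rpow_of_exponent_ge hα0 hα1.le hk.le

lemma ae_forall_tubeExponent_le [IsFiniteMeasureOnCompacts s]
    (hdist : ∀ g h k : G, dist (g * k) (h * k) = dist g h)
    (hα0 : 0 < α) (hα1 : α < 1) (hsim : ∀ g h : G, dist (αG g) (αG h) = α * dist g h)
    (hB : IsCompact B) :
    ∀ᵐ g ∂s, g ∈ B → ∀ B', Bornology.IsBounded B' →
      tubeExponent H s B g ≤ tubeExponent H s B' g := by
  filter_upwards [ae_all_iff.2 fun n : ℕ => ae_tubeExponent_le (H := H) hdist hα0 hα1 hsim hB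
    (isCompact_closedBall (1 : G) n).measure_lt_top.ne (s := s)] with g hg hgB B' hB'
  obtain ⟨R, hR⟩ := hB'.subset_closedBall (1 : G)
  obtain ⟨n, hn⟩ := exists_nat_ge R
  exact (hg n hgB).trans
    (tubeExponent_anti hα0 hα1 (hR.trans (Metric.closedBall_subset_closedBall hn)) g)

/-- Here the window moves with `g`. It contains a fixed ball of half the radius around some point of
a countable dense set, and the previous result applies to that ball. -/
lemma ae_forall_tubeExponent_closedBall_le [IsFiniteMeasureOnCompacts s]
    (hdist : ∀ g h k : G, dist (g * k) (h * k) = dist g h)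
    (hα0 : 0 < α) (hα1 : α < 1) (hsim : ∀ g h : G, dist (αG g) (αG h) = α * dist g h)
    {r : ℝ} (hr : 0 < r) :
    ∀ᵐ g ∂s, ∀ B', Bornology.IsBounded B' →
      tubeExponent H s (Metric.closedBall g r) g ≤ tubeExponent H s B' g := by
  obtain ⟨D, hDc, hDd⟩ := TopologicalSpace.exists_countable_dense G
  filter_upwards [(ae_ball_iff hDc).2 fun k _ => ae_forall_tubeExponent_le (H := H) (s := s)
    hdist hα0 hα1 hsim (isCompact_closedBall k (r / 2))] with g hg B' hB'
  obtain ⟨k, hk, hkd⟩ := hDd.exists_dist_lt g (half_pos hr)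
  refine le_trans (tubeExponent_anti hα0 hα1 ?_ g) (hg k hk hkd.le B' hB')
  refine Metric.closedBall_subset_closedBall' ?_
  rw [dist_comm]
  linarith

omit [MeasurableSpace G] [ProperSpace G] [BorelSpace G] [H.Normal] in
lemma preimage_inter_cosetTube_mul_right
    (hdist : ∀ g h k : G, dist (g * k) (h * k) = dist g h) (g : G) (r ρ : ℝ) :
    (fun h => h * g) ⁻¹' (Metric.closedBall g r ∩ cosetTube H g ρ)
      = Metric.closedBall 1 r ∩ cosetTube H 1 ρ := by
  ext h
  have h1 := hdist h 1 g
  rw [one_mul] at h1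
  rw [Set.mem_preimage, Set.mem_inter_iff, Set.mem_inter_iff, mem_cosetTube_iff_mul_inv hdist,
    mul_inv_cancel_right, Metric.mem_closedBall, Metric.mem_closedBall, h1]

omit [MeasurableSpace G] [ProperSpace G] [BorelSpace G] [H.Normal] in
lemma preimage_closedBall_inter_cosetTube_of_similarity (hα0 : 0 < α)
    (hsim : ∀ g h : G, dist (αG g) (αG h) = α * dist g h) (hHα : H.map (αG : G →* G) = H) (ρ : ℝ) :
    αG ⁻¹' (Metric.closedBall 1 α ∩ cosetTube H 1 (α * ρ))
      = Metric.closedBall 1 1 ∩ cosetTube H 1 ρ := by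
  ext h
  have h1 := hsim h 1
  rw [map_one] at h1
  rw [Set.mem_preimage, Set.mem_inter_iff, Set.mem_inter_iff,
    apply_mem_cosetTube_one_iff hα0 hsim hHα, Metric.mem_closedBall, Metric.mem_closedBall, h1,
    mul_le_iff_le_one_right hα0]

end TubeExponent

section Transverse

variable {G X : Type*} [Group G] [MetricSpace G] [ProperSpace G] [IsTopologicalGroup G]
  [MeasurableSpace G] [BorelSpace G]
  [MeasurableSpace X] [StandardBorelSpace X] [MulAction G X] [MeasurableSMul₂ G X]
  {μ : Measure X} {s : X → Measure G} {α : ℝ} {αG : G ≃* G} {H : Subgroup G}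

omit [ProperSpace G] [IsTopologicalGroup G] in
lemma tubeExponent_one_of_translate (hdist : ∀ g h k : G, dist (g * k) (h * k) = dist g h)
    (hα0 : 0 < α) (hα1 : α < 1) {m m' : Measure G} {g : G} {c : ℝ≥0∞} (h0 : c ≠ 0) (ht : c ≠ ∞)
    (h : ∀ E, MeasurableSet E → m' ((fun h => h * g) ⁻¹' E) = c * m E) (r : ℝ) :
    tubeExponent H m' (Metric.closedBall 1 r) 1 = tubeExponent H m (Metric.closedBall g r) g := by
  refine Eq.trans ?_ (liminf_logRatio_const_mul hα0 hα1
    (monotone_measure_inter_cosetTube (H := H) m (Metric.closedBall g r) g) h0 ht)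
  refine congrArg (fun m => liminf (logRatio m) (𝓝[>] 0)) (funext fun ρ => ?_)
  rw [← h _ (Metric.isClosed_closedBall.measurableSet.inter isOpen_cosetTube.measurableSet),
    preimage_inter_cosetTube_mul_right hdist]

omit [ProperSpace G] [StandardBorelSpace X] [MeasurableSMul₂ G X] in
lemma IsRegularFamily.ae_ae_tubeExponent_smul (hs : IsRegularFamily μ s)
    (hdist : ∀ g h k : G, dist (g * k) (h * k) = dist g h) (hα0 : 0 < α) (hα1 : α < 1) :
    ∀ᵐ x ∂μ, ∀ᵐ g ∂(s x), ∀ r, tubeExponent H (s (g • x)) (Metric.closedBall 1 r) 1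
      = tubeExponent H (s x) (Metric.closedBall g r) g := by
  filter_upwards [hs.ae_ae_translate] with x hx
  filter_upwards [hx] with g ⟨c, h0, ht, hc⟩ r
  exact tubeExponent_one_of_translate hdist hα0 hα1 h0 ht hc r

omit [ProperSpace G] [IsTopologicalGroup G] [StandardBorelSpace X] [MeasurableSMul₂ G X] in
lemma IsRegularFamily.measurable_tubeExponent (hs : IsRegularFamily μ s)
    (hα0 : 0 < α) (hα1 : α < 1) (r : ℝ) :
    Measurable fun x => tubeExponent H (s x) (Metric.closedBall 1 r) 1 :=
  measurable_liminf_logRatio hα0 hα1 (fun _ => monotone_measure_inter_cosetTube _ _ _) fun _ =>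
    hs.measurable _ (Metric.isClosed_closedBall.measurableSet.inter isOpen_cosetTube.measurableSet)

omit [StandardBorelSpace X] [MeasurableSMul₂ G X] in
lemma IsRegularFamily.ae_tubeExponent_eq [H.Normal] (hs : IsRegularFamily μ s)
    (hdist : ∀ g h k : G, dist (g * k) (h * k) = dist g h) (hα0 : 0 < α) (hα1 : α < 1)
    (hsim : ∀ g h : G, dist (αG g) (αG h) = α * dist g h) {r r' : ℝ} (hr : 0 < r) (hr' : 0 < r') :
    ∀ᵐ x ∂μ, tubeExponent H (s x) (Metric.closedBall 1 r) 1
      = tubeExponent H (s x) (Metric.closedBall 1 r') 1 := by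
  have hm : MeasurableSet {x | tubeExponent H (s x) (Metric.closedBall 1 r) 1
      = tubeExponent H (s x) (Metric.closedBall 1 r') 1} :=
    measurableSet_eq_fun (hs.measurable_tubeExponent hα0 hα1 r)
      (hs.measurable_tubeExponent hα0 hα1 r')
  have h0 := hs.null_of_ae_null _ hm.compl ?_
  · filter_upwards [measure_eq_zero_iff_ae_notMem.1 h0] with x hx
    exact not_not.1 hx
  filter_upwards [hs.ae_ae_tubeExponent_smul (H := H) hdist hα0 hα1, hs.ae_finite] with x hx hfin
  filter_upwards [hx, ae_forall_tubeExponent_closedBall_le (H := H) (s := s x) hdist hα0 hα1 hsim hr,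
    ae_forall_tubeExponent_closedBall_le (H := H) (s := s x) hdist hα0 hα1 hsim hr']
    with g hg hg1 hg2
  refine not_not.2 ?_
  change tubeExponent H (s (g • x)) _ 1 = tubeExponent H (s (g • x)) _ 1
  rw [hg, hg]
  exact le_antisymm (hg1 _ Metric.isBounded_closedBall) (hg2 _ Metric.isBounded_closedBall)

omit [StandardBorelSpace X] [MeasurableSMul₂ G X] in
/-- The transverse exponent is almost surely constant. -/
theorem IsRegularFamily.exists_ae_tubeExponent_eq [IsProbabilityMeasure μ] [H.Normal]
    (hs : IsRegularFamily μ s)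
    (hdist : ∀ g h k : G, dist (g * k) (h * k) = dist g h) (hα0 : 0 < α) (hα1 : α < 1)
    (hsim : ∀ g h : G, dist (αG g) (αG h) = α * dist g h) (hHα : H.map (αG : G →* G) = H)
    {αX : X ≃ᵐ X} (herg : Ergodic αX μ)
    (heq : ∀ᵐ x ∂μ, ∃ c : ℝ≥0∞, c ≠ 0 ∧ c ≠ ∞ ∧ s (αX x) = c • (s x).map αG) :
    ∃ τ : EReal, ∀ᵐ x ∂μ, tubeExponent H (s x) (Metric.closedBall 1 1) 1 = τ := by
  have hinv : ∀ᵐ x ∂μ, tubeExponent H (s (αX x)) (Metric.closedBall 1 1) 1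
      = tubeExponent H (s x) (Metric.closedBall 1 1) 1 := by
    -- The contraction carries the unit window to `closedBall 1 α` and tubes of radius `ρ` to radius
    -- `α * ρ`; neither change affects the exponent.
    filter_upwards [heq, herg.quasiMeasurePreserving.ae
      (hs.ae_tubeExponent_eq (H := H) hdist hα0 hα1 hsim one_pos hα0)] with x ⟨c, h0, ht, hc⟩ hx
    rw [hx]
    refine (liminf_logRatio_comp_mul hα0 hα1 (monotone_measure_inter_cosetTube (H := H) (s (αX x))
      (Metric.closedBall 1 α) 1)).symm.trans ?_
    refine Eq.trans ?_ (liminf_logRatio_const_mul hα0 hα1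
      (monotone_measure_inter_cosetTube (H := H) (s x) (Metric.closedBall 1 1) 1) h0 ht)
    refine congrArg (fun m => liminf (logRatio m) (𝓝[>] 0)) (funext fun ρ => ?_)
    rw [hc, Measure.smul_apply, smul_eq_mul, Measure.map_apply
      (continuous_of_similarity hα0 hsim).measurable
      (Metric.isClosed_closedBall.measurableSet.inter isOpen_cosetTube.measurableSet),
      preimage_closedBall_inter_cosetTube_of_similarity hα0 hsim hHα]
  obtain ⟨τ, hτ⟩ := herg.ae_eq_const_of_ae_eq_comp₀
    (hs.measurable_tubeExponent (H := H) hα0 hα1 1).nullMeasurable hinv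
  exact ⟨τ, hτ⟩

omit [StandardBorelSpace X] [MeasurableSMul₂ G X] in
lemma IsRegularFamily.ae_ae_tubeExponent_eq [H.Normal] (hs : IsRegularFamily μ s)
    (hdist : ∀ g h k : G, dist (g * k) (h * k) = dist g h) (hα0 : 0 < α) (hα1 : α < 1)
    (hsim : ∀ g h : G, dist (αG g) (αG h) = α * dist g h) {τ : EReal}
    (hτ : ∀ᵐ x ∂μ, tubeExponent H (s x) (Metric.closedBall 1 1) 1 = τ)
    {B : Set G} (hB : IsCompact B) :
    ∀ᵐ x ∂μ, ∀ᵐ g ∂(s x), g ∈ B → tubeExponent H (s x) B g = τ := by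
  filter_upwards [hs.ae_ae_tubeExponent_smul (H := H) hdist hα0 hα1, hs.ae_finite,
    hs.ae_of_ae _ hτ] with x hx hfin hxτ
  filter_upwards [hx, hxτ,
    ae_forall_tubeExponent_closedBall_le (H := H) (s := s x) hdist hα0 hα1 hsim one_pos,
    ae_forall_tubeExponent_le (H := H) (s := s x) hdist hα0 hα1 hsim hB] with g hg hgτ hg1 hg2 hgB
  rw [← hgτ, hg]
  exact le_antisymm (hg2 hgB _ Metric.isBounded_closedBall) (hg1 _ hB.isBounded)

/-- `G ⧸ H` carries the quotient σ-algebra, so measurability there is by definition measurability of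
the preimage. -/
lemma measurable_quotientGroup_coe {G : Type*} [Group G] [MeasurableSpace G] (H : Subgroup G) :
    Measurable fun g : G => (g : G ⧸ H) := fun _ h => h

omit [ProperSpace G] [IsTopologicalGroup G] in
lemma transverseMeasure_quotientBall [H.Normal]
    (hdist : ∀ g h k : G, dist (g * k) (h * k) = dist g h) (s : Measure G) {B : Set G}
    (hB : MeasurableSet B) (g : G) (ρ : ℝ) :
    transverseMeasure H s B (quotientBall H (g : G ⧸ H) ρ)
      = (s B)⁻¹ * s (B ∩ cosetTube H g ρ) := by
  have hpre : (fun u : G => (u : G ⧸ H)) ⁻¹' quotientBall H (g : G ⧸ H) ρ = cosetTube H g ρ := by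
    ext u
    exact mem_quotientBall_iff hdist
  have hm : MeasurableSet (quotientBall H (g : G ⧸ H) ρ) := by
    change MeasurableSet ((fun u : G => (u : G ⧸ H)) ⁻¹' quotientBall H (g : G ⧸ H) ρ)
    rw [hpre]
    exact isOpen_cosetTube.measurableSet
  rw [transverseMeasure, Measure.map_apply (measurable_quotientGroup_coe H) hm, hpre, cond_apply hB]

lemma measurable_measure_inter_cosetTube
    (hdist : ∀ g h k : G, dist (g * k) (h * k) = dist g h) {s : Measure G} {B : Set G}
    (hB : s B ≠ ∞) (ρ : ℝ) : Measurable fun g => s (B ∩ cosetTube H g ρ) := by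
  have : IsFiniteMeasure (s.restrict B) := ⟨by rw [Measure.restrict_apply_univ]; exact hB.lt_top⟩
  have hm : MeasurableSet {p : G × G | p.2 ∈ cosetTube H p.1 ρ} := by
    have hset : {p : G × G | p.2 ∈ cosetTube H p.1 ρ}
        = (fun p : G × G => p.2 * p.1⁻¹) ⁻¹' cosetTube H 1 ρ := by
      ext p
      exact mem_cosetTube_iff_mul_inv hdist
    rw [hset]
    exact (isOpen_cosetTube.preimage
      (by fun_prop : Continuous fun p : G × G => p.2 * p.1⁻¹)).measurableSet
  have h1 := measurable_measure_prodMk_left (ν := s.restrict B) hm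
  convert h1 using 2 with g
  change _ = s.restrict B (cosetTube H g ρ)
  rw [Measure.restrict_apply isOpen_cosetTube.measurableSet, Set.inter_comm]

lemma IsDisintegrationAlong.ae_ae_transverse [IsFiniteMeasure μ] [H.Normal]
    (hstab : HasDiscreteStabilizers G X) {σ : X → Measure G} (hσ : IsDisintegrationAlong μ σ)
    (hsσ : ∀ᵐ x ∂μ, ∃ c : ℝ≥0∞, c ≠ 0 ∧ c ≠ ∞ ∧ σ x = c • s x)
    (hs : IsRegularFamily μ s)
    (hdist : ∀ g h k : G, dist (g * k) (h * k) = dist g h) (hα0 : 0 < α) (hα1 : α < 1)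
    (hsim : ∀ g h : G, dist (αG g) (αG h) = α * dist g h) {d : ℝ}
    (hd : ∀ᵐ x ∂μ, tubeExponent H (s x) (Metric.closedBall 1 1) 1 = d) :
    IsTransverseDimension H μ d := by
  intro σ' hσ' B hB _
  filter_upwards [hσ.ae_eq_smul hstab hσ' hsσ, hs.ae_finite,
    hs.ae_ae_tubeExponent_eq hdist hα0 hα1 hsim hd hB] with x ⟨c, h0, ht, hc⟩ hfin hx
  have hBtop : σ' x B ≠ ∞ := by
    rw [hc]
    exact ENNReal.mul_ne_top ht hB.measure_lt_top.ne
  -- If `B` has zero mass, the conditioned measure is zero and the claim is vacuous.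
  rcases eq_or_ne (σ' x B) 0 with hB0 | hB0
  · rw [transverseMeasure, cond_eq_zero_of_meas_eq_zero hB0, Measure.map_zero]
    simp
  have key : ∀ g : G, liminf (logRatio fun ρ => transverseMeasure H (σ' x) B
      (quotientBall H (g : G ⧸ H) ρ)) (𝓝[>] 0) = tubeExponent H (σ' x) B g := by
    intro g
    simp_rw [transverseMeasure_quotientBall hdist (σ' x) hB.measurableSet]
    exact liminf_logRatio_const_mul hα0 hα1 (monotone_measure_inter_cosetTube _ _ _)
      (ENNReal.inv_ne_zero.2 hBtop) (ENNReal.inv_ne_top.2 hB0)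
  have hmeas : MeasurableSet {q : G ⧸ H | liminf (logRatio fun ρ => transverseMeasure H (σ' x) B
      (quotientBall H q ρ)) (𝓝[>] 0) = d} := by
    have h1 : Measurable fun g => tubeExponent H (σ' x) B g :=
      measurable_liminf_logRatio hα0 hα1 (fun _ => monotone_measure_inter_cosetTube _ _ _)
        fun n => measurable_measure_inter_cosetTube hdist hBtop _
    have h2 : MeasurableSet {g : G | tubeExponent H (σ' x) B g = d} :=
      h1 (measurableSet_singleton _)
    simp_rw [← key] at h2
    exact h2
  change ∀ᵐ q ∂(Measure.map (fun g : G => (g : G ⧸ H)) (cond (σ' x) B)), _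
  rw [ae_map_iff (measurable_quotientGroup_coe H).aemeasurable hmeas]
  have h1 : ∀ᵐ g ∂(σ' x), g ∈ B → tubeExponent H (σ' x) B g = d := by
    rw [hc, Measure.ae_ennreal_smul_measure_iff h0]
    filter_upwards [hx] with g hg hgB
    rw [tubeExponent_smul hα0 hα1 h0 ht, hg hgB]
  filter_upwards [cond_absolutelyContinuous.ae_le h1, ae_cond_mem hB.measurableSet] with g hg hgB
  rw [key, hg hgB]

end Transverse


/-! ### Comparison of the dimensions -/

section Comparison

lemma eventually_two_mul_le_of_lt_liminf_logRatio {m : ℝ → ℝ≥0∞} {t t' : ℝ} (ht : t' < t)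
    (h : (t : EReal) < liminf (logRatio m) (𝓝[>] 0)) :
    ∀ᶠ ρ in 𝓝[>] (0 : ℝ), m (2 * ρ) ≤ ENNReal.ofReal (ρ ^ t') := by
  have h2 : Tendsto (fun ρ : ℝ => 2 * ρ) (𝓝[>] 0) (𝓝[>] 0) := by
    refine tendsto_nhdsWithin_iff.2 ⟨?_, ?_⟩
    · have : Tendsto (fun ρ : ℝ => 2 * ρ) (𝓝 0) (𝓝 (2 * 0)) := tendsto_id.const_mul 2
      rw [mul_zero] at this
      exact this.mono_left nhdsWithin_le_nhds
    · filter_upwards [self_mem_nhdsWithin] with ρ (hρ : 0 < ρ)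
      exact mul_pos two_pos hρ
  filter_upwards [h2.eventually (eventually_le_of_lt_liminf_logRatio h),
    eventually_rpow_absorb (c := 2 ^ t) ht, self_mem_nhdsWithin] with ρ h3 h4 (hρ : 0 < ρ)
  refine h3.trans (ENNReal.ofReal_le_ofReal ?_)
  rwa [Real.mul_rpow two_pos.le hρ.le]

variable {G : Type*} [Group G] [MetricSpace G] [ProperSpace G]
  [MeasurableSpace G] [BorelSpace G] {α : ℝ} {H : Subgroup G}

/-- At a typical `h`, the ball of radius `ρ` has `s`-mass at most `ρ ^ (dH - ε)` times that of a
tube, itself at most `ρ ^ d`. The successive margins `ε / 4` and `ε / 2` absorb the doubled radius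
and leave room for Borel–Cantelli. -/
lemma add_le_of_exponents (hα0 : 0 < α) (hα1 : α < 1)
    (s : Measure G) [IsFiniteMeasureOnCompacts s] (t : Measure H) [SFinite t] (ht0 : t ≠ 0)
    {dG dH d : ℝ}
    (hG : ∀ᵐ h : H ∂t,
      Tendsto (logRatio fun ρ => s (Metric.ball (h : G) ρ)) (𝓝[>] 0) (𝓝 (dG : EReal)))
    (hH : ∀ᵐ h : H ∂t,
      Tendsto (logRatio fun ρ => t (Metric.ball h ρ)) (𝓝[>] 0) (𝓝 (dH : EReal)))
    (hd : ∀ᵐ h : H ∂t, (d : EReal) < tubeExponent H s (Metric.closedBall (h : G) 1) h) :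
    dH + d ≤ dG := by
  refine le_of_forall_pos_le_add fun ε hε => ?_
  have hab : ENNReal.ofReal (α ^ (dH - ε / 2)) < ENNReal.ofReal (α ^ (dH - ε)) := by
    rw [ENNReal.ofReal_lt_ofReal_iff (Real.rpow_pos_of_pos hα0 _)]
    exact Real.rpow_lt_rpow_of_exponent_gt hα0 hα1 (by linarith)
  have hsmall : ∀ᵐ h : H ∂t, ∀ᶠ n : ℕ in atTop,
      t (Metric.ball h (2 * α ^ n)) ≤ ENNReal.ofReal (α ^ (dH - ε / 2)) ^ n := by
    filter_upwards [hH] with h hh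
    have h1 : ((dH - ε / 4 : ℝ) : EReal) < liminf (logRatio fun ρ => t (Metric.ball h ρ)) (𝓝[>] 0) := by
      rw [hh.liminf_eq, EReal.coe_lt_coe_iff]
      linarith
    filter_upwards [eventually_scale_mem hα0 hα1
      (eventually_two_mul_le_of_lt_liminf_logRatio (show dH - ε / 2 < dH - ε / 4 by linarith) h1)]
      with n hn
    rwa [ofReal_rpow_pow hα0]
  have : (ae t).NeBot := ae_neBot.2 ht0
  obtain ⟨h, h1, h2, h3⟩ := ((ae_ball_le_pow_mul_tube hα0 hα1 s t hab ENNReal.ofReal_ne_top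
    hsmall).and (hG.and hd)).exists
  have h4 := le_liminf_logRatio hα0 hα1 (m := fun ρ => s (Metric.ball (h : G) ρ))
    (t := dH - ε + d) (fun a b hab => measure_mono (Metric.ball_subset_ball hab))
    ENNReal.one_ne_top (by
      filter_upwards [h1, eventually_scale_mem hα0 hα1 (eventually_le_of_lt_liminf_logRatio h3)]
        with n hn1 hn2
      -- The tube around `h` is the tube around `1`, as `h` lies in `H`.
      rw [← mul_one (h : G), cosetTube_mul_left h.2, mul_one] at hn2
      rw [one_mul, ← ofReal_pow_mul_rpow hα0]
      exact hn1.trans (mul_le_mul_right hn2 _))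
  rw [h2.liminf_eq, EReal.coe_le_coe_iff] at h4
  linarith

end Comparison

section Subgroup

variable {G X : Type*} [Group G] [MulAction G X]

lemma HasDiscreteStabilizers.subgroup [TopologicalSpace G] (hstab : HasDiscreteStabilizers G X)
    (H : Subgroup G) : HasDiscreteStabilizers H X := by
  intro x
  obtain ⟨V, hV, h⟩ := hstab x
  refine ⟨(↑) ⁻¹' V, continuous_subtype_val.continuousAt.preimage_mem_nhds hV, fun g hg hgx => ?_⟩
  exact Subtype.ext (h g hg hgx)

lemma Subgroup.measurableSMul₂ [MeasurableSpace G] [MeasurableSpace X] [MeasurableSMul₂ G X]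
    (H : Subgroup G) : MeasurableSMul₂ H X :=
  ⟨(measurable_subtype_coe.comp measurable_fst).smul measurable_snd⟩

end Subgroup

/-! ### Comparison at one base point and conclusion -/

section Main

variable {G X : Type*} [Group G] [MetricSpace G] [ProperSpace G] [IsTopologicalGroup G]
  [MeasurableSpace G] [BorelSpace G]
  [MeasurableSpace X] [StandardBorelSpace X] [MulAction G X] [MeasurableSMul₂ G X]
  {μ : Measure X} [IsProbabilityMeasure μ] {α : ℝ} {αG : G ≃* G} {αX : X ≃ᵐ X}

theorem IsDisintegrationAlong.exists_exactDimensional (hstab : HasDiscreteStabilizers G X)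
    {σ : X → Measure G} (hσ : IsDisintegrationAlong μ σ)
    (hequiv : ∀ (g : G) (x : X), αX (g • x) = αG g • αX x)
    (hdist : ∀ g h k : G, dist (g * k) (h * k) = dist g h) (hα0 : 0 < α) (hα1 : α < 1)
    (hsim : ∀ g h : G, dist (αG g) (αG h) = α * dist g h) (herg : Ergodic αX μ) :
    ∃ (s : X → Measure G) (d : ℝ), IsRegularFamily μ s ∧
      (∀ᵐ x ∂μ, ∃ c : ℝ≥0∞, c ≠ 0 ∧ c ≠ ∞ ∧ σ x = c • s x) ∧
      (∀ᵐ x ∂μ, ∃ c : ℝ≥0∞, c ≠ 0 ∧ c ≠ ∞ ∧ s (αX x) = c • (s x).map αG) ∧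
      (∀ᵐ x ∂μ, Tendsto (logRatio fun ρ => s x (Metric.ball 1 ρ)) (𝓝[>] 0) (𝓝 (d : EReal))) := by
  obtain ⟨s, hs, hsσ⟩ := hσ.exists_regularFamily hstab
  have heq := IsRegularFamily.ae_equivariant hstab hσ hsσ herg.toMeasurePreserving hequiv
    (continuous_of_similarity hα0 hsim) (continuous_symm_of_similarity hα0 hsim)
  obtain ⟨d, hd⟩ := hs.exists_dimension hdist hα0 hα1 hsim herg heq
  exact ⟨s, d, hs, hsσ, heq, hd⟩

omit [IsTopologicalGroup G] [BorelSpace G] in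
lemma tubeExponent_closedBall_nonneg (hα0 : 0 < α) (hα1 : α < 1) {H : Subgroup G}
    (m : Measure G) [IsFiniteMeasureOnCompacts m] (g : G) (r : ℝ) :
    0 ≤ tubeExponent H m (Metric.closedBall g r) g := by
  have h := le_liminf_logRatio hα0 hα1 (t := 0)
    (monotone_measure_inter_cosetTube (H := H) m (Metric.closedBall g r) g)
    (isCompact_closedBall g r).measure_lt_top.ne (Eventually.of_forall fun n => by
      rw [Real.rpow_zero, ENNReal.ofReal_one, mul_one]
      exact measure_mono Set.inter_subset_left)
  rwa [EReal.coe_zero] at h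

-- One generic `x` suffices. For `t x`-almost every `h`, the point `h • x` is generic for the
-- `G`-family as well, and translating back by `h` gives the exponents of the single measure `s x`
-- at `h`.
omit [StandardBorelSpace X] [MeasurableSMul₂ G X] in
lemma add_le_of_regularFamilies {H : Subgroup G} [ProperSpace H]
    (hdist : ∀ g h k : G, dist (g * k) (h * k) = dist g h) (hα0 : 0 < α) (hα1 : α < 1)
    {s : X → Measure G} {t : X → Measure H} (hs : IsRegularFamily μ s) (ht : IsRegularFamily μ t)
    {dG dH d : ℝ} {τ : EReal}
    (hG : ∀ᵐ x ∂μ, Tendsto (logRatio fun ρ => s x (Metric.ball 1 ρ)) (𝓝[>] 0) (𝓝 (dG : EReal)))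
    (hH : ∀ᵐ x ∂μ, Tendsto (logRatio fun ρ => t x (Metric.ball 1 ρ)) (𝓝[>] 0) (𝓝 (dH : EReal)))
    (hτ : ∀ᵐ x ∂μ, tubeExponent H (s x) (Metric.closedBall 1 1) 1 = τ) (hd : (d : EReal) < τ) :
    dH + d ≤ dG := by
  obtain ⟨X₀, hX₀, htr⟩ := hs.exists_ae_translate
  obtain ⟨x, hx, hfin, htfin, ht0, htH, htx⟩ := (Filter.Eventually.and hX₀ (hs.ae_finite.and
    (ht.ae_finite.and (ht.ae_ne_zero.and ((ht.ae_ae_tendsto_logRatio_ball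
      (fun g h k => hdist g h k) hα0 hα1 hH).and
      (ht.ae_of_ae _ (Filter.Eventually.and hX₀ (hG.and hτ)))))))).exists
  have : IsLocallyFiniteMeasure (t x) := isLocallyFiniteMeasure_of_isFiniteMeasureOnCompacts
  refine add_le_of_exponents hα0 hα1 (s x) (t x) ht0 ?_ htH ?_
  · filter_upwards [htx] with h ⟨h1, h2, _⟩
    obtain ⟨c, h0, hct, hc⟩ := htr x hx h h1
    exact tendsto_logRatio_of_eq_mul hα0 hα1
      (fun a b hab => measure_mono (Metric.ball_subset_ball hab)) h0 hct
      (measure_ball_one_of_translate hdist hc) h2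
  · filter_upwards [htx] with h ⟨h1, _, h2⟩
    obtain ⟨c, h0, hct, hc⟩ := htr x hx h h1
    rw [← tubeExponent_one_of_translate hdist hα0 hα1 h0 hct hc]
    exact hd.trans_eq h2.symm

end Main

theorem mainTheorem7 {G X : Type*}
    [Group G] [MetricSpace G] [IsTopologicalGroup G] [LocallyCompactSpace G]
    [SecondCountableTopology G] [MeasurableSpace G] [BorelSpace G]
    [MeasurableSpace X] [StandardBorelSpace X] [MulAction G X] [MeasurableSMul₂ G X]
    (hstab : HasDiscreteStabilizers G X)
    (μ : Measure X) [IsProbabilityMeasure μ]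
    (αX : X ≃ᵐ X) (αG : G ≃* G)
    (hequiv : ∀ (g : G) (x : X), αX (g • x) = αG g • αX x)
    (hdist : ∀ g h k : G, dist (g * k) (h * k) = dist g h)
    (α : ℝ) (hα0 : 0 < α) (hα1 : α < 1)
    (hsim : ∀ g h : G, dist (αG g) (αG h) = α * dist g h)
    (herg : Ergodic αX μ)
    (H : Subgroup G) [H.Normal] (hHclosed : IsClosed (H : Set G))
    (hHα : H.map (αG : G →* G) = H)
    (σG : X → Measure G) (hσG : IsDisintegrationAlong μ σG)
    (σH : X → Measure H) (hσH : IsDisintegrationAlong μ σH) :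
    ∃ dimG dimH dimT : ℝ,
      IsDimensionAlong G μ dimG ∧ IsDimensionAlong H μ dimH ∧
      IsTransverseDimension H μ dimT ∧
      dimH + dimT ≤ dimG := by
  have := properSpace_of_contracting hdist hα0 hα1 hsim
  have : ProperSpace H := .of_isClosed hHclosed
  have := H.measurableSMul₂ (X := X)
  let αH : H ≃* H := (αG.subgroupMap H).trans (MulEquiv.subgroupCongr hHα)
  have hHdist : ∀ g h k : H, dist (g * k) (h * k) = dist g h := fun g h k => hdist g h k
  obtain ⟨s, dG, hs, hsσ, hsα, hdG⟩ :=
    hσG.exists_exactDimensional hstab hequiv hdist hα0 hα1 hsim herg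
  obtain ⟨t, dH, ht, htσ, -, hdH⟩ := hσH.exists_exactDimensional (αG := αH) (hstab.subgroup H)
    (fun g x => hequiv g x) hHdist hα0 hα1 (fun g h => hsim g h) herg
  obtain ⟨τ, hτ⟩ := hs.exists_ae_tubeExponent_eq hdist hα0 hα1 hsim hHα herg hsα
  have hle : ∀ d : ℝ, (d : EReal) < τ → dH + d ≤ dG := fun d hd =>
    add_le_of_regularFamilies hdist hα0 hα1 hs ht hdG hdH hτ hd
  have hτ0 : 0 ≤ τ := by
    obtain ⟨x, hx, hfin⟩ := (hτ.and hs.ae_finite).exists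
    rw [← hx]
    exact tubeExponent_closedBall_nonneg hα0 hα1 _ _ _
  -- The inequality itself excludes an infinite transverse exponent, since it bounds every real `d`
  -- below `τ`.
  have hτtop : τ ≠ ⊤ := fun h => by
    have := hle (dG - dH + 1) (by rw [h]; exact EReal.coe_lt_top _)
    linarith
  lift τ to ℝ using ⟨hτtop, (EReal.bot_lt_zero.trans_le hτ0).ne'⟩
  refine ⟨dG, dH, τ, hσG.isDimensionAlong hstab hsσ hs hdist hα0 hα1 hdG,
    hσH.isDimensionAlong (hstab.subgroup H) htσ ht hHdist hα0 hα1 hdH,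
    hσG.ae_ae_transverse hstab hsσ hs hdist hα0 hα1 hsim hτ, ?_⟩
  -- The comparison is available only strictly below `τ`; the limit gives the endpoint.
  refine le_of_forall_pos_le_add fun ε hε => ?_
  have := hle (τ - ε) (by rw [EReal.coe_lt_coe_iff]; linarith)
  linarith
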